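/- Let $\mathcal G$ be a connected simple graph on $V=\{1,\dots,N\}$ with neighbourhoods $n_i$, let $|\psi_{\mathcal G}\rangle=\prod_{(i,j)\in E}\mathrm{CZ}^{\{i,j\}}|+\rangle^{\otimes N}$ be its graph state and $G_i=X_i\bigotimes_{j\in n_i}Z_j$ its generators. Consider a family of stabilizers $S^l=\prod_{i\in C_l}G_i$, where each $C_l\subseteq V$ contains no two adjacent vertices, so that $S^l=\bigotimes_i M^l_i$ with $M^l_i\in\{X,Z,\mathbb I\}$; put $s^l_i=1,-1,0$ if $M^l_i=X,Z,\mathbb I$ respectively. Let $\mathcal P\neq\varnothing$ be a finite set of pairs of labels, $\mathcal R$ a finite set of labels, and $\mathcal{AC}\subseteq V$ a set such that (1) for every $(l,k)\in\mathcal P$ there is exactly one $T\in\mathcal{AC}$ with $s^l_Ts^k_T=-1$, and $s^l_i=s^k_i=0$ for all other $i\in\mathcal{AC}$; (2) $s^r_i=0$ for every $r\in\mathcal R$ and $i\in\mathcal{AC}$. Let $\mathcal{ST}$ be the set of all stabilizers whose label occurs in $\mathcal P$ or $\mathcal R$. A strategy consists of a density operator $\rho$ on a tensor product of $N$ local (finite-dimensional,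 of arbitrary dimension) Hilbert spaces, and for each party $i$ two binary observables $A_i,B_i$ (Hermitian, $A_i^2=B_i^2=\mathbb I$). Its Bell value is $$\sum_{(l,k)\in\mathcal P}\ \sum_{j\in\{l,k\}}\Big\langle\bigotimes_i F_i^j\Big\rangle_\rho+\sum_{r\in\mathcal R}\Big\langle\bigotimes_i F^r_i\Big\rangle_\rho ,$$ where $F^j_i=\mathbb I$ if $s^j_i=0$; $F^j_i=A_i+s^j_iB_i$ if $i\in\mathcal{AC}$ and $s^j_i\ne0$; and, if $i\notin\mathcal{AC}$, $F^j_i=A_i$ for $s_i^j=1$ and $F^j_i=B_i$ for $s_i^j=-1$. The Bell inequality self-tests $\psi_{\mathcal G}$ if for every strategy that attains the maximal quantum value (the maximum over all strategies) there are local isometries $\Phi=\bigotimes_i\Phi_i$ and a state $\sigma$ such that, for every choice, for each party $i$, of $O_i\in\{A_i,B_i,\mathbb I\}$, $$\Phi\Big(\bigotimes_i O_i\Big)\rho\,\Phi^\dagger=\Big(\bigotimes_i \widehat O_i\Big)|\psi_{\mathcal G}\rangle\langle\psi_{\mathcal G}|\otimes\sigma ,$$ where $\widehat{\mathbb I}=\mathbb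 I$, $\widehat A_i=\frac{X_i+Z_i}{\sqrt2}$, $\widehat B_i=\frac{X_i-Z_i}{\sqrt2}$ for $i\in\mathcal{AC}$ and $\widehat A_i=X_i$, $\widehat B_i=Z_i$ for $i\notin\mathcal{AC}$. Theorem. The following are equivalent: (a) the Bell inequality self-tests $\psi_{\mathcal G}$; (b) the stabilizers in $\mathcal{ST}$ determine $\psi_{\mathcal G}$, i.e. $|\psi_{\mathcal G}\rangle\langle\psi_{\mathcal G}|$ is the only $N$-qubit density operator on which every stabilizer in $\mathcal{ST}$ has expectation value $1$; (c) $\mathcal{ST}$ contains $N$ independent stabilizers, i.e. $N$ stabilizers none of which is a product of the others. Moreover, if the stabilizers in $\mathcal{ST}$ do not determine $\psi_{\mathcal G}$, then there is a strategy attaining the maximal quantum value whose (mixed) state $\rho$ cannot be mapped by local isometries to $|\psi_{\mathcal G}\rangle\langle\psi_{\mathcal G}|\otimes\sigma$ for any state $\sigma$. -/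

import Mathlib

open Matrix
open scoped ComplexOrder

/-! ### Tensor products of matrices, Pauli matrices, graph states -/

/-- The tensor product of a family of local operators `M v`, as a matrix indexed by the product
bases: the entry at `(x, y)` is the product of the local entries. -/
def tensorOp {N : ℕ} {α β : Fin N → Type*} (M : ∀ v, Matrix (α v) (β v) ℂ) :
    Matrix (∀ v, α v) (∀ v, β v) ℂ :=
  Matrix.of fun x y => ∏ v, M v (x v) (y v)

/-- The Pauli matrix `X`. -/
def pauliX : Matrix (Fin 2) (Fin 2) ℂ := !![0, 1; 1, 0]

/-- The Pauli matrix `Z`. -/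
def pauliZ : Matrix (Fin 2) (Fin 2) ℂ := !![1, 0; 0, -1]

/-- The Pauli matrix encoded by a sign: `1 ↦ X`, `-1 ↦ Z`, `0 ↦ 𝕀`. -/
def pauliOf (s : SignType) : Matrix (Fin 2) (Fin 2) ℂ :=
  if s = 1 then pauliX else if s = -1 then pauliZ else 1

/-- The basis `Fin N → Fin 2` of the space of `N` qubits. -/
abbrev Qubits (N : ℕ) : Type := Fin N → Fin 2

/-- The graph state `∏_{(i,j) ∈ E} CZ^{i,j} |+⟩^{⊗ N}`: every amplitude of `|+⟩^{⊗ N}` is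
`(1/√2)^N`, and `CZ^{i,j}` multiplies the amplitude at `x` by `-1` if `x i = x j = 1`. -/
noncomputable def graphState {N : ℕ} (G : SimpleGraph (Fin N)) [DecidableRel G.Adj] :
    Qubits N → ℂ :=
  fun x => (∏ i, ∏ j, if i < j ∧ G.Adj i j ∧ x i = 1 ∧ x j = 1 then (-1 : ℂ) else 1) *
    ((1 / Real.sqrt 2 : ℝ) : ℂ) ^ N

/-- The projector `|ψ_G⟩⟨ψ_G|`. -/
noncomputable def graphProj {N : ℕ} (G : SimpleGraph (Fin N)) [DecidableRel G.Adj] :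
    Matrix (Qubits N) (Qubits N) ℂ :=
  Matrix.vecMulVec (graphState G) (star (graphState G))

/-- A density matrix: positive semidefinite of trace one. -/
def IsDensity {ι : Type*} [Fintype ι] (ρ : Matrix ι ι ℂ) : Prop :=
  ρ.PosSemidef ∧ ρ.trace = 1

/-! ### Stabilizers -/

/-- The generator `G_i = X_i ⨂_{j ∈ n_i} Z_j`. -/
def generator {N : ℕ} (G : SimpleGraph (Fin N)) [DecidableRel G.Adj] (i : Fin N) :
    Matrix (Qubits N) (Qubits N) ℂ :=
  tensorOp fun v => if v = i then pauliX else if G.Adj i v then pauliZ else 1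

/-- The stabilizer `∏_{i ∈ C} G_i`. -/
def stabilizer {N : ℕ} (G : SimpleGraph (Fin N)) [DecidableRel G.Adj] (C : Finset (Fin N)) :
    Matrix (Qubits N) (Qubits N) ℂ :=
  (((List.finRange N).filter (· ∈ C)).map (generator G)).prod

/-- The sequence `(s_v)` of the stabilizer `∏_{i ∈ C} G_i`, for an independent set `C`. -/
def settings {N : ℕ} (G : SimpleGraph (Fin N)) [DecidableRel G.Adj] (C : Finset (Fin N))
    (v : Fin N) : SignType :=
  if v ∈ C then 1 else if Odd (C.filter fun i => G.Adj i v).card then -1 else 0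

theorem tensorOp_mul {N : ℕ} (M M' : Fin N → Matrix (Fin 2) (Fin 2) ℂ) :
    tensorOp M * tensorOp M' = tensorOp fun v => M v * M' v := by
  ext x y
  simp only [tensorOp, Matrix.mul_apply, Matrix.of_apply, ← Finset.prod_mul_distrib]
  rw [Finset.prod_univ_sum, Fintype.piFinset_univ]

theorem tensorOp_one {N : ℕ} :
    tensorOp (fun _ : Fin N => (1 : Matrix (Fin 2) (Fin 2) ℂ)) = 1 := by
  ext x y
  simp only [tensorOp, Matrix.of_apply, Matrix.one_apply]
  by_cases h : x = y
  · simp [h]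
  · obtain ⟨v, hv⟩ := Function.ne_iff.mp h
    rw [if_neg h]
    exact Finset.prod_eq_zero (Finset.mem_univ v) (by simp [hv])

theorem pauliZ_mul_pauliZ : pauliZ * pauliZ = 1 := by
  ext i j
  fin_cases i <;> fin_cases j <;> simp [pauliZ]

/-- For an independent set `C`, the sequence `settings G C` describes the stabilizer. -/
theorem stabilizer_eq {N : ℕ} (G : SimpleGraph (Fin N)) [DecidableRel G.Adj]
    (C : Finset (Fin N)) (hC : G.IsIndepSet (C : Set (Fin N))) :
    stabilizer G C = tensorOp fun v => pauliOf (settings G C v) := by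
  have key : ∀ l : List (Fin N), l.Nodup → G.IsIndepSet (l.toFinset : Set (Fin N)) →
      (l.map (generator G)).prod = tensorOp fun v => pauliOf (settings G l.toFinset v) := by
    intro l
    induction l with
    | nil =>
      intro _ _
      simpa [settings, pauliOf] using (tensorOp_one (N := N)).symm
    | cons i l ih =>
      intro hnd hind
      have hi : i ∉ l := (List.nodup_cons.mp hnd).1
      have hadj : ∀ j ∈ l, ¬ G.Adj i j := by
        intro j hj
        exact hind (by simp) (by simp [hj]) (fun e => hi (e ▸ hj))
      have hadj2 : ∀ j ∈ l, ¬ G.Adj j i := fun j hj h => hadj j hj h.symm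
      rw [List.map_cons, List.prod_cons, ih (List.nodup_cons.mp hnd).2
        (hind.mono (by simp)), generator, tensorOp_mul]
      congr 1
      funext v
      have hfi : (i : Fin N) ∉ l.toFinset := by simpa using hi
      by_cases hvi : v = i
      · subst hvi
        have he : l.toFinset.filter (fun j => G.Adj j v) = ∅ := by
          ext j; simp only [Finset.mem_filter, List.mem_toFinset]; simp; exact hadj2 j
        simp [settings, pauliOf, hi, he]
      · by_cases hvl : v ∈ l
        · simp [settings, pauliOf, hvi, hvl, hadj v hvl]
        · by_cases ha : G.Adj i v
          · have hcard : ((insert i l.toFinset).filter fun j => G.Adj j v).card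
                = (l.toFinset.filter fun j => G.Adj j v).card + 1 := by
              rw [Finset.filter_insert, if_pos ha, Finset.card_insert_of_notMem (by simp [hi])]
            by_cases ho : Odd (l.toFinset.filter fun j => G.Adj j v).card
            · have hn : ¬ Odd ((l.toFinset.filter fun j => G.Adj j v).card + 1) := by
                rw [Nat.odd_add_one]; exact not_not.mpr ho
              simp [settings, pauliOf, hvi, hvl, ha, hcard, ho, hn, pauliZ_mul_pauliZ]
            · have hn : Odd ((l.toFinset.filter fun j => G.Adj j v).card + 1) := by
                rw [Nat.odd_add_one]; exact ho
              simp [settings, pauliOf, hvi, hvl, ha, hcard, ho, hn]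
          · have hf : (insert i l.toFinset).filter (fun j => G.Adj j v)
                = l.toFinset.filter fun j => G.Adj j v := by
              rw [Finset.filter_insert, if_neg ha]
            simp [settings, pauliOf, hvi, hvl, ha, hf]
  have hl : ((List.finRange N).filter (· ∈ C)).toFinset = C := by
    ext v; simp
  have h := key ((List.finRange N).filter (· ∈ C)) ((List.nodup_finRange N).filter _)
    (by rw [hl]; exact hC)
  rw [hl] at h
  exact h

/-! ### The Bell inequalities -/

/-- The data of a Bell inequality for the graph `G`: stabilizers `S^l = ∏_{i ∈ C_l} G_i` labelled
by `l : L`, each generated by pairwise non-adjacent vertices, a set `P` of pairs of labels, a set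
`R` of labels, and a vertex set `AC` that is suitable for `P` and `R`. -/
structure BellData {N : ℕ} (G : SimpleGraph (Fin N)) [DecidableRel G.Adj] (L : Type*) where
  C : L → Finset (Fin N)
  indep : ∀ l, G.IsIndepSet (C l : Set (Fin N))
  P : Finset (L × L)
  R : Finset L
  AC : Finset (Fin N)
  /-- Each pair is pairable at exactly one position of `AC`; both are `𝕀` on the rest of `AC`. -/
  pair_AC : ∀ p ∈ P, ∃ T ∈ AC, settings G (C p.1) T * settings G (C p.2) T = -1 ∧
    ∀ i ∈ AC, i ≠ T → settings G (C p.1) i = 0 ∧ settings G (C p.2) i = 0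
  /-- The remaining stabilizers are `𝕀` on `AC`. -/
  rest_AC : ∀ r ∈ R, ∀ i ∈ AC, settings G (C r) i = 0

/-- A quantum strategy of `N` parties: a (mixed) state on the tensor product of the local Hilbert
spaces `ℂ^(d v)`, and two binary observables (Hermitian with square `1`) for each party. -/
structure Strategy (N : ℕ) where
  d : Fin N → ℕ
  ρ : Matrix (∀ v, Fin (d v)) (∀ v, Fin (d v)) ℂ
  density : IsDensity ρ
  A : ∀ v, Matrix (Fin (d v)) (Fin (d v)) ℂ
  B : ∀ v, Matrix (Fin (d v)) (Fin (d v)) ℂ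
  A_herm : ∀ v, (A v).IsHermitian
  B_herm : ∀ v, (B v).IsHermitian
  A_sq : ∀ v, A v * A v = 1
  B_sq : ∀ v, B v * B v = 1

/-- The observable chosen by a sign: `1 ↦ A_v`, `-1 ↦ B_v`, `0 ↦ 𝕀`. -/
def Strategy.obs {N : ℕ} (Q : Strategy N) (v : Fin N) (s : SignType) :
    Matrix (Fin (Q.d v)) (Fin (Q.d v)) ℂ :=
  if s = 1 then Q.A v else if s = -1 then Q.B v else 1

/-- The expectation value `tr (ρ M)`, real for Hermitian `M`. -/
noncomputable def Strategy.expect {N : ℕ} (Q : Strategy N)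
    (M : Matrix (∀ v, Fin (Q.d v)) (∀ v, Fin (Q.d v)) ℂ) : ℝ :=
  (Q.ρ * M).trace.re

namespace BellData

variable {N : ℕ} {G : SimpleGraph (Fin N)} [DecidableRel G.Adj] {L : Type*}

/-- The factor of party `v` in the correlation of the stabilizer `S^l`: on `AC` the Pauli
operators `X`, `Z` are replaced by `A + B`, `A - B`, elsewhere by `A`, `B`; `𝕀` is kept. -/
def factor (D : BellData G L) (Q : Strategy N) (l : L) (v : Fin N) :
    Matrix (Fin (Q.d v)) (Fin (Q.d v)) ℂ :=
  if v ∈ D.AC then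
    if settings G (D.C l) v = 1 then Q.A v + Q.B v
    else if settings G (D.C l) v = -1 then Q.A v - Q.B v else 1
  else Q.obs v (settings G (D.C l) v)

/-- The correlation of the stabilizer `S^l`. -/
noncomputable def corr (D : BellData G L) (Q : Strategy N) (l : L) : ℝ :=
  Q.expect (tensorOp (D.factor Q l))

/-- The Bell value `∑_{(l,k) ∈ P} B_{l,k} + ∑_{r ∈ R} B_r` of a strategy. -/
noncomputable def value (D : BellData G L) (Q : Strategy N) : ℝ :=
  ∑ p ∈ D.P, (D.corr Q p.1 + D.corr Q p.2) + ∑ r ∈ D.R, D.corr Q r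

/-- The strategy attains the maximal quantum value of the Bell expression. -/
def IsMaximal (D : BellData G L) (Q : Strategy N) : Prop :=
  ∀ Q₁ : Strategy N, D.value Q₁ ≤ D.value Q

/-- The prescribed qubit observables: `1 ↦ (X+Z)/√2`, `-1 ↦ (X-Z)/√2` on `AC`, and `1 ↦ X`,
`-1 ↦ Z` elsewhere; `0 ↦ 𝕀`. -/
noncomputable def refObs (D : BellData G L) (v : Fin N) (s : SignType) :
    Matrix (Fin 2) (Fin 2) ℂ :=
  if v ∈ D.AC then
    if s = 1 then ((1 / Real.sqrt 2 : ℝ) : ℂ) • (pauliX + pauliZ)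
    else if s = -1 then ((1 / Real.sqrt 2 : ℝ) : ℂ) • (pauliX - pauliZ) else 1
  else pauliOf s

end BellData

/-- The operator `M ⊗ σ` on `⨂_v (ℂ² ⊗ ℂ^(m v))`, where `M` acts on the `N` qubits and `σ` on the
remaining factors. -/
def joint {N : ℕ} {m : Fin N → ℕ} (M : Matrix (Qubits N) (Qubits N) ℂ)
    (σ : Matrix (∀ v, Fin (m v)) (∀ v, Fin (m v)) ℂ) :
    Matrix (∀ v, Fin 2 × Fin (m v)) (∀ v, Fin 2 × Fin (m v)) ℂ :=
  Matrix.of fun x y =>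
    M (fun v => (x v).1) (fun v => (y v).1) * σ (fun v => (x v).2) (fun v => (y v).2)

/-- Local isometries `U_v : ℂ^(d v) → ℂ² ⊗ ℂ^(m v)` map the state of `Q` to `ψ_G ⊗ σ`. -/
def StateEquivalent {N : ℕ} (G : SimpleGraph (Fin N)) [DecidableRel G.Adj]
    (Q : Strategy N) : Prop :=
  ∃ (m : Fin N → ℕ) (U : ∀ v, Matrix (Fin 2 × Fin (m v)) (Fin (Q.d v)) ℂ)
    (σ : Matrix (∀ v, Fin (m v)) (∀ v, Fin (m v)) ℂ),
    (∀ v, (U v)ᴴ * U v = 1) ∧ IsDensity σ ∧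
    tensorOp U * Q.ρ * (tensorOp U)ᴴ = joint (graphProj G) σ

namespace BellData

variable {N : ℕ} {G : SimpleGraph (Fin N)} [DecidableRel G.Adj] {L : Type*}

/-- Local isometries map the state and the observables of `Q` to the graph state (with an extra
state `σ`) and the prescribed observables: for each choice `s` of one of `A_v`, `B_v`, `𝕀` for
every party, `O_s ρ` is mapped to `(P_s |ψ_G⟩⟨ψ_G|) ⊗ σ`. The case `s = 0` is `StateEquivalent`. -/
def Equivalent (D : BellData G L) (Q : Strategy N) : Prop :=
  ∃ (m : Fin N → ℕ) (U : ∀ v, Matrix (Fin 2 × Fin (m v)) (Fin (Q.d v)) ℂ)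
    (σ : Matrix (∀ v, Fin (m v)) (∀ v, Fin (m v)) ℂ),
    (∀ v, (U v)ᴴ * U v = 1) ∧ IsDensity σ ∧
    ∀ s : Fin N → SignType,
      tensorOp U * (tensorOp (fun v => Q.obs v (s v)) * Q.ρ) * (tensorOp U)ᴴ =
        joint (tensorOp (fun v => D.refObs v (s v)) * graphProj G) σ

/-- The Bell inequality self-tests the graph state: every strategy attaining the maximal quantum
value is equivalent to the graph state with the prescribed observables. -/
def SelfTests (D : BellData G L) : Prop :=
  ∀ Q : Strategy N, D.IsMaximal Q → D.Equivalent Q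

/-- The set `ST` of all stabilizers that occur in `P` or in `R`. -/
def ST (D : BellData G L) : Set (Matrix (Qubits N) (Qubits N) ℂ) :=
  {M | ∃ l, M = stabilizer G (D.C l) ∧ (l ∈ D.R ∨ ∃ p ∈ D.P, l = p.1 ∨ l = p.2)}

/-- The stabilizers in `ST` determine the graph state: it is the only `N`-qubit state on which
all of them have expectation value `1`. -/
def Determines (D : BellData G L) : Prop :=
  ∀ ρ : Matrix (Qubits N) (Qubits N) ℂ,
    (IsDensity ρ ∧ ∀ M ∈ D.ST, (ρ * M).trace = 1) ↔ ρ = graphProj G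

/-- `ST` contains `N` independent stabilizers: none of them is a product of the others. -/
def ContainsIndependent (D : BellData G L) : Prop :=
  ∃ J : Finset (Matrix (Qubits N) (Qubits N) ℂ), (J : Set _) ⊆ D.ST ∧ J.card = N ∧
    ∀ M ∈ J, M ∉ Submonoid.closure ((J : Set (Matrix (Qubits N) (Qubits N) ℂ)) \ {M})

end BellData

/-!
Every stabilizer `∏_{i ∈ C} G_i` is diagonal in the basis of the states `Z^y |ψ_G⟩`, with
eigenvalue `(-1)^(c ⬝ y)`, where `c` is the indicator vector of `C` over `ZMod 2`. So the family
`ST` becomes a set of vectors in `(ZMod 2)^N`, and the determination of `ψ_G` and the existence of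
`N` independent elements both say that this set spans (`determines_iff_spans`,
`containsIndependent_iff_spans`).

The maximal value of the Bell expression is known from a sum of squares: with `(A ± B) / √2` in the
place of `X`, `Z` on `AC`, and `A`, `B` elsewhere, each stabilizer gives a correlator `E`, and the
value is `2√2 |P| + |R|` minus a positive combination of the expectations of `(E - 1)²`
(`value_eq`). Hence a strategy is maximal exactly if every correlator of `ST` fixes its state
(`isMaximal_iff`, `value_eq_maxValue_iff`).

*Spanning implies self-testing.* The observables of a party in `AC` anticommute on the state, since
`E²` for a correlator with `X` at that party is the identity plus half the local anticommutator.
For the other parties this has to be propagated through the graph. Let `W_v` be the negative of the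
group commutator of the two involutions of party `v`, and consider the subgroup `Λ` of those `e ∈
ℤ^N` for which `⨂_v W_v^(e v)` fixes the state. The commutator of two correlators puts their vector
of conflicts (`X` against `Z` at a position) into `Λ`; conjugation by a correlator flips the signs
of `e` on its support; and `Λ` contains the unit vector at a vertex of `AC`. For a connected graph
and a spanning family this forces `Λ = ℤ^N` (`single_mem_of_conflict_mem`): modulo `2` the
conflicts span, by bilinearity, a space containing `e_i + e_j` for every edge `ij`, so `ℤ^N / Λ` is
divisible by `2`, hence has no `2`-torsion, so `Λ` is stable under restriction to supports and to
classes of vertices that lie in the same supports; inside such a class, which consists of pairwise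
adjacent twins, the conflicts are unit vectors or differences of two of them. Thus all parties have
anticommuting observables on the state (`BellData.siteOp_anticomm_mul_eq_zero`), and the swap
isometries turn them into Pauli matrices (`BellData.equivalent_of_spans`).

*Not spanning excludes self-testing.* If some `y ≠ 0` is orthogonal to all of `ST`, then the equal
mixture of `ψ_G` and `Z^y ψ_G` attains the maximal value with the prescribed qubit observables. It
has no local isometry to `ψ_G ⊗ σ`: an isometry from a qubit has a two-dimensional range, which the
full local support of `ψ_G` uses up, so `σ` would be a pure product state and the mixture would be
pure (`mul_self_eq_self_of_stateEquivalent`).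
-/


/-! ### Tensor products of local operators -/

section Tensor

variable {N : ℕ} {α β γ : Fin N → Type*}

theorem tensorOp_mul_tensorOp [∀ v, Fintype (β v)] (M : ∀ v, Matrix (α v) (β v) ℂ)
    (M' : ∀ v, Matrix (β v) (γ v) ℂ) :
    tensorOp M * tensorOp M' = tensorOp fun v => M v * M' v := by
  classical
  ext x y
  simp only [tensorOp, Matrix.mul_apply, Matrix.of_apply, ← Finset.prod_mul_distrib]
  rw [Finset.prod_univ_sum, Fintype.piFinset_univ]

theorem tensorOp_eq_one [∀ v, DecidableEq (α v)] :
    tensorOp (fun v => (1 : Matrix (α v) (α v) ℂ)) = 1 := by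
  ext x y
  simp only [tensorOp, Matrix.of_apply, Matrix.one_apply]
  by_cases h : x = y
  · simp [h]
  · obtain ⟨v, hv⟩ := Function.ne_iff.mp h
    rw [if_neg h]
    exact Finset.prod_eq_zero (Finset.mem_univ v) (by simp [hv])

theorem conjTranspose_tensorOp (M : ∀ v, Matrix (α v) (β v) ℂ) :
    (tensorOp M)ᴴ = tensorOp fun v => (M v)ᴴ := by
  ext x y
  simp [tensorOp, Matrix.conjTranspose_apply]

theorem tensorOp_isHermitian {M : ∀ v, Matrix (α v) (α v) ℂ} (h : ∀ v, (M v).IsHermitian) :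
    (tensorOp M).IsHermitian := by
  rw [Matrix.IsHermitian, conjTranspose_tensorOp]
  exact congrArg tensorOp (funext fun v => (h v).eq)

theorem tensorOp_smul_factor (c : Fin N → ℂ) (M : ∀ v, Matrix (α v) (β v) ℂ) :
    tensorOp (fun v => c v • M v) = (∏ v, c v) • tensorOp M := by
  ext x y
  simp [tensorOp, Finset.prod_mul_distrib]

theorem tensorOp_update_apply (M : ∀ v, Matrix (α v) (β v) ℂ) (v : Fin N)
    (m : Matrix (α v) (β v) ℂ) (x : ∀ v, α v) (y : ∀ v, β v) :
    tensorOp (Function.update M v m) x y =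
      m (x v) (y v) * ∏ w ∈ Finset.univ.erase v, M w (x w) (y w) := by
  rw [tensorOp, Matrix.of_apply, ← Finset.mul_prod_erase _ _ (Finset.mem_univ v)]
  congr 1
  · simp
  · refine Finset.prod_congr rfl fun w hw => ?_
    rw [Function.update_of_ne (Finset.ne_of_mem_erase hw)]

theorem tensorOp_update_add (M : ∀ v, Matrix (α v) (β v) ℂ) (v : Fin N)
    (m m' : Matrix (α v) (β v) ℂ) :
    tensorOp (Function.update M v (m + m')) =
      tensorOp (Function.update M v m) + tensorOp (Function.update M v m') := by
  ext x y
  simp only [Matrix.add_apply, tensorOp_update_apply, add_mul]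

theorem tensorOp_update_smul (M : ∀ v, Matrix (α v) (β v) ℂ) (v : Fin N) (c : ℂ)
    (m : Matrix (α v) (β v) ℂ) :
    tensorOp (Function.update M v (c • m)) = c • tensorOp (Function.update M v m) := by
  ext x y
  simp only [Matrix.smul_apply, tensorOp_update_apply, smul_eq_mul, mul_assoc]

variable [∀ v, DecidableEq (α v)]

/-- The operator that acts as `m` at the site `v` and trivially on the other tensor factors. -/
def siteOp (v : Fin N) (m : Matrix (α v) (α v) ℂ) : Matrix (∀ v, α v) (∀ v, α v) ℂ :=
  tensorOp (Function.update (fun _ => 1) v m)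

theorem siteOp_one (v : Fin N) : siteOp v (1 : Matrix (α v) (α v) ℂ) = 1 := by
  rw [siteOp, Function.update_eq_self_iff.mpr rfl, tensorOp_eq_one]

theorem siteOp_add (v : Fin N) (m m' : Matrix (α v) (α v) ℂ) :
    siteOp v (m + m') = siteOp v m + siteOp v m' :=
  tensorOp_update_add _ _ _ _

theorem siteOp_smul (v : Fin N) (c : ℂ) (m : Matrix (α v) (α v) ℂ) :
    siteOp v (c • m) = c • siteOp v m :=
  tensorOp_update_smul _ _ _ _

theorem siteOp_neg (v : Fin N) (m : Matrix (α v) (α v) ℂ) :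
    siteOp v (-m) = -siteOp v m := by
  simpa using siteOp_smul v (-1) m

theorem siteOp_sub (v : Fin N) (m m' : Matrix (α v) (α v) ℂ) :
    siteOp v (m - m') = siteOp v m - siteOp v m' := by
  rw [sub_eq_add_neg, siteOp_add, siteOp_neg, ← sub_eq_add_neg]

variable [∀ v, Fintype (α v)]

theorem siteOp_mul (v : Fin N) (m m' : Matrix (α v) (α v) ℂ) :
    siteOp v m * siteOp v m' = siteOp v (m * m') := by
  rw [siteOp, siteOp, siteOp, tensorOp_mul_tensorOp]
  congr 1
  funext w
  by_cases h : w = v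
  · subst h; simp
  · simp [h]

/-- A state fixed by a local operator at every site is fixed by their tensor product. -/
theorem tensorOp_mul_eq_self {κ : Type*} {p : ∀ v, Matrix (α v) (α v) ℂ}
    {ρ : Matrix (∀ v, α v) κ ℂ} (h : ∀ v, siteOp v (p v) * ρ = ρ) : tensorOp p * ρ = ρ := by
  have key : ∀ s : Finset (Fin N), tensorOp (fun v => if v ∈ s then p v else 1) * ρ = ρ := by
    intro s
    induction s using Finset.induction_on with
    | empty => simp [tensorOp_eq_one]
    | insert v s hv ih =>
      have : tensorOp (fun w => if w ∈ insert v s then p w else 1) =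
          siteOp v (p v) * tensorOp (fun w => if w ∈ s then p w else 1) := by
        rw [siteOp, tensorOp_mul_tensorOp]
        congr 1
        funext w
        by_cases hw : w = v
        · subst hw; simp [hv]
        · simp [hw]
      rw [this, Matrix.mul_assoc, ih, h]
  simpa using key Finset.univ

end Tensor

/-! ### Positive semidefinite matrices -/

section PosSemidef

variable {n : Type*} [Fintype n]

theorem trace_mul_sq_re_nonneg {ρ E : Matrix n n ℂ} (hρ : ρ.PosSemidef) (hE : E.IsHermitian) :
    0 ≤ (ρ * (E * E)).trace.re := by
  have h : (ρ * (E * E)).trace = (E * ρ * Eᴴ).trace := by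
    rw [hE.eq, Matrix.mul_assoc, Matrix.trace_mul_comm E, Matrix.mul_assoc]
  rw [h]
  exact (Complex.le_def.mp (hρ.mul_mul_conjTranspose_same E).trace_nonneg).1

theorem mul_eq_zero_of_conj_eq_zero {m : Type*} [Fintype m] {ρ : Matrix n n ℂ}
    (hρ : ρ.PosSemidef) {E : Matrix m n ℂ} (h : E * ρ * Eᴴ = 0) : E * ρ = 0 := by
  classical
  open scoped MatrixOrder in
  obtain ⟨R, rfl⟩ := CStarAlgebra.nonneg_iff_eq_star_mul_self.mp hρ.nonneg
  rw [star_eq_conjTranspose] at h ⊢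
  have h' : (R * Eᴴ)ᴴ * (R * Eᴴ) = 0 := by
    rw [← h]; simp [Matrix.mul_assoc]
  have h2 := Matrix.conjTranspose_mul_self_eq_zero.mp h'
  have h3 : E * Rᴴ = 0 := by simpa using congrArg Matrix.conjTranspose h2
  rw [← Matrix.mul_assoc, h3, Matrix.zero_mul]

/-- An observable with vanishing second moment annihilates the state. -/
theorem mul_eq_zero_of_trace_mul_sq {ρ E : Matrix n n ℂ} (hρ : ρ.PosSemidef)
    (hE : E.IsHermitian) (h : (ρ * (E * E)).trace.re = 0) : E * ρ = 0 := by
  have h1 : (ρ * (E * E)).trace = (E * ρ * Eᴴ).trace := by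
    rw [hE.eq, Matrix.mul_assoc, Matrix.trace_mul_comm E, Matrix.mul_assoc]
  have hp := hρ.mul_mul_conjTranspose_same E
  refine mul_eq_zero_of_conj_eq_zero hρ (hp.trace_eq_zero_iff.mp ?_)
  have h2 := Complex.le_def.mp hp.trace_nonneg
  rw [h1] at h
  exact Complex.ext h h2.2.symm

/-- The spectral pseudo-inverse of a Hermitian matrix. -/
theorem exists_pseudoInverse [DecidableEq n] {K : Matrix n n ℂ} (hK : K.IsHermitian) :
    ∃ g : Matrix n n ℂ, g.IsHermitian ∧ g * K = K * g ∧ K * g * K = K := by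
  have hs := hK.spectral_theorem
  rw [Unitary.conjStarAlgAut_apply] at hs
  set u : Matrix n n ℂ := (hK.eigenvectorUnitary : Matrix n n ℂ) with hu
  have huu : star u * u = 1 := Unitary.coe_star_mul_self _
  set e : n → ℂ := RCLike.ofReal ∘ hK.eigenvalues with he
  have hmul : ∀ a b : n → ℂ, u * diagonal a * star u * (u * diagonal b * star u) =
      u * diagonal (fun i => a i * b i) * star u := by
    intro a b
    rw [← diagonal_mul_diagonal]
    calc _ = u * diagonal a * (star u * u) * diagonal b * star u := by
          simp only [Matrix.mul_assoc]
      _ = _ := by rw [huu]; simp only [Matrix.mul_assoc, Matrix.one_mul]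
  refine ⟨u * diagonal (fun i => (e i)⁻¹) * star u, ?_, ?_, ?_⟩
  · have : star (fun i => (e i)⁻¹) = fun i => (e i)⁻¹ := by
      funext i; simp [he]
    rw [Matrix.IsHermitian, star_eq_conjTranspose, conjTranspose_mul, conjTranspose_mul,
      conjTranspose_conjTranspose, diagonal_conjTranspose, this, Matrix.mul_assoc]
  · rw [hs, hmul, hmul]
    simp only [mul_comm]
  · rw [hs, hmul, hmul]
    have : (fun i => e i * (e i)⁻¹ * e i) = e := by
      funext i
      exact mul_inv_mul_cancel (e i)
    rw [this]

/-- The projector `p` onto the kernel of a Hermitian matrix `K`. It commutes with everything that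
commutes with `K`, and `1 - p` is a multiple of `K`, so `p` fixes whatever `K` annihilates. -/
theorem exists_kernelProjector [DecidableEq n] {K : Matrix n n ℂ} (hK : K.IsHermitian) :
    ∃ p : Matrix n n ℂ, p.IsHermitian ∧ p * p = p ∧ K * p = 0 ∧
      (∀ M, M * K = K * M → M * p = p * M) ∧ ∃ g, 1 - p = g * K := by
  obtain ⟨g, hg, hcomm, hK'⟩ := exists_pseudoInverse hK
  have hKp : K * (1 - g * K) = 0 := by
    rw [Matrix.mul_sub, Matrix.mul_one, ← Matrix.mul_assoc, hK', sub_self]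
  have hpK : (1 - g * K) * K = 0 := by
    rw [Matrix.sub_mul, Matrix.one_mul, hcomm, hK', sub_self]
  refine ⟨1 - g * K, ?_, ?_, hKp, fun M hM => ?_, g, by simp⟩
  · rw [Matrix.IsHermitian, conjTranspose_sub, conjTranspose_one, conjTranspose_mul, hK.eq, hg.eq,
      hcomm]
  · rw [Matrix.sub_mul, Matrix.mul_assoc, hKp]; simp
  · have h1 : (1 - g * K) * M * (g * K) = 0 := by
      have : (1 - g * K) * M * (K * g) = (1 - g * K) * K * (M * g) := by
        rw [Matrix.mul_assoc, ← Matrix.mul_assoc M, hM]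
        simp only [Matrix.mul_assoc]
      rw [hcomm] at this hpK ⊢
      rw [this, hpK, Matrix.zero_mul]
    have h2 : g * K * M * (1 - g * K) = 0 := by
      rw [Matrix.mul_assoc g, ← hM, Matrix.mul_assoc, Matrix.mul_assoc, hKp]; simp
    have h3 : (1 - g * K) * M * (1 - g * K) = (1 - g * K) * M := by
      rw [Matrix.mul_sub ((1 - g * K) * M), h1]; simp
    have h4 : (1 - g * K) * M * (1 - g * K) = M * (1 - g * K) := by
      rw [Matrix.sub_mul 1, Matrix.sub_mul (1 * M), h2]; simp
    rw [← h4, h3]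

end PosSemidef

/-! ### The graph basis -/

/-- The nontrivial character of `ZMod 2`, with values `±1`. -/
def sgn (a : ZMod 2) : ℂ := if a = 0 then 1 else -1

theorem zmod_two_cases (a : ZMod 2) : a = 0 ∨ a = 1 := by
  revert a; decide

@[simp] theorem sgn_zero : sgn 0 = 1 := if_pos rfl

@[simp] theorem sgn_one : sgn 1 = -1 := if_neg (by decide)

theorem sgn_add (a b : ZMod 2) : sgn (a + b) = sgn a * sgn b := by
  rcases zmod_two_cases a with rfl | rfl <;> rcases zmod_two_cases b with rfl | rfl <;>
    simp [CharTwo.add_self_eq_zero]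

theorem sgn_mul_self (a : ZMod 2) : sgn a * sgn a = 1 := by
  rw [← sgn_add, CharTwo.add_self_eq_zero, sgn_zero]

@[simp] theorem star_sgn (a : ZMod 2) : star (sgn a) = sgn a := by
  rcases zmod_two_cases a with rfl | rfl <;> simp

theorem sgn_sum {ι : Type*} (s : Finset ι) (f : ι → ZMod 2) :
    sgn (∑ i ∈ s, f i) = ∏ i ∈ s, sgn (f i) := by
  classical
  induction s using Finset.induction_on with
  | empty => simp
  | insert i s hi ih => rw [Finset.sum_insert hi, Finset.prod_insert hi, sgn_add, ih]

section GraphBasis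

variable {N : ℕ}

/-- A computational basis label of `N` qubits, read as a vector over the field `ZMod 2`. -/
def bits : Qubits N ≃ (Fin N → ZMod 2) := Equiv.refl _

/-- The indicator vector of a vertex set over `ZMod 2`. -/
def indVec (C : Finset (Fin N)) : Fin N → ZMod 2 := fun i => if i ∈ C then 1 else 0

/-- Orthogonality of the characters of `(ZMod 2)^N`. -/
theorem sum_sgn_dotProduct (z : Fin N → ZMod 2) :
    ∑ x : Qubits N, sgn (bits x ⬝ᵥ z) = if z = 0 then (2 : ℂ) ^ N else 0 := by
  have h1 : ∀ x : Qubits N, sgn (bits x ⬝ᵥ z) = ∏ i, sgn (bits x i * z i) := fun x => by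
    rw [dotProduct, sgn_sum]
  have h2 : ∑ x : Qubits N, ∏ i, sgn (bits x i * z i) =
      ∏ i, ∑ b : ZMod 2, sgn (b * z i) := by
    rw [Finset.prod_univ_sum, Fintype.piFinset_univ]
    rfl
  have h3 : ∀ a : ZMod 2, ∑ b : ZMod 2, sgn (b * a) = if a = 0 then 2 else 0 := by
    intro a
    rw [show (Finset.univ : Finset (ZMod 2)) = {0, 1} from rfl, Finset.sum_pair (by decide)]
    rcases zmod_two_cases a with rfl | rfl <;> norm_num
  simp only [h1, h2, h3]
  rw [Finset.prod_ite_zero]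
  simp [funext_iff]

variable (G : SimpleGraph (Fin N)) [DecidableRel G.Adj]

/-- The number, modulo 2, of edges inside a vertex set: the phase exponent of the graph state. -/
def edgeParity (x : Fin N → ZMod 2) : ZMod 2 :=
  ∑ i, ∑ j, if i < j ∧ G.Adj i j then x i * x j else 0

theorem graphState_eq (x : Qubits N) :
    graphState G x = sgn (edgeParity G (bits x)) * ((1 / Real.sqrt 2 : ℝ) : ℂ) ^ N := by
  rw [graphState, edgeParity, sgn_sum]
  congr 1
  refine Finset.prod_congr rfl fun i _ => ?_
  rw [sgn_sum]
  refine Finset.prod_congr rfl fun j _ => ?_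
  have hb : ∀ i, x i = 0 ∧ bits x i = 0 ∨ x i = 1 ∧ bits x i = 1 := fun i => by
    rcases zmod_two_cases (bits x i) with h | h
    · exact Or.inl ⟨h, h⟩
    · exact Or.inr ⟨h, h⟩
  by_cases h : i < j ∧ G.Adj i j
  · rcases hb i with ⟨h1, h2⟩ | ⟨h1, h2⟩ <;> rcases hb j with ⟨h3, h4⟩ | ⟨h3, h4⟩ <;>
      simp [h, h1, h2, h3, h4]
  · rw [if_neg h, if_neg (fun h' => h ⟨h'.1, h'.2.1⟩), sgn_zero]

/-- Adding the vertex `i` adds the edges between `i` and its neighbours. -/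
theorem edgeParity_add_single (x : Fin N → ZMod 2) (i : Fin N) :
    edgeParity G (x + Pi.single i 1) =
      edgeParity G x + ∑ j, if G.Adj i j then x j else 0 := by
  set e : Fin N → ZMod 2 := Pi.single i 1 with he
  have h : ∀ a b : Fin N,
      (if a < b ∧ G.Adj a b then (x + e) a * (x + e) b else 0) =
      (if a < b ∧ G.Adj a b then x a * x b else 0) +
        ((if a = i then (if i < b ∧ G.Adj i b then x b else 0) else 0) +
        (if b = i then (if a < i ∧ G.Adj i a then x a else 0) else 0)) := by
    intro a b
    by_cases ha : a = i
    · by_cases hb : b = i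
      · subst ha; subst hb; simp
      · subst ha
        by_cases hab : a < b ∧ G.Adj a b
        · simp [hab, hb, he]; ring
        · simp [hab, hb]
    · by_cases hb : b = i
      · subst hb
        by_cases hab : a < b ∧ G.Adj a b
        · simp [ha, hab.1, hab.2, hab.2.symm, he]; ring
        · have : ¬ (a < b ∧ G.Adj b a) := fun h => hab ⟨h.1, h.2.symm⟩
          simp [hab, ha, this]
      · simp [ha, hb, he]
  simp only [edgeParity, h, Finset.sum_add_distrib]
  congr 1
  rw [Finset.sum_comm]
  simp only [Finset.sum_ite_eq', Finset.mem_univ, if_true]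
  rw [← Finset.sum_add_distrib]
  refine Finset.sum_congr rfl fun j _ => ?_
  by_cases hj : G.Adj i j
  · rcases lt_or_gt_of_ne hj.ne with h | h
    · simp [h, hj, h.not_gt]
    · simp [h, hj, h.not_gt]
  · simp [hj]

/-- The matrix whose columns are the states `Z^y |ψ_G⟩`; the column `y = 0` is `ψ_G` itself. It
diagonalizes all stabilizers simultaneously. -/
noncomputable def graphBasis : Matrix (Qubits N) (Qubits N) ℂ :=
  Matrix.of fun x y => graphState G x * sgn (bits x ⬝ᵥ bits y)

theorem graphBasis_apply_zero (x : Qubits N) : graphBasis G x 0 = graphState G x := by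
  have : bits (0 : Qubits N) = 0 := rfl
  simp [graphBasis, this]

theorem star_graphState (x : Qubits N) : star (graphState G x) = graphState G x := by
  rw [graphState_eq, star_mul, star_sgn, star_pow, Complex.star_def, Complex.conj_ofReal, mul_comm]

theorem graphState_mul_self (x : Qubits N) :
    graphState G x * graphState G x = ((2 : ℂ) ^ N)⁻¹ := by
  have : ((1 / Real.sqrt 2 : ℝ) : ℂ) * ((1 / Real.sqrt 2 : ℝ) : ℂ) = 2⁻¹ := by
    rw [← Complex.ofReal_mul, div_mul_div_comm, Real.mul_self_sqrt (by norm_num)]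
    norm_num
  rw [graphState_eq, mul_mul_mul_comm, sgn_mul_self, one_mul, ← mul_pow, this, inv_pow]

theorem graphBasis_conjTranspose_mul : (graphBasis G)ᴴ * graphBasis G = 1 := by
  ext y z
  have h : ∀ x : Qubits N, (graphBasis G)ᴴ y x * graphBasis G x z =
      ((2 : ℂ) ^ N)⁻¹ * sgn (bits x ⬝ᵥ (bits y + bits z)) := by
    intro x
    rw [Matrix.conjTranspose_apply, graphBasis, Matrix.of_apply, Matrix.of_apply, star_mul,
      star_sgn, star_graphState, dotProduct_add, sgn_add, ← graphState_mul_self G x]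
    ring
  rw [Matrix.mul_apply]
  simp only [h]
  rw [← Finset.mul_sum, sum_sgn_dotProduct, Matrix.one_apply]
  have : bits y + bits z = 0 ↔ y = z := by
    rw [← bits.apply_eq_iff_eq (x := y), funext_iff, funext_iff]
    simp [CharTwo.add_eq_zero]
  by_cases hyz : y = z
  · rw [if_pos (this.mpr hyz), if_pos hyz]; simp
  · rw [if_neg (fun h => hyz (this.mp h)), if_neg hyz]; simp

theorem graphBasis_mul_conjTranspose : graphBasis G * (graphBasis G)ᴴ = 1 :=
  mul_eq_one_comm.mp (graphBasis_conjTranspose_mul G)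

/-- `G_i` maps `|y⟩` to `±|y + e_i⟩`, the sign being the parity of `y` on the neighbours of
`i`. -/
theorem generator_apply (i : Fin N) (x y : Qubits N) :
    generator G i x y = if bits y = bits x + Pi.single i 1 then
      sgn (∑ j, if G.Adj i j then bits x j else 0) else 0 := by
  have hX : ∀ a b : ZMod 2, pauliX a b = if b = a + 1 then 1 else 0 := by
    intro a b
    rcases zmod_two_cases a with rfl | rfl <;> rcases zmod_two_cases b with rfl | rfl <;>
      simp [pauliX, CharTwo.add_self_eq_zero] <;> rfl
  have hZ : ∀ a b : ZMod 2, pauliZ a b = if b = a then sgn a else 0 := by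
    intro a b
    rcases zmod_two_cases a with rfl | rfl <;> rcases zmod_two_cases b with rfl | rfl <;>
      simp [pauliZ] <;> rfl
  have hv : ∀ v, (if v = i then pauliX else if G.Adj i v then pauliZ else 1 :
        Matrix (Fin 2) (Fin 2) ℂ) (x v) (y v) =
      if bits y v = bits x v + (Pi.single i 1 : Fin N → ZMod 2) v then
        sgn (if G.Adj i v then bits x v else 0) else 0 := by
    intro v
    by_cases h : v = i
    · subst h
      simp only [if_true, Pi.single_eq_same, SimpleGraph.irrefl, if_false, sgn_zero]
      exact hX (bits x v) (bits y v)
    · by_cases ha : G.Adj i v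
      · simp only [h, ha, if_true, if_false, Pi.single_eq_of_ne h, add_zero]
        exact hZ (bits x v) (bits y v)
      · simp only [h, ha, if_false, Matrix.one_apply]
        simp only [Pi.single_eq_of_ne h, add_zero, sgn_zero]
        exact if_congr eq_comm rfl rfl
  rw [generator, tensorOp, Matrix.of_apply]
  simp only [hv]
  rw [Finset.prod_ite_zero, sgn_sum]
  simp [funext_iff]

/-- The state `Z^y |ψ_G⟩` is an eigenvector of `G_i` with eigenvalue `(-1)^(y i)`. -/
theorem generator_mul_graphBasis (i : Fin N) :
    generator G i * graphBasis G = graphBasis G * diagonal fun y => sgn (bits y i) := by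
  ext x y
  rw [Matrix.mul_diagonal, Matrix.mul_apply,
    Finset.sum_eq_single (bits.symm (bits x + Pi.single i 1))]
  · rw [generator_apply, if_pos (by simp), graphBasis, Matrix.of_apply, Matrix.of_apply,
      graphState_eq, graphState_eq, Equiv.apply_symm_apply, edgeParity_add_single, sgn_add,
      add_dotProduct, sgn_add, single_one_dotProduct]
    have := sgn_mul_self (∑ j, if G.Adj i j then bits x j else 0)
    linear_combination (sgn (edgeParity G (bits x)) * ((1 / Real.sqrt 2 : ℝ) : ℂ) ^ N *
      sgn (bits x ⬝ᵥ bits y) * sgn (bits y i)) * this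
  · intro z _ hz
    rw [generator_apply, if_neg (fun h => hz (by rw [← h, Equiv.symm_apply_apply])), zero_mul]
  · simp

/-- The operator that is diagonal in the graph basis, with eigenvalue `w y` on `Z^y |ψ_G⟩`. -/
noncomputable def graphDiag (w : Qubits N → ℂ) : Matrix (Qubits N) (Qubits N) ℂ :=
  graphBasis G * diagonal w * (graphBasis G)ᴴ

theorem graphDiag_mul (w w' : Qubits N → ℂ) :
    graphDiag G w * graphDiag G w' = graphDiag G fun y => w y * w' y := by
  have : graphDiag G w * graphDiag G w' =
      graphBasis G * diagonal w * ((graphBasis G)ᴴ * graphBasis G) *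
        diagonal w' * (graphBasis G)ᴴ := by
    simp only [graphDiag, Matrix.mul_assoc]
  rw [this, graphBasis_conjTranspose_mul, Matrix.mul_one, Matrix.mul_assoc (graphBasis G),
    diagonal_mul_diagonal, graphDiag]

theorem trace_graphDiag (w : Qubits N → ℂ) : (graphDiag G w).trace = ∑ y, w y := by
  rw [graphDiag, Matrix.trace_mul_comm, ← Matrix.mul_assoc, graphBasis_conjTranspose_mul,
    Matrix.one_mul, Matrix.trace_diagonal]

theorem graphDiag_posSemidef {w : Qubits N → ℂ} (hw : 0 ≤ w) : (graphDiag G w).PosSemidef :=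
  (Matrix.PosSemidef.diagonal hw).mul_mul_conjTranspose_same _

theorem graphDiag_isHermitian {w : Qubits N → ℂ} (hw : star w = w) :
    (graphDiag G w).IsHermitian := by
  rw [Matrix.IsHermitian, graphDiag, conjTranspose_mul, conjTranspose_mul,
    conjTranspose_conjTranspose, diagonal_conjTranspose, hw, Matrix.mul_assoc]

theorem graphDiag_injective : Function.Injective (graphDiag G) := by
  intro w w' h
  have hd : ∀ w, (graphBasis G)ᴴ * graphDiag G w * graphBasis G = diagonal w := by
    intro w
    rw [graphDiag, ← Matrix.mul_assoc, ← Matrix.mul_assoc, graphBasis_conjTranspose_mul,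
      Matrix.one_mul, Matrix.mul_assoc, graphBasis_conjTranspose_mul, Matrix.mul_one]
  exact diagonal_injective ((hd w).symm.trans
    ((congrArg (fun M => (graphBasis G)ᴴ * M * graphBasis G) h).trans (hd w')))

theorem graphProj_eq_graphDiag : graphProj G = graphDiag G (Pi.single 0 1) := by
  ext x y
  rw [graphDiag, Matrix.mul_apply, Finset.sum_eq_single 0]
  · rw [Matrix.mul_diagonal, Pi.single_eq_same, mul_one, conjTranspose_apply, graphBasis_apply_zero,
      graphBasis_apply_zero, graphProj, vecMulVec_apply]
    rfl
  · intro z _ hz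
    rw [Matrix.mul_diagonal, Pi.single_eq_of_ne hz, mul_zero, zero_mul]
  · simp

theorem graphProj_isDensity : IsDensity (graphProj G) := by
  rw [graphProj_eq_graphDiag]
  refine ⟨graphDiag_posSemidef G ?_, ?_⟩
  · intro y
    by_cases h : y = 0
    · subst h; simp
    · simp [h]
  · rw [trace_graphDiag, Finset.sum_pi_single']
    simp

theorem graphProj_mul_self : graphProj G * graphProj G = graphProj G := by
  rw [graphProj_eq_graphDiag, graphDiag_mul]
  congr 1
  funext y
  by_cases h : y = 0
  · subst h; simp
  · simp [h]

/-- The Pauli group element with eigenvalue `(-1)^(c ⬝ y)` on `Z^y |ψ_G⟩`: the product of the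
generators `G_i` with `c i = 1`. -/
noncomputable def stabilizerOf (c : Fin N → ZMod 2) : Matrix (Qubits N) (Qubits N) ℂ :=
  graphDiag G fun y => sgn (c ⬝ᵥ bits y)

theorem stabilizer_eq_stabilizerOf (C : Finset (Fin N)) :
    stabilizer G C = stabilizerOf G (indVec C) := by
  have key : ∀ l : List (Fin N), (l.map (generator G)).prod * graphBasis G =
      graphBasis G * diagonal fun y => (l.map fun i => sgn (bits y i)).prod := by
    intro l
    induction l with
    | nil =>
      simp
    | cons i l ih =>
      rw [List.map_cons, List.prod_cons, Matrix.mul_assoc, ih, ← Matrix.mul_assoc,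
        generator_mul_graphBasis, Matrix.mul_assoc, diagonal_mul_diagonal]
      simp
  have hl : ((List.finRange N).filter (· ∈ C)).toFinset = C := by
    ext v; simp
  have hd : ∀ y : Qubits N, (((List.finRange N).filter (· ∈ C)).map fun i => sgn (bits y i)).prod =
      sgn (indVec C ⬝ᵥ bits y) := by
    intro y
    rw [← List.prod_toFinset _ ((List.nodup_finRange N).filter _), hl, ← sgn_sum, dotProduct]
    simp [indVec]
  rw [stabilizer, stabilizerOf, graphDiag, ← Matrix.mul_one (List.prod _),
    ← graphBasis_mul_conjTranspose G, ← Matrix.mul_assoc, key]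
  simp only [hd]

theorem stabilizerOf_zero : stabilizerOf G 0 = 1 := by
  simp [stabilizerOf, graphDiag, graphBasis_mul_conjTranspose]

theorem stabilizerOf_add (c c' : Fin N → ZMod 2) :
    stabilizerOf G (c + c') = stabilizerOf G c * stabilizerOf G c' := by
  simp only [stabilizerOf, graphDiag_mul, add_dotProduct, sgn_add]

theorem stabilizerOf_mul_self (c : Fin N → ZMod 2) :
    stabilizerOf G c * stabilizerOf G c = 1 := by
  have : c + c = 0 := funext fun i => CharTwo.add_self_eq_zero (c i)
  rw [← stabilizerOf_add, this, stabilizerOf_zero]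

theorem stabilizerOf_isHermitian (c : Fin N → ZMod 2) : (stabilizerOf G c).IsHermitian :=
  graphDiag_isHermitian G (funext fun _ => star_sgn _)

theorem stabilizerOf_injective : Function.Injective (stabilizerOf G) := by
  intro c c' h
  funext i
  have h2 := congrFun (graphDiag_injective G h) (bits.symm (Pi.single i 1))
  simp only [Equiv.apply_symm_apply, dotProduct_single_one] at h2
  rcases zmod_two_cases (c i) with h3 | h3 <;> rcases zmod_two_cases (c' i) with h4 | h4 <;>
    rw [h3, h4] at h2 ⊢ <;> norm_num at h2

theorem trace_graphProj_mul_stabilizerOf (c : Fin N → ZMod 2) :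
    (graphProj G * stabilizerOf G c).trace = 1 := by
  rw [graphProj_eq_graphDiag, stabilizerOf, graphDiag_mul, trace_graphDiag,
    Finset.sum_eq_single 0]
  · have : bits (0 : Qubits N) = 0 := rfl
    simp [this]
  · intro y _ hy; simp [hy]
  · simp

/-- A state on which a stabilizer has expectation value `1` is fixed by that stabilizer. -/
theorem stabilizerOf_mul_eq_self {ρ : Matrix (Qubits N) (Qubits N) ℂ} (hρ : IsDensity ρ)
    {c : Fin N → ZMod 2} (h : (ρ * stabilizerOf G c).trace = 1) : stabilizerOf G c * ρ = ρ := by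
  have h1 : (stabilizerOf G c - 1) * ρ = 0 := by
    refine mul_eq_zero_of_trace_mul_sq hρ.1
      ((stabilizerOf_isHermitian G c).sub Matrix.isHermitian_one) ?_
    have : (stabilizerOf G c - 1) * (stabilizerOf G c - 1) = 1 + 1 - 2 • stabilizerOf G c := by
      rw [Matrix.sub_mul, Matrix.mul_sub, stabilizerOf_mul_self]
      simp only [Matrix.mul_one, Matrix.one_mul, two_smul]
      abel
    rw [this, Matrix.mul_sub, Matrix.mul_add, Matrix.mul_one, Matrix.mul_smul, Matrix.trace_sub,
      Matrix.trace_add, Matrix.trace_smul, h, hρ.2]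
    norm_num
  rwa [Matrix.sub_mul, Matrix.one_mul, sub_eq_zero] at h1

end GraphBasis

/-! ### Spanning families of stabilizers -/

section Spanning

variable {N : ℕ} (G : SimpleGraph (Fin N)) [DecidableRel G.Adj]

/-- The indicator vectors of a family of vertex sets span `(ZMod 2)^N`, that is, the stabilizers
of the family generate the whole stabilizer group. -/
def Spans (𝒞 : Set (Finset (Fin N))) : Prop :=
  Submodule.span (ZMod 2) (indVec '' 𝒞) = ⊤

theorem exists_orthogonal_of_span_ne_top {s : Set (Fin N → ZMod 2)}
    (h : Submodule.span (ZMod 2) s ≠ ⊤) :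
    ∃ y : Fin N → ZMod 2, y ≠ 0 ∧ ∀ c ∈ s, c ⬝ᵥ y = 0 := by
  obtain ⟨f, hf, hle⟩ := Submodule.exists_le_ker_of_lt_top _ (lt_top_iff_ne_top.mpr h)
  have hfy : ∀ c : Fin N → ZMod 2, f c = c ⬝ᵥ fun i => f (Pi.single i 1) := fun c => by
    rw [LinearMap.pi_apply_eq_sum_univ f c]
    simp only [dotProduct, smul_eq_mul]
    refine Finset.sum_congr rfl fun i _ => ?_
    congr 2
    funext j
    simp [Pi.single_apply, eq_comm]
  refine ⟨fun i => f (Pi.single i 1), fun h0 => hf ?_, fun c hc => ?_⟩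
  · refine LinearMap.ext fun c => ?_
    rw [hfy, h0, dotProduct_zero]; rfl
  · rw [← hfy]
    exact hle (Submodule.subset_span hc)

/-- Linear functionals that agree on a spanning family of vertex sets are equal. -/
theorem Spans.linearMap_ext {𝒞 : Set (Finset (Fin N))} (h : Spans 𝒞) {M : Type*} [AddCommGroup M]
    [Module (ZMod 2) M] {f g : (Fin N → ZMod 2) →ₗ[ZMod 2] M}
    (hfg : ∀ C ∈ 𝒞, f (indVec C) = g (indVec C)) : f = g := by
  refine LinearMap.ext_on h ?_
  rintro _ ⟨C, hC, rfl⟩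
  exact hfg C hC

/-- Whatever is fixed by a spanning family of stabilizers is fixed by `|ψ_G⟩⟨ψ_G|`. -/
theorem Spans.graphProj_mul_eq_self {𝒞 : Set (Finset (Fin N))} (h : Spans 𝒞) {κ : Type*}
    {A : Matrix (Qubits N) κ ℂ} (hA : ∀ C ∈ 𝒞, stabilizerOf G (indVec C) * A = A) :
    graphProj G * A = A := by
  have hall : ∀ c, stabilizerOf G c * A = A := by
    intro c
    have hc : c ∈ Submodule.span (ZMod 2) (indVec '' 𝒞) := by rw [h]; trivial
    induction hc using Submodule.span_induction with
    | mem x hx => obtain ⟨C, hC, rfl⟩ := hx; exact hA C hC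
    | zero => rw [stabilizerOf_zero, Matrix.one_mul]
    | add x y _ _ hx hy => rw [stabilizerOf_add, Matrix.mul_assoc, hy, hx]
    | smul a x _ hx =>
      rcases zmod_two_cases a with rfl | rfl
      · rw [zero_smul, stabilizerOf_zero, Matrix.one_mul]
      · rwa [one_smul]
  -- in the graph basis, only the row of `ψ_G` survives
  set B := (graphBasis G)ᴴ * A with hB
  have hAB : A = graphBasis G * B := by
    rw [hB, ← Matrix.mul_assoc, graphBasis_mul_conjTranspose, Matrix.one_mul]
  have hrow : ∀ c y k, sgn (c ⬝ᵥ bits y) * B y k = B y k := by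
    intro c y k
    have h1 : (graphBasis G)ᴴ * (stabilizerOf G c * A) = B := by rw [hall]
    rw [stabilizerOf, graphDiag, Matrix.mul_assoc _ _ A, ← hB, Matrix.mul_assoc,
      ← Matrix.mul_assoc, graphBasis_conjTranspose_mul, Matrix.one_mul] at h1
    have := congrFun (congrFun h1 y) k
    rwa [Matrix.diagonal_mul] at this
  have hB0 : ∀ y k, y ≠ 0 → B y k = 0 := by
    intro y k hy
    obtain ⟨i, hi⟩ := Function.ne_iff.mp hy
    have hi' : bits y i = 1 := (zmod_two_cases (bits y i)).resolve_left hi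
    have := hrow (Pi.single i 1) y k
    rw [single_one_dotProduct, hi', sgn_one] at this
    linear_combination (-1 / 2 : ℂ) * this
  rw [graphProj_eq_graphDiag, graphDiag, Matrix.mul_assoc _ _ A, ← hB]
  conv_rhs => rw [hAB]
  rw [Matrix.mul_assoc]
  congr 1
  ext y k
  rw [Matrix.diagonal_mul]
  by_cases hy : y = 0
  · subst hy; simp
  · rw [hB0 y k hy, mul_zero]

/-- If a family does not span, then some maximally mixed state of a two-dimensional subspace is
stabilized by the whole family. -/
theorem exists_mixed_of_not_spans {𝒞 : Set (Finset (Fin N))} (h : ¬ Spans 𝒞) :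
    ∃ ρ : Matrix (Qubits N) (Qubits N) ℂ, IsDensity ρ ∧ ρ * ρ = (1 / 2 : ℂ) • ρ ∧
      ∀ C ∈ 𝒞, (ρ * stabilizerOf G (indVec C)).trace = 1 := by
  obtain ⟨y, hy, hort⟩ := exists_orthogonal_of_span_ne_top h
  have hyb : bits.symm y ≠ 0 := fun h0 => hy h0
  set z : Qubits N := bits.symm y with hz
  set w : Qubits N → ℂ := fun x => if x = 0 ∨ x = z then 1 / 2 else 0 with hw
  have hsum : ∑ x, w x = 1 := by
    have : ∀ x, w x = (if x = 0 then 1 / 2 else 0) + (if x = z then 1 / 2 else 0) := by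
      intro x
      by_cases h1 : x = 0
      · simp [hw, h1, hyb.symm]
      · simp [hw, h1]
    simp only [this, Finset.sum_add_distrib, Finset.sum_ite_eq', Finset.mem_univ, if_true]
    norm_num
  -- the equal mixture of `ψ_G` and `Z^y ψ_G`
  refine ⟨graphDiag G w, ⟨graphDiag_posSemidef G ?_, ?_⟩, ?_, ?_⟩
  · intro x
    by_cases h1 : x = 0 ∨ x = z
    · simp only [hw, h1, if_true, Pi.zero_apply]
      exact Complex.le_def.mpr (by norm_num)
    · simp [hw, h1]
  · rw [trace_graphDiag, hsum]
  · rw [graphDiag_mul]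
    have : (fun x => w x * w x) = fun x => 1 / 2 * w x := by
      funext x
      by_cases h1 : x = 0 ∨ x = z <;> simp [hw, h1]
    rw [this, graphDiag, graphDiag, ← Matrix.smul_mul, ← Matrix.mul_smul]
    congr 2
    ext i j
    by_cases hij : i = j
    · subst hij; simp
    · simp [hij]
  · intro C hC
    rw [stabilizerOf, graphDiag_mul, trace_graphDiag, ← hsum]
    refine Finset.sum_congr rfl fun x _ => ?_
    by_cases h1 : x = 0
    · have : bits (0 : Qubits N) = 0 := rfl
      simp [h1, this]
    · by_cases h2 : x = z
      · rw [h2, hz, Equiv.apply_symm_apply, hort _ ⟨C, hC, rfl⟩]; simp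
      · simp [hw, h1, h2]

end Spanning

namespace BellData

variable {N : ℕ} {G : SimpleGraph (Fin N)} [DecidableRel G.Adj] {L : Type*}

/-- The labels occurring in `P` or in `R`. -/
def labels (D : BellData G L) : Set L := {l | l ∈ D.R ∨ ∃ p ∈ D.P, l = p.1 ∨ l = p.2}

/-- The generating vertex sets of the stabilizers in `ST`. -/
def rows (D : BellData G L) : Set (Finset (Fin N)) := D.C '' D.labels

theorem mem_ST_iff (D : BellData G L) (M : Matrix (Qubits N) (Qubits N) ℂ) :
    M ∈ D.ST ↔ ∃ C ∈ D.rows, stabilizerOf G (indVec C) = M := by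
  constructor
  · rintro ⟨l, rfl, hl⟩
    exact ⟨D.C l, ⟨l, hl, rfl⟩, (stabilizer_eq_stabilizerOf G _).symm⟩
  · rintro ⟨_, ⟨l, hl, rfl⟩, rfl⟩
    exact ⟨l, (stabilizer_eq_stabilizerOf G _).symm, hl⟩

theorem determines_iff_spans (D : BellData G L) : D.Determines ↔ Spans D.rows := by
  constructor
  · intro h
    by_contra hns
    obtain ⟨ρ, hρ, hsq, htr⟩ := exists_mixed_of_not_spans G hns
    have heq : ρ = graphProj G := by
      refine (h ρ).mp ⟨hρ, fun M hM => ?_⟩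
      obtain ⟨C, hC, rfl⟩ := (D.mem_ST_iff M).mp hM
      exact htr C hC
    -- the mixed state has `tr ρ² = 1/2`, the graph state `1`
    rw [heq, graphProj_mul_self] at hsq
    have := congrArg Matrix.trace hsq
    rw [Matrix.trace_smul, (graphProj_isDensity G).2] at this
    norm_num at this
  · intro h ρ
    constructor
    · rintro ⟨hρ, htr⟩
      have h1 : graphProj G * ρ = ρ := h.graphProj_mul_eq_self G fun C hC =>
        stabilizerOf_mul_eq_self G hρ (htr _ ((D.mem_ST_iff _).mpr ⟨C, hC, rfl⟩))
      have h2 : ρ * graphProj G = ρ := by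
        have := congrArg conjTranspose h1
        rwa [conjTranspose_mul, hρ.1.isHermitian.eq,
          (graphProj_isDensity G).1.isHermitian.eq] at this
      have h3 : ρ = (star (graphState G) ⬝ᵥ ρ *ᵥ graphState G) • graphProj G := by
        conv_lhs => rw [← h2, ← h1]
        rw [graphProj, vecMulVec_mul, vecMulVec_mul_vecMulVec, ← dotProduct_mulVec]
        ext x y
        simp only [vecMulVec_apply, Matrix.smul_apply, Pi.smul_apply, smul_eq_mul]
        ring
      have h4 := congrArg Matrix.trace h3
      rw [Matrix.trace_smul, hρ.2, (graphProj_isDensity G).2, smul_eq_mul, mul_one] at h4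
      rw [h3, ← h4, one_smul]
    · rintro rfl
      refine ⟨graphProj_isDensity G, fun M hM => ?_⟩
      obtain ⟨C, _, rfl⟩ := (D.mem_ST_iff M).mp hM
      exact trace_graphProj_mul_stabilizerOf G _

/-- Under `c ↦ ∏ G_i^(c i)`, products of stabilizers correspond to sums of vectors. -/
theorem stabilizerOf_mem_closure_iff (s : Set (Fin N → ZMod 2)) (c : Fin N → ZMod 2) :
    stabilizerOf G c ∈ Submonoid.closure (stabilizerOf G '' s) ↔
      c ∈ Submodule.span (ZMod 2) s := by
  constructor
  · intro h
    have key : ∀ M ∈ Submonoid.closure (stabilizerOf G '' s),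
        ∃ c ∈ Submodule.span (ZMod 2) s, stabilizerOf G c = M := by
      intro M hM
      induction hM using Submonoid.closure_induction with
      | mem x hx =>
        obtain ⟨c, hc, rfl⟩ := hx
        exact ⟨c, Submodule.subset_span hc, rfl⟩
      | one => exact ⟨0, zero_mem _, stabilizerOf_zero G⟩
      | mul x y _ _ hx hy =>
        obtain ⟨a, ha, rfl⟩ := hx
        obtain ⟨b, hb, rfl⟩ := hy
        exact ⟨a + b, add_mem ha hb, stabilizerOf_add G a b⟩
    obtain ⟨c', hc', he⟩ := key _ h
    rwa [← stabilizerOf_injective G he]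
  · intro h
    induction h using Submodule.span_induction with
    | mem x hx => exact Submonoid.subset_closure ⟨x, hx, rfl⟩
    | zero => rw [stabilizerOf_zero]; exact one_mem _
    | add x y _ _ hx hy => rw [stabilizerOf_add]; exact mul_mem hx hy
    | smul a x _ hx =>
      rcases zmod_two_cases a with rfl | rfl
      · rw [zero_smul, stabilizerOf_zero]; exact one_mem _
      · rwa [one_smul]

theorem containsIndependent_iff_spans (D : BellData G L) :
    D.ContainsIndependent ↔ Spans D.rows := by
  classical
  have hrank : Module.finrank (ZMod 2) (Fin N → ZMod 2) = N := by simp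
  have hST : D.ST = stabilizerOf G '' (indVec '' D.rows) := by
    ext M
    rw [mem_ST_iff, Set.image_image]
    rfl
  constructor
  · rintro ⟨J, hJ, hcard, hind⟩
    set b : Set (Fin N → ZMod 2) := stabilizerOf G ⁻¹' J with hb
    have hJb : (J : Set (Matrix (Qubits N) (Qubits N) ℂ)) = stabilizerOf G '' b := by
      rw [hb, Set.image_preimage_eq_of_subset]
      rw [hST] at hJ
      exact hJ.trans (Set.image_subset_range _ _)
    have hli : LinearIndepOn (ZMod 2) id b := by
      rw [linearIndepOn_iff_notMem_span]
      intro c hc hmem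
      rw [Set.image_id] at hmem
      refine hind _ hc ?_
      rw [hJb, ← Set.image_singleton, ← Set.image_sdiff (stabilizerOf_injective G),
        stabilizerOf_mem_closure_iff]
      exact hmem
    have : Fintype b := Fintype.ofFinite b
    have hbsub : b ⊆ indVec '' D.rows := by
      intro c hc
      obtain ⟨c', hc', he⟩ := hST ▸ hJ hc
      rwa [← stabilizerOf_injective G he]
    have hbcard : Fintype.card b = N := by
      refine Eq.trans ?_ hcard
      rw [← Set.ncard_coe_finset J, hJb,
        Set.ncard_image_of_injective _ (stabilizerOf_injective G), ← Nat.card_eq_fintype_card]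
      rfl
    refine top_unique ?_
    rw [← LinearIndependent.span_eq_top_of_card_eq_finrank' hli (by rw [hbcard, hrank])]
    refine Submodule.span_mono ?_
    rintro _ ⟨x, rfl⟩
    exact hbsub x.2
  · intro h
    obtain ⟨b, hbs, hspan, hli⟩ := exists_linearIndependent (ZMod 2) (indVec '' D.rows)
    have : Fintype b := Fintype.ofFinite b
    have hbcard : Set.ncard b = N := by
      have := finrank_span_eq_card hli
      rw [Subtype.range_coe, hspan, h, finrank_top, hrank] at this
      rw [← Nat.card_coe_set_eq, Nat.card_eq_fintype_card, ← this]
    refine ⟨((Set.toFinite b).image (stabilizerOf G)).toFinset, ?_, ?_, ?_⟩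
    · rw [Set.Finite.coe_toFinset, hST]
      exact Set.image_mono hbs
    · rw [← Set.ncard_eq_toFinset_card _ ((Set.toFinite b).image _),
        Set.ncard_image_of_injective _ (stabilizerOf_injective G), hbcard]
    · rw [Set.Finite.coe_toFinset]
      intro M hM
      rw [Set.Finite.mem_toFinset] at hM
      obtain ⟨c, hc, rfl⟩ := hM
      rw [← Set.image_singleton, ← Set.image_sdiff (stabilizerOf_injective G),
        stabilizerOf_mem_closure_iff]
      have := (linearIndepOn_iff_notMem_span (K := ZMod 2) (v := id) (s := b)).mp hli c hc
      rwa [Set.image_id] at this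

end BellData

/-! ### The maximal quantum value -/

theorem ofReal_inv_sqrt_two_mul_self :
    ((1 / Real.sqrt 2 : ℝ) : ℂ) * ((1 / Real.sqrt 2 : ℝ) : ℂ) = 1 / 2 := by
  rw [← Complex.ofReal_mul, div_mul_div_comm, Real.mul_self_sqrt (by norm_num)]
  norm_num

theorem ofReal_sqrt_two_mul_inv : ((Real.sqrt 2 : ℝ) : ℂ) * ((1 / Real.sqrt 2 : ℝ) : ℂ) = 1 := by
  rw [← Complex.ofReal_mul, mul_one_div_cancel (by positivity)]
  norm_num

theorem sign_cases_of_mul_eq_neg_one {s t : SignType} (h : s * t = -1) :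
    s = 1 ∧ t = -1 ∨ s = -1 ∧ t = 1 := by
  revert s t; decide

theorem pauliX_isHermitian : pauliX.IsHermitian := by
  ext i j; fin_cases i <;> fin_cases j <;> simp [pauliX]

theorem pauliZ_isHermitian : pauliZ.IsHermitian := by
  ext i j; fin_cases i <;> fin_cases j <;> simp [pauliZ]

theorem pauliX_mul_pauliX : pauliX * pauliX = 1 := by
  ext i j; fin_cases i <;> fin_cases j <;> simp [pauliX]

theorem pauliZ_mul_pauliX : pauliZ * pauliX = -(pauliX * pauliZ) := by
  ext i j; fin_cases i <;> fin_cases j <;> simp [pauliX, pauliZ]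

namespace Strategy

variable {N : ℕ} (Q : Strategy N)

theorem obs_isHermitian (v : Fin N) (s : SignType) : (Q.obs v s).IsHermitian := by
  unfold obs
  split_ifs
  · exact Q.A_herm v
  · exact Q.B_herm v
  · exact Matrix.isHermitian_one

theorem obs_mul_self (v : Fin N) (s : SignType) : Q.obs v s * Q.obs v s = 1 := by
  unfold obs
  split_ifs
  · exact Q.A_sq v
  · exact Q.B_sq v
  · exact Matrix.mul_one 1

/-- The anticommutator of the two observables of a party. -/
def anticomm (v : Fin N) : Matrix (Fin (Q.d v)) (Fin (Q.d v)) ℂ :=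
  Q.A v * Q.B v + Q.B v * Q.A v

theorem anticomm_isHermitian (v : Fin N) : (Q.anticomm v).IsHermitian := by
  rw [Matrix.IsHermitian, anticomm, conjTranspose_add, conjTranspose_mul, conjTranspose_mul,
    (Q.A_herm v).eq, (Q.B_herm v).eq, add_comm]

theorem A_mul_anticomm (v : Fin N) : Q.A v * Q.anticomm v = Q.anticomm v * Q.A v := by
  rw [anticomm, Matrix.mul_add, Matrix.add_mul, ← Matrix.mul_assoc, Q.A_sq,
    Matrix.mul_assoc (Q.B v), Q.A_sq, ← Matrix.mul_assoc, Matrix.one_mul, Matrix.mul_one, add_comm]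

theorem B_mul_anticomm (v : Fin N) : Q.B v * Q.anticomm v = Q.anticomm v * Q.B v := by
  rw [anticomm, Matrix.mul_add, Matrix.add_mul, ← Matrix.mul_assoc (Q.B v) (Q.B v), Q.B_sq,
    Matrix.mul_assoc (Q.A v), Q.B_sq, ← Matrix.mul_assoc, Matrix.one_mul, Matrix.mul_one, add_comm]

end Strategy

namespace BellData

variable {N : ℕ} {G : SimpleGraph (Fin N)} [DecidableRel G.Adj] {L : Type*}

/-- The operator of party `v` that plays the role of the Pauli matrix encoded by `s`: on `AC` it is
`(A ± B) / √2`, elsewhere `A` or `B`. -/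
noncomputable def pauliLike (D : BellData G L) (Q : Strategy N) (v : Fin N) (s : SignType) :
    Matrix (Fin (Q.d v)) (Fin (Q.d v)) ℂ :=
  if v ∈ D.AC then
    if s = 1 then ((1 / Real.sqrt 2 : ℝ) : ℂ) • (Q.A v + Q.B v)
    else if s = -1 then ((1 / Real.sqrt 2 : ℝ) : ℂ) • (Q.A v - Q.B v) else 1
  else Q.obs v s

variable (D : BellData G L) (Q : Strategy N)

theorem pauliLike_zero (v : Fin N) : D.pauliLike Q v 0 = 1 := by
  by_cases h : v ∈ D.AC <;> simp [pauliLike, Strategy.obs, h]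

theorem pauliLike_isHermitian (v : Fin N) (s : SignType) : (D.pauliLike Q v s).IsHermitian := by
  have hr : IsSelfAdjoint ((1 / Real.sqrt 2 : ℝ) : ℂ) := Complex.conj_ofReal _
  unfold pauliLike
  split_ifs
  · exact ((Q.A_herm v).add (Q.B_herm v)).smul hr
  · exact ((Q.A_herm v).sub (Q.B_herm v)).smul hr
  · exact Matrix.isHermitian_one
  · exact Q.obs_isHermitian v s

theorem pauliLike_mul_self_of_notMem {v : Fin N} (hv : v ∉ D.AC) (s : SignType) :
    D.pauliLike Q v s * D.pauliLike Q v s = 1 := by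
  rw [pauliLike, if_neg hv, Q.obs_mul_self]

theorem pauliLike_one_mul_self {v : Fin N} (hv : v ∈ D.AC) :
    D.pauliLike Q v 1 * D.pauliLike Q v 1 = 1 + (1 / 2 : ℂ) • Q.anticomm v := by
  rw [pauliLike, if_pos hv, if_pos rfl, Matrix.smul_mul, Matrix.mul_smul, smul_smul,
    ofReal_inv_sqrt_two_mul_self, Matrix.add_mul, Matrix.mul_add, Matrix.mul_add, Q.A_sq, Q.B_sq,
    Strategy.anticomm]
  module

theorem pauliLike_neg_one_mul_self {v : Fin N} (hv : v ∈ D.AC) :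
    D.pauliLike Q v (-1) * D.pauliLike Q v (-1) = 1 - (1 / 2 : ℂ) • Q.anticomm v := by
  rw [pauliLike, if_pos hv, if_neg (by decide), if_pos rfl, Matrix.smul_mul, Matrix.mul_smul,
    smul_smul, ofReal_inv_sqrt_two_mul_self, Matrix.sub_mul, Matrix.mul_sub, Matrix.mul_sub, Q.A_sq,
    Q.B_sq, Strategy.anticomm]
  module

/-- The correlator of the stabilizer `S^l`, normalized so that its ideal value is `1`. -/
noncomputable def normCorr (l : L) : Matrix (∀ v, Fin (Q.d v)) (∀ v, Fin (Q.d v)) ℂ :=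
  tensorOp fun v => D.pauliLike Q v (settings G (D.C l) v)

theorem normCorr_isHermitian (l : L) : (D.normCorr Q l).IsHermitian :=
  tensorOp_isHermitian fun _ => D.pauliLike_isHermitian Q _ _

theorem normCorr_mul_self_rest {r : L} (hr : r ∈ D.R) :
    D.normCorr Q r * D.normCorr Q r = 1 := by
  rw [normCorr, tensorOp_mul_tensorOp, ← tensorOp_eq_one]
  congr 1
  funext v
  by_cases hv : v ∈ D.AC
  · rw [D.rest_AC r hr v hv, pauliLike_zero, Matrix.one_mul]
  · exact D.pauliLike_mul_self_of_notMem Q hv _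

/-- The square of a correlator that is nontrivial at a single vertex of `AC` is local. -/
theorem normCorr_mul_self {l : L} {T : Fin N}
    (hT : ∀ i ∈ D.AC, i ≠ T → settings G (D.C l) i = 0) :
    D.normCorr Q l * D.normCorr Q l =
      siteOp T (D.pauliLike Q T (settings G (D.C l) T) *
        D.pauliLike Q T (settings G (D.C l) T)) := by
  rw [normCorr, tensorOp_mul_tensorOp, siteOp]
  congr 1
  funext v
  by_cases hvT : v = T
  · subst hvT; simp
  · rw [Function.update_of_ne hvT]
    by_cases hv : v ∈ D.AC
    · rw [hT v hv hvT, pauliLike_zero, Matrix.one_mul]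
    · exact D.pauliLike_mul_self_of_notMem Q hv _

/-- The two local squares of a pair are `1 ± {A, B} / 2`, so the anticommutators cancel. -/
theorem normCorr_sq_add_sq {p : L × L} (hp : p ∈ D.P) :
    D.normCorr Q p.1 * D.normCorr Q p.1 + D.normCorr Q p.2 * D.normCorr Q p.2 = (2 : ℂ) • 1 := by
  obtain ⟨T, hT, hs, hz⟩ := D.pair_AC p hp
  rw [D.normCorr_mul_self Q fun i hi hiT => (hz i hi hiT).1,
    D.normCorr_mul_self Q fun i hi hiT => (hz i hi hiT).2, ← siteOp_add, ← siteOp_one T,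
    ← siteOp_smul]
  congr 1
  rcases sign_cases_of_mul_eq_neg_one hs with ⟨h1, h2⟩ | ⟨h1, h2⟩ <;>
    rw [h1, h2, D.pauliLike_one_mul_self Q hT, D.pauliLike_neg_one_mul_self Q hT] <;> module

theorem corr_rest {r : L} (hr : r ∈ D.R) : D.corr Q r = (Q.ρ * D.normCorr Q r).trace.re := by
  have : D.factor Q r = fun v => D.pauliLike Q v (settings G (D.C r) v) := by
    funext v
    by_cases hv : v ∈ D.AC
    · rw [D.rest_AC r hr v hv, pauliLike_zero, factor, if_pos hv, D.rest_AC r hr v hv]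
      simp
    · rw [factor, if_neg hv, pauliLike, if_neg hv]
  rw [corr, Strategy.expect, this, normCorr]

theorem corr_of_pair {l : L} {T : Fin N} (hT : T ∈ D.AC) (hTl : settings G (D.C l) T ≠ 0)
    (hz : ∀ i ∈ D.AC, i ≠ T → settings G (D.C l) i = 0) :
    D.corr Q l = Real.sqrt 2 * (Q.ρ * D.normCorr Q l).trace.re := by
  have h : D.factor Q l = Function.update
      (fun v => D.pauliLike Q v (settings G (D.C l) v)) T
      (((Real.sqrt 2 : ℝ) : ℂ) • D.pauliLike Q T (settings G (D.C l) T)) := by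
    funext v
    by_cases hvT : v = T
    · subst hvT
      rw [Function.update_self, factor, if_pos hT, pauliLike, if_pos hT]
      have hc : settings G (D.C l) v = 1 ∨ settings G (D.C l) v = -1 := by
        revert hTl; generalize settings G (D.C l) v = s; revert s; decide
      rcases hc with h1 | h1
      · rw [h1, if_pos rfl, if_pos rfl, smul_smul, ofReal_sqrt_two_mul_inv, one_smul]
      · rw [h1, if_neg (by decide), if_pos rfl, if_neg (by decide), if_pos rfl, smul_smul,
          ofReal_sqrt_two_mul_inv, one_smul]
    · rw [Function.update_of_ne hvT]
      by_cases hv : v ∈ D.AC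
      · rw [hz v hv hvT, pauliLike_zero, factor, if_pos hv, hz v hv hvT]
        simp
      · rw [factor, if_neg hv, pauliLike, if_neg hv]
  rw [corr, Strategy.expect, h, tensorOp_update_smul, Function.update_eq_self, Matrix.mul_smul,
    Matrix.trace_smul, smul_eq_mul, Complex.re_ofReal_mul, normCorr]

/-- The expectation value of `(E - 1)²` for a normalized correlator `E`: a measure of how far the
state is from being stabilized by `E`. -/
noncomputable def slack (l : L) : ℝ :=
  (Q.ρ * ((D.normCorr Q l - 1) * (D.normCorr Q l - 1))).trace.re

theorem normCorr_sub_one_isHermitian (l : L) : (D.normCorr Q l - 1).IsHermitian :=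
  (D.normCorr_isHermitian Q l).sub Matrix.isHermitian_one

theorem slack_nonneg (l : L) : 0 ≤ D.slack Q l :=
  trace_mul_sq_re_nonneg Q.density.1 (D.normCorr_sub_one_isHermitian Q l)

theorem slack_eq_zero_iff (l : L) : D.slack Q l = 0 ↔ D.normCorr Q l * Q.ρ = Q.ρ := by
  rw [← sub_eq_zero (a := D.normCorr Q l * Q.ρ)]
  have h : D.normCorr Q l * Q.ρ - Q.ρ = (D.normCorr Q l - 1) * Q.ρ := by
    rw [Matrix.sub_mul, Matrix.one_mul]
  rw [h]
  refine ⟨mul_eq_zero_of_trace_mul_sq Q.density.1 (D.normCorr_sub_one_isHermitian Q l),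
    fun h0 => ?_⟩
  rw [slack, Matrix.trace_mul_comm, Matrix.mul_assoc, h0, Matrix.mul_zero]
  simp

theorem slack_eq (l : L) : D.slack Q l =
    (Q.ρ * (D.normCorr Q l * D.normCorr Q l)).trace.re + 1 -
      2 * (Q.ρ * D.normCorr Q l).trace.re := by
  have : (D.normCorr Q l - 1) * (D.normCorr Q l - 1) =
      D.normCorr Q l * D.normCorr Q l + 1 - (2 : ℂ) • D.normCorr Q l := by
    rw [Matrix.sub_mul, Matrix.mul_sub, Matrix.mul_one, Matrix.one_mul]
    module
  rw [slack, this, Matrix.mul_sub, Matrix.mul_add, Matrix.mul_one, Matrix.mul_smul,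
    Matrix.trace_sub, Matrix.trace_add, Matrix.trace_smul, Q.density.2]
  simp

theorem corr_rest_eq {r : L} (hr : r ∈ D.R) : D.corr Q r = 1 - D.slack Q r / 2 := by
  rw [slack_eq, D.normCorr_mul_self_rest Q hr, Matrix.mul_one, Q.density.2, D.corr_rest Q hr,
    Complex.one_re]
  ring

theorem corr_pair_eq {p : L × L} (hp : p ∈ D.P) :
    D.corr Q p.1 + D.corr Q p.2 =
      2 * Real.sqrt 2 - (D.slack Q p.1 + D.slack Q p.2) * (Real.sqrt 2 / 2) := by
  obtain ⟨T, hT, hs, hz⟩ := D.pair_AC p hp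
  have h0 : settings G (D.C p.1) T ≠ 0 ∧ settings G (D.C p.2) T ≠ 0 := by
    rcases sign_cases_of_mul_eq_neg_one hs with ⟨h1, h2⟩ | ⟨h1, h2⟩ <;> rw [h1, h2] <;> decide
  have hsum := congrArg (fun M => (Q.ρ * M).trace.re) (D.normCorr_sq_add_sq Q hp)
  simp only [Matrix.mul_add, Matrix.trace_add, Complex.add_re, Matrix.mul_smul, Matrix.mul_one,
    Matrix.trace_smul, Q.density.2] at hsum
  rw [D.corr_of_pair Q hT h0.1 fun i hi hiT => (hz i hi hiT).1,
    D.corr_of_pair Q hT h0.2 fun i hi hiT => (hz i hi hiT).2, slack_eq, slack_eq]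
  have h2 : ((2 : ℂ) • (1 : ℂ)).re = 2 := by norm_num
  rw [h2] at hsum
  linear_combination (Real.sqrt 2 / 2) * hsum

/-- The quantum maximum of the Bell expression. -/
noncomputable def maxValue : ℝ := D.P.card * (2 * Real.sqrt 2) + D.R.card

/-- A sum-of-squares decomposition of the Bell operator, evaluated in the state. -/
theorem value_eq : D.value Q = D.maxValue -
    ((∑ p ∈ D.P, (D.slack Q p.1 + D.slack Q p.2) * (Real.sqrt 2 / 2)) +
      ∑ r ∈ D.R, D.slack Q r / 2) := by
  rw [value, Finset.sum_congr rfl fun p hp => D.corr_pair_eq Q hp,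
    Finset.sum_congr rfl fun r hr => D.corr_rest_eq Q hr, Finset.sum_sub_distrib,
    Finset.sum_sub_distrib, maxValue]
  simp
  ring

theorem value_le_maxValue : D.value Q ≤ D.maxValue := by
  rw [value_eq, sub_le_self_iff]
  refine add_nonneg (Finset.sum_nonneg fun p _ => ?_) (Finset.sum_nonneg fun r _ => ?_)
  · exact mul_nonneg (add_nonneg (D.slack_nonneg Q _) (D.slack_nonneg Q _)) (by positivity)
  · exact div_nonneg (D.slack_nonneg Q _) (by norm_num)

theorem value_eq_maxValue_iff :
    D.value Q = D.maxValue ↔ ∀ l ∈ D.labels, D.normCorr Q l * Q.ρ = Q.ρ := by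
  simp only [← slack_eq_zero_iff]
  have h2 : (0 : ℝ) < Real.sqrt 2 / 2 := by positivity
  have hP : ∀ p ∈ D.P, 0 ≤ (D.slack Q p.1 + D.slack Q p.2) * (Real.sqrt 2 / 2) := fun p _ =>
    mul_nonneg (add_nonneg (D.slack_nonneg Q _) (D.slack_nonneg Q _)) h2.le
  have hR : ∀ r ∈ D.R, 0 ≤ D.slack Q r / 2 := fun r _ =>
    div_nonneg (D.slack_nonneg Q _) (by norm_num)
  rw [value_eq, sub_eq_self, add_eq_zero_iff_of_nonneg (Finset.sum_nonneg hP)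
    (Finset.sum_nonneg hR), Finset.sum_eq_zero_iff_of_nonneg hP,
    Finset.sum_eq_zero_iff_of_nonneg hR]
  constructor
  · rintro ⟨h1, h3⟩ l (hl | ⟨p, hp, hl⟩)
    · have := h3 l hl
      linarith
    · have := (mul_eq_zero.mp (h1 p hp)).resolve_right h2.ne'
      have ha := D.slack_nonneg Q p.1
      have hb := D.slack_nonneg Q p.2
      rcases hl with rfl | rfl <;> linarith
  · intro h
    refine ⟨fun p hp => ?_, fun r hr => ?_⟩
    · rw [h p.1 (Or.inr ⟨p, hp, Or.inl rfl⟩), h p.2 (Or.inr ⟨p, hp, Or.inr rfl⟩)]; simp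
    · rw [h r (Or.inl hr)]; simp

/-! ### The reference strategy -/

theorem refObs_isHermitian (v : Fin N) (s : SignType) : (D.refObs v s).IsHermitian := by
  have hr : IsSelfAdjoint ((1 / Real.sqrt 2 : ℝ) : ℂ) := Complex.conj_ofReal _
  unfold refObs pauliOf
  split_ifs
  · exact (pauliX_isHermitian.add pauliZ_isHermitian).smul hr
  · exact (pauliX_isHermitian.sub pauliZ_isHermitian).smul hr
  · exact Matrix.isHermitian_one
  · exact pauliX_isHermitian
  · exact pauliZ_isHermitian
  · exact Matrix.isHermitian_one

theorem refObs_mul_self (v : Fin N) (s : SignType) : D.refObs v s * D.refObs v s = 1 := by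
  unfold refObs pauliOf
  split_ifs
  · rw [Matrix.smul_mul, Matrix.mul_smul, smul_smul, ofReal_inv_sqrt_two_mul_self, Matrix.add_mul,
      Matrix.mul_add, Matrix.mul_add, pauliX_mul_pauliX, pauliZ_mul_pauliZ, pauliZ_mul_pauliX]
    module
  · rw [Matrix.smul_mul, Matrix.mul_smul, smul_smul, ofReal_inv_sqrt_two_mul_self, Matrix.sub_mul,
      Matrix.mul_sub, Matrix.mul_sub, pauliX_mul_pauliX, pauliZ_mul_pauliZ, pauliZ_mul_pauliX]
    module
  · exact Matrix.mul_one 1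
  · exact pauliX_mul_pauliX
  · exact pauliZ_mul_pauliZ
  · exact Matrix.mul_one 1

/-- The strategy that measures the prescribed qubit observables on a given `N`-qubit state. -/
noncomputable def refStrategy {ρ : Matrix (Qubits N) (Qubits N) ℂ} (hρ : IsDensity ρ) :
    Strategy N where
  d := fun _ => 2
  ρ := ρ
  density := hρ
  A := fun v => D.refObs v 1
  B := fun v => D.refObs v (-1)
  A_herm := fun v => D.refObs_isHermitian v 1
  B_herm := fun v => D.refObs_isHermitian v (-1)
  A_sq := fun v => D.refObs_mul_self v 1
  B_sq := fun v => D.refObs_mul_self v (-1)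

/-- For the prescribed observables the sums `(A ± B) / √2` are the Pauli matrices themselves. -/
theorem pauliLike_refStrategy {ρ : Matrix (Qubits N) (Qubits N) ℂ} (hρ : IsDensity ρ) (v : Fin N)
    (s : SignType) : D.pauliLike (D.refStrategy hρ) v s = pauliOf s := by
  have hr := ofReal_inv_sqrt_two_mul_self
  set c : ℂ := ((1 / Real.sqrt 2 : ℝ) : ℂ) with hc
  have hX : c • (c • (pauliX + pauliZ) + c • (pauliX - pauliZ)) = pauliX := by
    rw [← smul_add, smul_smul, hr]; module
  have hZ : c • (c • (pauliX + pauliZ) - c • (pauliX - pauliZ)) = pauliZ := by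
    rw [← smul_sub, smul_smul, hr]; module
  by_cases hv : v ∈ D.AC
  · have hA : (D.refStrategy hρ).A v = c • (pauliX + pauliZ) := by
      change D.refObs v 1 = _
      rw [refObs, if_pos hv, if_pos rfl]
    have hB : (D.refStrategy hρ).B v = c • (pauliX - pauliZ) := by
      change D.refObs v (-1) = _
      rw [refObs, if_pos hv, if_neg (by decide), if_pos rfl]
    rw [pauliLike, if_pos hv, pauliOf]
    split_ifs
    · exact (congrArg₂ (fun a b => c • (a + b)) hA hB).trans hX
    · exact (congrArg₂ (fun a b => c • (a - b)) hA hB).trans hZ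
    · rfl
  · have hA : (D.refStrategy hρ).A v = pauliX := by
      change D.refObs v 1 = _
      rw [refObs, if_neg hv, pauliOf, if_pos rfl]
    have hB : (D.refStrategy hρ).B v = pauliZ := by
      change D.refObs v (-1) = _
      rw [refObs, if_neg hv, pauliOf, if_neg (by decide), if_pos rfl]
    rw [pauliLike, if_neg hv, Strategy.obs, pauliOf]
    split_ifs
    · exact hA
    · exact hB
    · rfl

/-- The prescribed observables attain the maximal value on every state stabilized by `ST`. -/
theorem value_refStrategy {ρ : Matrix (Qubits N) (Qubits N) ℂ} (hρ : IsDensity ρ)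
    (h : ∀ C ∈ D.rows, (ρ * stabilizerOf G (indVec C)).trace = 1) :
    D.value (D.refStrategy hρ) = D.maxValue := by
  rw [value_eq_maxValue_iff]
  intro l hl
  have h1 : D.normCorr (D.refStrategy hρ) l = stabilizerOf G (indVec (D.C l)) := by
    rw [← stabilizer_eq_stabilizerOf, stabilizer_eq G _ (D.indep l), normCorr]
    simp only [pauliLike_refStrategy]
    rfl
  rw [h1]
  exact stabilizerOf_mul_eq_self G hρ (h _ ⟨l, hl, rfl⟩)

theorem isMaximal_iff : D.IsMaximal Q ↔ D.value Q = D.maxValue := by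
  constructor
  · intro h
    refine le_antisymm (D.value_le_maxValue Q) ?_
    rw [← D.value_refStrategy (graphProj_isDensity G)
      fun C _ => trace_graphProj_mul_stabilizerOf G _]
    exact h _
  · intro h Q'
    rw [h]
    exact D.value_le_maxValue Q'

/-- If the stabilizers span, then every vertex of `AC` serves some pair of `P`, so a state reaching
the maximal value is annihilated by the anticommutator of the observables of that vertex. -/
theorem siteOp_anticomm_mul_of_mem_AC (hsp : Spans D.rows)
    (hQ : ∀ l ∈ D.labels, D.normCorr Q l * Q.ρ = Q.ρ) {T : Fin N} (hT : T ∈ D.AC) :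
    siteOp T (Q.anticomm T) * Q.ρ = 0 := by
  obtain ⟨l, hl, hTl⟩ : ∃ l ∈ D.labels, T ∈ D.C l := by
    by_contra! hno
    have h := hsp.linearMap_ext (f := LinearMap.proj (R := ZMod 2) (φ := fun _ => ZMod 2) T)
      (g := 0) (by
        rintro _ ⟨l, hl, rfl⟩
        simp [indVec, hno l hl])
    have := LinearMap.congr_fun h (Pi.single T 1)
    simp at this
  have hset : settings G (D.C l) T = 1 := by simp [settings, hTl]
  have hz : ∀ i ∈ D.AC, i ≠ T → settings G (D.C l) i = 0 := by
    rcases hl with hl | ⟨p, hp, hl⟩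
    · rw [D.rest_AC l hl T hT] at hset
      exact absurd hset (by decide)
    · obtain ⟨T', hT', _, hz⟩ := D.pair_AC p hp
      have : T = T' := by
        by_contra hne
        rcases hl with rfl | rfl
        · rw [(hz T hT hne).1] at hset; exact absurd hset (by decide)
        · rw [(hz T hT hne).2] at hset; exact absurd hset (by decide)
      subst this
      rcases hl with rfl | rfl
      · exact fun i hi hiT => (hz i hi hiT).1
      · exact fun i hi hiT => (hz i hi hiT).2
  have h1 : D.normCorr Q l * D.normCorr Q l * Q.ρ = Q.ρ := by
    rw [Matrix.mul_assoc, hQ l hl, hQ l hl]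
  rw [D.normCorr_mul_self Q hz, hset, D.pauliLike_one_mul_self Q hT, siteOp_add, siteOp_one,
    siteOp_smul, Matrix.add_mul, Matrix.one_mul, add_eq_left, Matrix.smul_mul] at h1
  exact (smul_eq_zero.mp h1).resolve_left (by norm_num)

end BellData

/-! ### The lattice of local phases -/

section Lattice

variable {N : ℕ} (G : SimpleGraph (Fin N)) [DecidableRel G.Adj]

theorem SimpleGraph.Connected.eq_of_adj_eq {V α : Type*} {H : SimpleGraph V} (hH : H.Connected)
    {f : V → α} (hf : ∀ i j, H.Adj i j → f i = f j) (i j : V) : f i = f j := by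
  obtain ⟨w⟩ := hH.preconnected i j
  induction w with
  | nil => rfl
  | cons h _ ih => exact (hf _ _ h).trans ih

/-- The `v`-th row of the adjacency matrix over `ZMod 2`: it gives the exponent of `Z` at the
vertex `v` in a product of generators. -/
def nbrSum (v : Fin N) : (Fin N → ZMod 2) →ₗ[ZMod 2] ZMod 2 :=
  ∑ a ∈ Finset.univ.filter fun a => G.Adj a v, LinearMap.proj a

theorem nbrSum_apply (v : Fin N) (c : Fin N → ZMod 2) :
    nbrSum G v c = ∑ a, if G.Adj a v then c a else 0 := by
  rw [nbrSum, LinearMap.sum_apply, Finset.sum_filter]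
  rfl

theorem nbrSum_single (v a : Fin N) :
    nbrSum G v (Pi.single a 1) = if G.Adj a v then 1 else 0 := by
  rw [nbrSum_apply, Finset.sum_eq_single a]
  · simp
  · intro b _ hb; simp [hb]
  · simp

variable {G}

theorem nbrSum_indVec (C : Finset (Fin N)) (v : Fin N) :
    nbrSum G v (indVec C) = ((C.filter fun i => G.Adj i v).card : ZMod 2) := by
  rw [nbrSum_apply, Finset.card_filter, Nat.cast_sum, ← Finset.sum_subset (Finset.subset_univ C)]
  · refine Finset.sum_congr rfl fun a ha => ?_
    simp [indVec, ha]
  · intro a _ ha; simp [indVec, ha]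

theorem settings_eq_one_iff {C : Finset (Fin N)} {v : Fin N} : settings G C v = 1 ↔ v ∈ C := by
  unfold settings
  split_ifs with h1 h2 <;> simp [h1]

theorem settings_eq_neg_one_iff {C : Finset (Fin N)} (hC : G.IsIndepSet (C : Set (Fin N)))
    {v : Fin N} : settings G C v = -1 ↔ nbrSum G v (indVec C) = 1 := by
  rw [nbrSum_indVec, ZMod.natCast_eq_one_iff_odd]
  by_cases h1 : v ∈ C
  · have he : C.filter (fun i => G.Adj i v) = ∅ := by
      refine Finset.filter_eq_empty_iff.mpr fun i hi ha => ?_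
      exact hC hi h1 ha.ne ha
    rw [he]
    simp [settings, h1]
  · unfold settings
    rw [if_neg h1]
    split_ifs with h2 <;> simp [h2]

theorem nbrSum_eq_zero_of_mem {C : Finset (Fin N)} (hC : G.IsIndepSet (C : Set (Fin N)))
    {v : Fin N} (hv : v ∈ C) : nbrSum G v (indVec C) = 0 := by
  refine (zmod_two_cases _).resolve_right fun h => ?_
  have h1 := (settings_eq_neg_one_iff hC).mpr h
  rw [settings_eq_one_iff.mpr hv] at h1
  exact absurd h1 (by decide)

/-- The position `v` of a stabilizer is trivial exactly if the exponents of `X` and `Z` at `v`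
add up to zero: they are never both nonzero. -/
theorem settings_eq_zero_iff {C : Finset (Fin N)} (hC : G.IsIndepSet (C : Set (Fin N)))
    {v : Fin N} : settings G C v = 0 ↔ indVec C v + nbrSum G v (indVec C) = 0 := by
  by_cases h1 : v ∈ C
  · rw [nbrSum_eq_zero_of_mem hC h1, settings_eq_one_iff.mpr h1]
    simp [indVec, h1]
  · have h2 := settings_eq_neg_one_iff (v := v) hC
    have h3 : settings G C v ≠ 1 := fun h => h1 (settings_eq_one_iff.mp h)
    have h4 : indVec C v = 0 := by simp [indVec, h1]
    rw [h4, zero_add]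
    rcases zmod_two_cases (nbrSum G v (indVec C)) with h5 | h5
    · rw [h5] at h2 ⊢
      have : settings G C v ≠ -1 := fun h => absurd (h2.mp h) (by decide)
      revert h3 this
      generalize settings G C v = s
      revert s; decide
    · rw [h2.mpr h5, h5]; decide

/-- The exponents of the local commutators in the commutator of two stabilizers: `1` where the
first has `X` and the second `Z`, `-1` where the first has `Z` and the second `X`. -/
def conflict (G : SimpleGraph (Fin N)) [DecidableRel G.Adj] (C C' : Finset (Fin N)) (v : Fin N) :
    ℤ :=
  if settings G C v = 1 ∧ settings G C' v = -1 then 1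
  else if settings G C v = -1 ∧ settings G C' v = 1 then -1 else 0

/-- The effect of conjugation by a stabilizer on the exponents of the local commutators: the sign
flips on the support of the stabilizer. -/
def flipOn (G : SimpleGraph (Fin N)) [DecidableRel G.Adj] (C : Finset (Fin N)) (e : Fin N → ℤ)
    (v : Fin N) : ℤ :=
  if settings G C v = 0 then e v else -e v

theorem conflict_cast {C C' : Finset (Fin N)} (hC : G.IsIndepSet (C : Set (Fin N)))
    (hC' : G.IsIndepSet (C' : Set (Fin N))) (v : Fin N) :
    ((conflict G C C' v : ℤ) : ZMod 2) =
      indVec C v * nbrSum G v (indVec C') + nbrSum G v (indVec C) * indVec C' v := by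
  have h : ∀ {D : Finset (Fin N)}, G.IsIndepSet (D : Set (Fin N)) →
      (settings G D v = 1 ∧ indVec D v = 1 ∧ nbrSum G v (indVec D) = 0) ∨
      (settings G D v = -1 ∧ indVec D v = 0 ∧ nbrSum G v (indVec D) = 1) ∨
      (settings G D v = 0 ∧ indVec D v = 0 ∧ nbrSum G v (indVec D) = 0) := by
    intro D hD
    by_cases h1 : v ∈ D
    · exact Or.inl ⟨settings_eq_one_iff.mpr h1, by simp [indVec, h1], nbrSum_eq_zero_of_mem hD h1⟩
    · have h4 : indVec D v = 0 := by simp [indVec, h1]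
      rcases zmod_two_cases (nbrSum G v (indVec D)) with h5 | h5
      · exact Or.inr (Or.inr ⟨(settings_eq_zero_iff hD).mpr (by rw [h4, h5, zero_add]), h4, h5⟩)
      · exact Or.inr (Or.inl ⟨(settings_eq_neg_one_iff hD).mpr h5, h4, h5⟩)
  have hne : ((1 : SignType) = -1) = False := by simp
  have hne' : ((-1 : SignType) = 1) = False := by simp
  rcases h hC with ⟨h1, h2, h3⟩ | ⟨h1, h2, h3⟩ | ⟨h1, h2, h3⟩ <;>
    rcases h hC' with ⟨h4, h5, h6⟩ | ⟨h4, h5, h6⟩ | ⟨h4, h5, h6⟩ <;>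
    simp [conflict, h1, h2, h3, h4, h5, h6, hne, hne']

/-- Any two stabilizers conflict at an even number of positions. -/
theorem sum_conflict_eq_zero (c c' : Fin N → ZMod 2) :
    ∑ v, (c v * nbrSum G v c' + nbrSum G v c * c' v) = 0 := by
  rw [Finset.sum_add_distrib]
  have : ∑ v, nbrSum G v c * c' v = ∑ v, c v * nbrSum G v c' := by
    simp only [nbrSum_apply, Finset.sum_mul, Finset.mul_sum]
    rw [Finset.sum_comm]
    refine Finset.sum_congr rfl fun a _ => Finset.sum_congr rfl fun v _ => ?_
    simp [G.adj_comm]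
  rw [this, CharTwo.add_self_eq_zero]

/-- A lattice containing the conflicts of a spanning family, and one unit vector, is everything
modulo 2: a functional that vanishes on the conflicts takes equal values on adjacent vertices. -/
theorem span_conflict_eq_top (hG : G.Connected) {𝒞 : Set (Finset (Fin N))}
    (hind : ∀ C ∈ 𝒞, G.IsIndepSet (C : Set (Fin N))) (hsp : Spans 𝒞) {Λ : AddSubgroup (Fin N → ℤ)}
    (hconf : ∀ C ∈ 𝒞, ∀ C' ∈ 𝒞, conflict G C C' ∈ Λ) {T : Fin N} (hT : Pi.single T 1 ∈ Λ) :
    Submodule.span (ZMod 2) ((fun (e : Fin N → ℤ) v => ((e v : ℤ) : ZMod 2)) '' Λ) = ⊤ := by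
  by_contra hne
  obtain ⟨y, hy, hort⟩ := exists_orthogonal_of_span_ne_top hne
  -- pairing the conflicts with `y` is bilinear in the indicator vectors
  let B : (Fin N → ZMod 2) →ₗ[ZMod 2] (Fin N → ZMod 2) →ₗ[ZMod 2] ZMod 2 :=
    LinearMap.mk₂ (ZMod 2)
      (fun c c' => ∑ v, (c v * nbrSum G v c' + nbrSum G v c * c' v) * y v)
      (by intros; simp only [map_add, Pi.add_apply, ← Finset.sum_add_distrib]
          exact Finset.sum_congr rfl fun v _ => by ring)
      (by intros; simp only [map_smul, Pi.smul_apply, smul_eq_mul, Finset.mul_sum]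
          exact Finset.sum_congr rfl fun v _ => by ring)
      (by intros; simp only [map_add, Pi.add_apply, ← Finset.sum_add_distrib]
          exact Finset.sum_congr rfl fun v _ => by ring)
      (by intros; simp only [map_smul, Pi.smul_apply, smul_eq_mul, Finset.mul_sum]
          exact Finset.sum_congr rfl fun v _ => by ring)
  have hB : B = 0 := by
    refine hsp.linearMap_ext fun C hC => hsp.linearMap_ext fun C' hC' => ?_
    have := hort _ ⟨_, hconf C hC C' hC', rfl⟩
    simp only [conflict_cast (hind C hC) (hind C' hC')] at this
    exact this
  have hadj : ∀ i j, G.Adj i j → y i = y j := by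
    intro i j hij
    have h : ∑ v, ((Pi.single i 1 : Fin N → ZMod 2) v * nbrSum G v (Pi.single j 1) +
        nbrSum G v (Pi.single i 1) * (Pi.single j 1 : Fin N → ZMod 2) v) * y v = 0 :=
      LinearMap.congr_fun (LinearMap.congr_fun hB (Pi.single i 1)) (Pi.single j 1)
    simp only [nbrSum_single, add_mul, Finset.sum_add_distrib] at h
    rw [Finset.sum_eq_single i (by intro b _ hb; simp [hb]) (by simp),
      Finset.sum_eq_single j (by intro b _ hb; simp [hb]) (by simp)] at h
    simpa [hij, hij.symm, CharTwo.add_eq_zero] using h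
  have hyT : y T = 0 := by
    have := hort _ ⟨_, hT, rfl⟩
    rw [dotProduct, Finset.sum_eq_single T (by intro b _ hb; simp [hb]) (by simp)] at this
    simpa using this
  exact hy (funext fun i => (hG.eq_of_adj_eq hadj i T).trans hyT)

/-- In a finitely generated abelian group that is divisible by 2, doubling is injective. -/
theorem mem_of_two_smul_mem {Λ : AddSubgroup (Fin N → ℤ)}
    (h : Submodule.span (ZMod 2) ((fun (e : Fin N → ℤ) v => ((e v : ℤ) : ZMod 2)) '' Λ) = ⊤)
    {e : Fin N → ℤ} (he : (2 : ℤ) • e ∈ Λ) : e ∈ Λ := by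
  set Λ' := AddSubgroup.toIntSubmodule Λ with hΛ'
  have hred : ∀ c : Fin N → ZMod 2, ∃ l ∈ Λ, (fun v => ((l v : ℤ) : ZMod 2)) = c := by
    intro c
    have hc : c ∈ Submodule.span (ZMod 2)
        ((fun (e : Fin N → ℤ) v => ((e v : ℤ) : ZMod 2)) '' Λ) := by rw [h]; trivial
    induction hc using Submodule.span_induction with
    | mem x hx => obtain ⟨l, hl, rfl⟩ := hx; exact ⟨l, hl, rfl⟩
    | zero => exact ⟨0, zero_mem _, by funext; simp⟩
    | add x y _ _ hx hy =>
      obtain ⟨a, ha, rfl⟩ := hx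
      obtain ⟨b, hb, rfl⟩ := hy
      exact ⟨a + b, add_mem ha hb, by funext; simp⟩
    | smul a x _ hx =>
      rcases zmod_two_cases a with rfl | rfl
      · exact ⟨0, zero_mem _, by funext; simp⟩
      · rwa [one_smul]
  -- doubling is surjective on the finitely generated quotient, hence injective
  let f : ((Fin N → ℤ) ⧸ Λ') →ₗ[ℤ] ((Fin N → ℤ) ⧸ Λ') := (2 : ℤ) • LinearMap.id
  have hsurj : Function.Surjective f := by
    intro q
    obtain ⟨m, rfl⟩ := Submodule.Quotient.mk_surjective Λ' q
    obtain ⟨l, hl, hlm⟩ := hred fun v => ((m v : ℤ) : ZMod 2)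
    have hdvd : ∀ v, (2 : ℤ) ∣ m v - l v := by
      intro v
      have := congrFun hlm v
      refine (ZMod.intCast_zmod_eq_zero_iff_dvd _ 2).mp ?_
      rw [Int.cast_sub, ← this, sub_self]
    choose k hk using hdvd
    refine ⟨Submodule.Quotient.mk k, ?_⟩
    have : f (Submodule.Quotient.mk k) = Submodule.Quotient.mk ((2 : ℤ) • k) := rfl
    rw [this, eq_comm, Submodule.Quotient.eq]
    have hml : m - (2 : ℤ) • k = l := by
      funext v
      have := hk v
      simp only [Pi.sub_apply, Pi.smul_apply, smul_eq_mul]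
      omega
    rw [hml]
    exact hl
  have hinj : Function.Injective f := OrzechProperty.injective_of_surjective_endomorphism f hsurj
  have h0 : f (Submodule.Quotient.mk e) = f 0 := by
    have : f (Submodule.Quotient.mk e) = Submodule.Quotient.mk ((2 : ℤ) • e) := rfl
    rw [this, map_zero, Submodule.Quotient.mk_eq_zero]
    exact he
  exact (Submodule.Quotient.mk_eq_zero Λ').mp (hinj h0)

/-- The positions that lie in the supports of the same stabilizers as `j`. -/
def supportClass (G : SimpleGraph (Fin N)) [DecidableRel G.Adj] (𝒞 : Set (Finset (Fin N)))
    (j : Fin N) : Set (Fin N) :=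
  {i | ∀ C ∈ 𝒞, settings G C i = 0 ↔ settings G C j = 0}

/-- A lattice that is invariant under the sign flips on supports, and closed under division by
`2`, is closed under restriction to support classes: `e` minus its flip is twice the restriction. -/
theorem indicator_supportClass_mem {𝒞 : Set (Finset (Fin N))} {Λ : AddSubgroup (Fin N → ℤ)}
    (hflip : ∀ C ∈ 𝒞, ∀ e ∈ Λ, flipOn G C e ∈ Λ)
    (hdiv : ∀ e : Fin N → ℤ, (2 : ℤ) • e ∈ Λ → e ∈ Λ) (j : Fin N) {e : Fin N → ℤ} (he : e ∈ Λ) :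
    (supportClass G 𝒞 j).indicator e ∈ Λ := by
  classical
  have hstep : ∀ C ∈ 𝒞, ∀ e ∈ Λ,
      {i | settings G C i = 0 ↔ settings G C j = 0}.indicator e ∈ Λ := by
    intro C hC e he
    have hsupp : {i | settings G C i ≠ 0}.indicator e ∈ Λ := by
      refine hdiv _ ?_
      have : (2 : ℤ) • {i | settings G C i ≠ 0}.indicator e = e - flipOn G C e := by
        funext v
        by_cases hv : settings G C v = 0
        · simp [flipOn, hv]
        · simp [flipOn, hv, two_mul]
      rw [this]
      exact sub_mem he (hflip C hC e he)
    by_cases hj : settings G C j = 0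
    · have : {i | settings G C i = 0 ↔ settings G C j = 0}.indicator e =
          e - {i | settings G C i ≠ 0}.indicator e := by
        funext v
        by_cases hv : settings G C v = 0 <;> simp [hv, hj]
      rw [this]
      exact sub_mem he hsupp
    · have : {i | settings G C i = 0 ↔ settings G C j = 0} = {i | settings G C i ≠ 0} := by
        ext v; simp [hj]
      rw [this]
      exact hsupp
  have key : ∀ s : Finset (Finset (Fin N)), (∀ C ∈ s, C ∈ 𝒞) →
      {i | ∀ C ∈ s, settings G C i = 0 ↔ settings G C j = 0}.indicator e ∈ Λ := by
    intro s
    induction s using Finset.induction_on with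
    | empty => intro _; simpa using he
    | insert C s hCs ih =>
      intro hs
      have := hstep C (hs C (Finset.mem_insert_self C s)) _
        (ih fun C' hC' => hs C' (Finset.mem_insert_of_mem hC'))
      rw [Set.indicator_indicator] at this
      convert this using 2
      ext v
      simp
  have := key (Set.toFinite 𝒞).toFinset fun C hC => by simpa using hC
  convert this using 2
  ext v
  simp [supportClass]

/-- A lattice of exponents that contains the conflicts of a spanning family of stabilizers of a
connected graph and one unit vector, and is invariant under the sign flips of the family, is the
whole of `ℤ^N`. -/
theorem single_mem_of_conflict_mem (hG : G.Connected) {𝒞 : Set (Finset (Fin N))}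
    (hind : ∀ C ∈ 𝒞, G.IsIndepSet (C : Set (Fin N))) (hsp : Spans 𝒞) {Λ : AddSubgroup (Fin N → ℤ)}
    (hflip : ∀ C ∈ 𝒞, ∀ e ∈ Λ, flipOn G C e ∈ Λ)
    (hconf : ∀ C ∈ 𝒞, ∀ C' ∈ 𝒞, conflict G C C' ∈ Λ) {T : Fin N} (hT : Pi.single T 1 ∈ Λ)
    (j : Fin N) : Pi.single j 1 ∈ Λ := by
  classical
  have hdiv : ∀ e : Fin N → ℤ, (2 : ℤ) • e ∈ Λ → e ∈ Λ := fun e =>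
    mem_of_two_smul_mem (span_conflict_eq_top hG hind hsp hconf hT)
  set K := supportClass G 𝒞 j with hK
  have hjK : j ∈ K := fun C _ => Iff.rfl
  have hKconf : ∀ C ∈ 𝒞, ∀ C' ∈ 𝒞, K.indicator (conflict G C C') ∈ Λ := fun C hC C' hC' =>
    indicator_supportClass_mem hflip hdiv j (hconf C hC C' hC')
  have hcover : ∀ i, ∃ C ∈ 𝒞, i ∈ C := by
    intro i
    by_contra! hno
    have h := hsp.linearMap_ext (f := LinearMap.proj (R := ZMod 2) (φ := fun _ => ZMod 2) i)
      (g := 0) (fun C hC => by simp [indVec, hno C hC])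
    have := LinearMap.congr_fun h (Pi.single i 1)
    simp at this
  -- the members of `K` are twins: they have the same closed neighbourhoods
  let τ : Fin N → ((Fin N → ZMod 2) →ₗ[ZMod 2] ZMod 2) := fun i => LinearMap.proj i + nbrSum G i
  have hτ0 : ∀ i, ∀ C ∈ 𝒞, settings G C i = 0 ↔ τ i (indVec C) = 0 := fun i C hC =>
    settings_eq_zero_iff (hind C hC)
  have hτ : ∀ i ∈ K, τ i = τ j := by
    intro i hi
    refine hsp.linearMap_ext fun C hC => ?_
    have h := hi C hC
    rw [hτ0 i C hC, hτ0 j C hC] at h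
    rcases zmod_two_cases (τ i (indVec C)) with h1 | h1 <;>
      rcases zmod_two_cases (τ j (indVec C)) with h2 | h2 <;> rw [h1, h2] at h ⊢
    · exact absurd (h.mp rfl) (by decide)
    · exact absurd (h.mpr rfl) (by decide)
  have hτs : ∀ i a, τ i (Pi.single a 1) =
      (if i = a then 1 else 0) + if G.Adj a i then 1 else 0 := by
    intro i a
    simp only [τ, LinearMap.add_apply, nbrSum_single, LinearMap.proj_apply, Pi.single_apply]
  have hclique : ∀ a ∈ K, ∀ b ∈ K, a ≠ b → G.Adj a b := by
    intro a ha b hb hab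
    by_contra hnadj
    have h := LinearMap.congr_fun ((hτ a ha).trans (hτ b hb).symm) (Pi.single a 1)
    rw [hτs, hτs] at h
    simp [hab.symm, hnadj] at h
  have hone : ∀ C ∈ 𝒞, ∀ a ∈ K, ∀ b ∈ K, a ∈ C → b ∈ C → a = b := by
    intro C hC a ha b hb haC hbC
    by_contra hab
    exact hind C hC haC hbC hab (hclique a ha b hb hab)
  -- on `K` a supporting stabilizer has `Z` wherever it does not have `X`
  have hneg : ∀ C ∈ 𝒞, settings G C j ≠ 0 → ∀ v ∈ K, v ∉ C → settings G C v = -1 := by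
    intro C hC hj v hv hvC
    have h0 : settings G C v ≠ 0 := fun h => hj ((hv C hC).mp h)
    have h1 : settings G C v ≠ 1 := fun h => hvC (settings_eq_one_iff.mp h)
    revert h0 h1
    generalize settings G C v = s
    revert s; decide
  obtain ⟨C, hC, hjC⟩ := hcover j
  have hCj1 : settings G C j = 1 := settings_eq_one_iff.mpr hjC
  have hCj : settings G C j ≠ 0 := by rw [hCj1]; decide
  have hCK : ∀ v ∈ K, v ≠ j → settings G C v = -1 := fun v hv hvj =>
    hneg C hC hCj v hv fun hvC => hvj (hone C hC v hv j hjK hvC hjC)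
  by_cases hTK : T ∈ K
  · -- a stabilizer with `X` at `j` against one with `X` at `T`
    by_cases hjT : j = T
    · rwa [hjT]
    obtain ⟨C', hC', hTC'⟩ := hcover T
    have hCT1 : settings G C' T = 1 := settings_eq_one_iff.mpr hTC'
    have hCj' : settings G C' j ≠ 0 := fun h => by
      have := (hTK C' hC').mpr h
      rw [hCT1] at this
      exact absurd this (by decide)
    have hCK' : ∀ v ∈ K, v ≠ T → settings G C' v = -1 := fun v hv hvT =>
      hneg C' hC' hCj' v hv fun hvC => hvT (hone C' hC' v hv T hTK hvC hTC')
    have heq : K.indicator (conflict G C C') = Pi.single j 1 - Pi.single T 1 := by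
      funext v
      by_cases hvj : v = j
      · subst hvj
        rw [Set.indicator_of_mem hjK]
        simp [conflict, hCj1, hCK' v hjK hjT, hjT]
      · by_cases hvT : v = T
        · subst hvT
          rw [Set.indicator_of_mem hTK]
          simp [conflict, hCT1, hCK v hTK hvj, hvj]
        · by_cases hvK : v ∈ K
          · rw [Set.indicator_of_mem hvK]
            simp [conflict, hCK v hvK hvj, hCK' v hvK hvT, hvj, hvT]
          · rw [Set.indicator_of_notMem hvK]
            simp [hvj, hvT]
    have h := add_mem (hKconf C hC C' hC') hT
    rwa [heq, sub_add_cancel] at h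
  · by_contra hjΛ
    -- otherwise every supporting stabilizer has `X` somewhere on `K`, as one with `Z` throughout
    -- would give the unit vector at `j`
    have hmeet : ∀ C' ∈ 𝒞, settings G C' j ≠ 0 → ∃ i ∈ K, i ∈ C' := by
      intro C' hC' hj'
      by_contra! hno
      refine hjΛ ?_
      have heq : K.indicator (conflict G C C') = Pi.single j 1 := by
        funext v
        by_cases hvK : v ∈ K
        · rw [Set.indicator_of_mem hvK]
          have h' := hneg C' hC' hj' v hvK (hno v hvK)
          by_cases hvj : v = j
          · subst hvj
            simp [conflict, hCj1, h']
          · simp [conflict, hCK v hvK hvj, h', hvj]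
        · rw [Set.indicator_of_notMem hvK, Pi.single_eq_of_ne fun h : v = j => hvK (h ▸ hjK)]
      rw [← heq]
      exact hKconf C hC C' hC'
    -- hence `K` is the closed neighbourhood of each of its members, so it is the whole graph
    have hτK : τ j = ∑ i ∈ K.toFinset, LinearMap.proj i := by
      refine hsp.linearMap_ext fun C' hC' => ?_
      rw [LinearMap.sum_apply]
      simp only [LinearMap.proj_apply]
      by_cases hj' : settings G C' j = 0
      · rw [(hτ0 j C' hC').mp hj', Finset.sum_eq_zero]
        intro i hi
        have hi0 := (Set.mem_toFinset.mp hi C' hC').mpr hj'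
        have : i ∉ C' := fun h => by
          rw [settings_eq_one_iff.mpr h] at hi0
          exact absurd hi0 (by decide)
        simp [indVec, this]
      · obtain ⟨i, hi, hiC⟩ := hmeet C' hC' hj'
        have h1 := (zmod_two_cases (τ j (indVec C'))).resolve_left
          fun h => hj' ((hτ0 j C' hC').mpr h)
        rw [h1, Finset.sum_eq_single i]
        · simp [indVec, hiC]
        · intro b hb hbi
          have : b ∉ C' := fun h => hbi (hone C' hC' b (Set.mem_toFinset.mp hb) i hi h hiC)
          simp [indVec, this]
        · intro h; exact absurd (Set.mem_toFinset.mpr hi) h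
    have hclosed : ∀ i ∈ K, ∀ a, G.Adj i a → a ∈ K := by
      intro i hi a hia
      by_contra haK
      have h := LinearMap.congr_fun ((hτ i hi).trans hτK) (Pi.single a 1)
      rw [hτs, LinearMap.sum_apply, Finset.sum_eq_zero] at h
      · simp [hia.ne, hia.symm] at h
      · intro b hb
        have : b ≠ a := fun hba => haK (hba ▸ Set.mem_toFinset.mp hb)
        simp [this]
    have := hG.eq_of_adj_eq (f := fun i => i ∈ K) (fun i a hia => propext
      ⟨fun hi => hclosed i hi a hia, fun ha => hclosed a ha i hia.symm⟩) j T
    exact hTK (this ▸ hjK)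

end Lattice

/-! ### Anticommutation at every vertex -/

section Phases

variable {N : ℕ} {α : Fin N → Type*} [∀ v, Fintype (α v)] [∀ v, DecidableEq (α v)]

theorem signType_cases (s : SignType) : s = 1 ∨ s = -1 ∨ s = 0 := by
  revert s; decide

/-- The involution selected by a sign: `1 ↦ X`, `-1 ↦ Z`, `0 ↦ 1`. -/
def selectOp {n : Type*} [DecidableEq n] (X Z : Matrix n n ℂ) (s : SignType) : Matrix n n ℂ :=
  if s = 1 then X else if s = -1 then Z else 1

theorem selectOp_one {n : Type*} [DecidableEq n] (X Z : Matrix n n ℂ) : selectOp X Z 1 = X :=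
  if_pos rfl

theorem selectOp_neg_one {n : Type*} [DecidableEq n] (X Z : Matrix n n ℂ) :
    selectOp X Z (-1) = Z := by
  rw [selectOp, if_neg (by decide), if_pos rfl]

theorem selectOp_zero {n : Type*} [DecidableEq n] (X Z : Matrix n n ℂ) : selectOp X Z 0 = 1 := by
  rw [selectOp, if_neg (by decide), if_neg (by decide)]

section Local

variable {n : Type*} [Fintype n] [DecidableEq n] {X Z : Matrix n n ℂ}

theorem mul_four_mul_four (hX : X * X = 1) (hZ : Z * Z = 1) :
    X * Z * X * Z * (Z * X * Z * X) = 1 := by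
  calc _ = X * Z * X * (Z * Z) * X * Z * X := by simp only [Matrix.mul_assoc]
    _ = X * Z * (X * X) * Z * X := by rw [hZ]; simp only [Matrix.mul_assoc, Matrix.one_mul]
    _ = X * (Z * Z) * X := by rw [hX]; simp only [Matrix.mul_assoc, Matrix.one_mul]
    _ = 1 := by rw [hZ, Matrix.mul_one, hX]

variable (hX : X * X = 1) (hZ : Z * Z = 1)

/-- The negative of the group commutator `X Z X⁻¹ Z⁻¹` of two involutions. It is trivial exactly
where the involutions anticommute. -/
def negCommutator : (Matrix n n ℂ)ˣ where
  val := -(X * Z * X * Z)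
  inv := -(Z * X * Z * X)
  val_inv := by rw [neg_mul_neg, mul_four_mul_four hX hZ]
  inv_val := by rw [neg_mul_neg, mul_four_mul_four hZ hX]

/-- Conjugation by `X` or by `Z` inverts the commutator. -/
theorem selectOp_conj_zpow (s : SignType) (k : ℤ) :
    selectOp X Z s * ((negCommutator hX hZ ^ k : (Matrix n n ℂ)ˣ) : Matrix n n ℂ) *
        selectOp X Z s =
      ((negCommutator hX hZ ^ (if s = 0 then k else -k) : (Matrix n n ℂ)ˣ) : Matrix n n ℂ) := by
  have key : ∀ u : (Matrix n n ℂ)ˣ, u * u = 1 →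
      u * negCommutator hX hZ * u⁻¹ = (negCommutator hX hZ)⁻¹ →
      (u : Matrix n n ℂ) * ((negCommutator hX hZ ^ k : (Matrix n n ℂ)ˣ) : Matrix n n ℂ) * u =
      ((negCommutator hX hZ ^ (-k) : (Matrix n n ℂ)ˣ) : Matrix n n ℂ) := by
    intro u hu hc
    have hu' : u⁻¹ = u := inv_eq_of_mul_eq_one_left hu
    rw [_root_.zpow_neg, ← _root_.inv_zpow, ← hc, conj_zpow, hu', Units.val_mul, Units.val_mul]
  have hXu : X * -(X * Z * X * Z) * X = -(Z * X * Z * X) := by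
    rw [Matrix.mul_neg, Matrix.neg_mul]
    simp only [← Matrix.mul_assoc]
    rw [hX, Matrix.one_mul]
  have hZu : Z * -(X * Z * X * Z) * Z = -(Z * X * Z * X) := by
    rw [Matrix.mul_neg, Matrix.neg_mul]
    simp only [Matrix.mul_assoc]
    rw [hZ, Matrix.mul_one]
  rcases signType_cases s with rfl | rfl | rfl
  · rw [selectOp_one, if_neg (by decide)]
    exact key ⟨X, X, hX, hX⟩ (Units.ext hX) (Units.ext hXu)
  · rw [selectOp_neg_one, if_neg (by decide)]
    exact key ⟨Z, Z, hZ, hZ⟩ (Units.ext hZ) (Units.ext hZu)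
  · rw [selectOp_zero, if_pos rfl, Matrix.one_mul, Matrix.mul_one]

/-- The group commutator of two tensor factors of stabilizers, which are involutions. -/
theorem selectOp_commutator {s t : SignType} {k : ℤ}
    (hk : k = if s = 1 ∧ t = -1 then 1 else if s = -1 ∧ t = 1 then -1 else 0) :
    selectOp X Z s * selectOp X Z t * (selectOp X Z s * selectOp X Z t) =
      sgn ((k : ℤ) : ZMod 2) •
        ((negCommutator hX hZ ^ k : (Matrix n n ℂ)ˣ) : Matrix n n ℂ) := by
  have hne : ((1 : SignType) = -1) = False := by simp
  have hne' : ((-1 : SignType) = 1) = False := by simp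
  have hXX : X * X * (X * X) = 1 := by rw [hX, Matrix.one_mul]
  have hZZ : Z * Z * (Z * Z) = 1 := by rw [hZ, Matrix.one_mul]
  rcases signType_cases s with rfl | rfl | rfl <;> rcases signType_cases t with rfl | rfl | rfl <;>
    simp [hne, hne'] at hk <;> subst hk <;>
    simp [selectOp_one, selectOp_neg_one, selectOp_zero, hX, hZ, negCommutator, Matrix.mul_assoc]

end Local

variable {κ : Type*} {G : SimpleGraph (Fin N)} [DecidableRel G.Adj]
  {X Z : ∀ v, Matrix (α v) (α v) ℂ}

/-- The tensor product of powers of the (negative) local commutators. -/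
def phaseOp (hX : ∀ v, X v * X v = 1) (hZ : ∀ v, Z v * Z v = 1) (e : Fin N → ℤ) :
    Matrix (∀ v, α v) (∀ v, α v) ℂ :=
  tensorOp fun v => ((negCommutator (hX v) (hZ v) ^ e v : (Matrix (α v) (α v) ℂ)ˣ) :
    Matrix (α v) (α v) ℂ)

variable (hX : ∀ v, X v * X v = 1) (hZ : ∀ v, Z v * Z v = 1)

theorem phaseOp_zero : phaseOp hX hZ 0 = 1 := by
  simp [phaseOp, tensorOp_eq_one]

theorem phaseOp_add (e e' : Fin N → ℤ) :
    phaseOp hX hZ (e + e') = phaseOp hX hZ e * phaseOp hX hZ e' := by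
  rw [phaseOp, phaseOp, phaseOp, tensorOp_mul_tensorOp]
  simp only [Pi.add_apply, _root_.zpow_add, Units.val_mul]

theorem phaseOp_single (v : Fin N) :
    phaseOp hX hZ (Pi.single v 1) = -siteOp v (X v * Z v * X v * Z v) := by
  rw [← siteOp_neg, phaseOp, siteOp]
  congr 1
  funext w
  by_cases h : w = v
  · subst h
    simp [negCommutator]
  · simp [h]

/-- The exponents `e` for which the product of local commutators fixes `ρ`. -/
def phaseLattice (ρ : Matrix (∀ v, α v) κ ℂ) : AddSubgroup (Fin N → ℤ) where
  carrier := {e | phaseOp hX hZ e * ρ = ρ}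
  zero_mem' := by
    rw [Set.mem_ofPred_eq, phaseOp_zero, Matrix.one_mul]
  add_mem' := by
    intro e e' he he'
    rw [Set.mem_ofPred_eq] at he he' ⊢
    rw [phaseOp_add, Matrix.mul_assoc, he', he]
  neg_mem' := by
    intro e he
    rw [Set.mem_ofPred_eq] at he ⊢
    conv_lhs => rw [← he]
    rw [← Matrix.mul_assoc, ← phaseOp_add, neg_add_cancel, phaseOp_zero, Matrix.one_mul]

/-- If the correlators of a spanning family of stabilizers, formed with local involutions `X v` and
`Z v`, fix a state, and `X`, `Z` anticommute on the state at a single vertex, then they do so at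
every vertex. -/
theorem siteOp_anticomm_mul_eq_zero (hX : ∀ v, X v * X v = 1) (hZ : ∀ v, Z v * Z v = 1)
    (hG : G.Connected) {𝒞 : Set (Finset (Fin N))}
    (hind : ∀ C ∈ 𝒞, G.IsIndepSet (C : Set (Fin N))) (hsp : Spans 𝒞)
    {ρ : Matrix (∀ v, α v) κ ℂ}
    (hρ : ∀ C ∈ 𝒞, tensorOp (fun v => selectOp (X v) (Z v) (settings G C v)) * ρ = ρ) {T : Fin N}
    (hT : siteOp T (X T * Z T * X T * Z T) * ρ = -ρ) (v : Fin N) :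
    siteOp v (X v * Z v + Z v * X v) * ρ = 0 := by
  set S : Finset (Fin N) → Matrix (∀ v, α v) (∀ v, α v) ℂ := fun C =>
    tensorOp (fun v => selectOp (X v) (Z v) (settings G C v)) with hS
  have hv : Pi.single v 1 ∈ phaseLattice hX hZ ρ := by
    refine single_mem_of_conflict_mem hG hind hsp (T := T) ?_ ?_ ?_ v
    · -- conjugation by a correlator flips the exponents on its support
      intro C hC e he
      have he' : phaseOp hX hZ e * ρ = ρ := he
      have hconj : phaseOp hX hZ (flipOn G C e) = S C * phaseOp hX hZ e * S C := by
        rw [hS, phaseOp, phaseOp, tensorOp_mul_tensorOp, tensorOp_mul_tensorOp]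
        congr 1
        funext v
        rw [selectOp_conj_zpow, flipOn]
      change phaseOp hX hZ _ * ρ = ρ
      rw [hconj, Matrix.mul_assoc, hρ C hC, Matrix.mul_assoc, he', hρ C hC]
    · -- the minus signs of the local factors cancel: the number of conflicts is even
      intro C hC C' hC'
      have hcomm : S C * S C' * (S C * S C') = phaseOp hX hZ (conflict G C C') := by
        rw [hS, tensorOp_mul_tensorOp, tensorOp_mul_tensorOp]
        have h := fun v => selectOp_commutator (hX v) (hZ v) (s := settings G C v)
          (t := settings G C' v) (k := conflict G C C' v) rfl
        simp only [h]
        rw [tensorOp_smul_factor, ← sgn_sum,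
          Finset.sum_congr rfl fun v _ => conflict_cast (hind C hC) (hind C' hC') v,
          sum_conflict_eq_zero, sgn_zero, one_smul]
        rfl
      change phaseOp hX hZ _ * ρ = ρ
      have h1 : S C * ρ = ρ := hρ C hC
      have h2 : S C' * ρ = ρ := hρ C' hC'
      rw [← hcomm]
      simp only [Matrix.mul_assoc, h1, h2]
    · change phaseOp hX hZ _ * ρ = ρ
      rw [phaseOp_single, Matrix.neg_mul, hT, neg_neg]
  have h1 : phaseOp hX hZ (Pi.single v 1) * ρ = ρ := hv
  rw [phaseOp_single, Matrix.neg_mul] at h1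
  have h2 : siteOp v (Z v * X v) * (siteOp v (X v * Z v * X v * Z v) * ρ) =
      siteOp v (X v * Z v) * ρ := by
    rw [← Matrix.mul_assoc, siteOp_mul]
    congr 2
    calc Z v * X v * (X v * Z v * X v * Z v) = Z v * (X v * X v) * Z v * X v * Z v := by
          simp only [Matrix.mul_assoc]
      _ = X v * Z v := by rw [hX, Matrix.mul_one, hZ, Matrix.one_mul]
  rw [siteOp_add, Matrix.add_mul, ← h2, neg_eq_iff_eq_neg.mp h1, Matrix.mul_neg, neg_add_cancel]

end Phases

namespace BellData

variable {N : ℕ} {G : SimpleGraph (Fin N)} [DecidableRel G.Adj] {L : Type*} (D : BellData G L)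
  (Q : Strategy N)

theorem pauliLike_commute {v : Fin N} {p : Matrix (Fin (Q.d v)) (Fin (Q.d v)) ℂ}
    (hp : ∀ M, M * Q.anticomm v = Q.anticomm v * M → M * p = p * M) (s : SignType) :
    D.pauliLike Q v s * p = p * D.pauliLike Q v s := by
  have hA := hp _ (Q.A_mul_anticomm v)
  have hB := hp _ (Q.B_mul_anticomm v)
  unfold pauliLike Strategy.obs
  split_ifs
  · rw [Matrix.smul_mul, Matrix.mul_smul, Matrix.add_mul, Matrix.mul_add, hA, hB]
  · rw [Matrix.smul_mul, Matrix.mul_smul, Matrix.sub_mul, Matrix.mul_sub, hA, hB]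
  · rw [Matrix.one_mul, Matrix.mul_one]
  · exact hA
  · exact hB
  · rw [Matrix.one_mul, Matrix.mul_one]

theorem pauliLike_sq_mul {v : Fin N} {p : Matrix (Fin (Q.d v)) (Fin (Q.d v)) ℂ}
    (hp : Q.anticomm v * p = 0) (s : SignType) :
    D.pauliLike Q v s * D.pauliLike Q v s * p = p := by
  by_cases hv : v ∈ D.AC
  · rcases signType_cases s with rfl | rfl | rfl
    · rw [D.pauliLike_one_mul_self Q hv, Matrix.add_mul, Matrix.smul_mul, hp, smul_zero, add_zero,
        Matrix.one_mul]
    · rw [D.pauliLike_neg_one_mul_self Q hv, Matrix.sub_mul, Matrix.smul_mul, hp, smul_zero,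
        sub_zero, Matrix.one_mul]
    · rw [pauliLike_zero, Matrix.one_mul, Matrix.one_mul]
  · rw [D.pauliLike_mul_self_of_notMem Q hv, Matrix.one_mul]

theorem pauliLike_anticomm_mul {v : Fin N} {p : Matrix (Fin (Q.d v)) (Fin (Q.d v)) ℂ}
    (hp : Q.anticomm v * p = 0) :
    D.pauliLike Q v 1 * D.pauliLike Q v (-1) * p =
      -(D.pauliLike Q v (-1) * D.pauliLike Q v 1 * p) := by
  rw [← add_eq_zero_iff_eq_neg, ← Matrix.add_mul]
  by_cases hv : v ∈ D.AC
  · have : D.pauliLike Q v 1 * D.pauliLike Q v (-1) + D.pauliLike Q v (-1) * D.pauliLike Q v 1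
        = 0 := by
      simp only [pauliLike, if_pos hv, if_true, if_neg (show ¬ ((-1 : SignType) = 1) by decide)]
      simp only [Matrix.smul_mul, Matrix.mul_smul, Matrix.add_mul, Matrix.mul_add,
        Matrix.sub_mul, Matrix.mul_sub, Q.A_sq, Q.B_sq]
      module
    rw [this, Matrix.zero_mul]
  · have : D.pauliLike Q v 1 * D.pauliLike Q v (-1) + D.pauliLike Q v (-1) * D.pauliLike Q v 1
        = Q.anticomm v := by
      simp only [pauliLike, if_neg hv, Strategy.obs, if_true,
        if_neg (show ¬ ((-1 : SignType) = 1) by decide), Strategy.anticomm]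
    rw [this, hp]

/-- A projector `p` onto the kernel of `K` fixes a state that is annihilated by `K`. -/
theorem _root_.Strategy.siteOp_mul_eq_self_of_kernelProjector {v : Fin N}
    {K p g : Matrix (Fin (Q.d v)) (Fin (Q.d v)) ℂ} (hg : 1 - p = g * K)
    (h : siteOp v K * Q.ρ = 0) : siteOp v p * Q.ρ = Q.ρ := by
  have h1 : siteOp v (1 - p) * Q.ρ = 0 := by
    rw [hg, ← siteOp_mul, Matrix.mul_assoc, h, Matrix.mul_zero]
  rw [siteOp_sub, siteOp_one, Matrix.sub_mul, Matrix.one_mul, sub_eq_zero] at h1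
  exact h1.symm

/-- A state reaching the maximal value of a spanning Bell expression is annihilated by the
anticommutator of the observables of each party. On `AC` the operators `(A ± B) / √2` are
involutions only on the kernel of the anticommutator; they are extended by the identity. -/
theorem siteOp_anticomm_mul_eq_zero (hG : G.Connected) (hP : D.P.Nonempty) (hsp : Spans D.rows)
    (hQ : ∀ l ∈ D.labels, D.normCorr Q l * Q.ρ = Q.ρ) (v : Fin N) :
    siteOp v (Q.anticomm v) * Q.ρ = 0 := by
  by_cases hvAC : v ∈ D.AC
  · exact D.siteOp_anticomm_mul_of_mem_AC Q hsp hQ hvAC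
  have hAC := fun {T} (hT : T ∈ D.AC) => D.siteOp_anticomm_mul_of_mem_AC Q hsp hQ hT
  choose p _ hpp hKp hcomm g hg using fun v => exists_kernelProjector (Q.anticomm_isHermitian v)
  set O : SignType → ∀ v, Matrix (Fin (Q.d v)) (Fin (Q.d v)) ℂ := fun s v =>
    if v ∈ D.AC then D.pauliLike Q v s * p v + (1 - p v) else D.pauliLike Q v s with hO
  set p' : ∀ v, Matrix (Fin (Q.d v)) (Fin (Q.d v)) ℂ := fun v => if v ∈ D.AC then p v else 1
    with hp'
  have hp1 : ∀ v, (1 - p v) * p v = 0 := fun v => by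
    rw [Matrix.sub_mul, Matrix.one_mul, hpp, sub_self]
  have hp2 : ∀ v, p v * (1 - p v) = 0 := fun v => by
    rw [Matrix.mul_sub, Matrix.mul_one, hpp, sub_self]
  have hp3 : ∀ v, (1 - p v) * (1 - p v) = 1 - p v := fun v => by
    rw [Matrix.mul_sub, Matrix.mul_one, hp1, sub_zero]
  have hOp : ∀ s v, O s v * p' v = D.pauliLike Q v s * p' v := by
    intro s v
    by_cases hv : v ∈ D.AC
    · simp only [hO, hp', if_pos hv]
      rw [Matrix.add_mul, Matrix.mul_assoc, hpp, hp1, add_zero]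
    · simp only [hO, hp', if_neg hv]
  have hOO : ∀ s v, O s v * O s v = 1 := by
    intro s v
    by_cases hv : v ∈ D.AC
    · simp only [hO, if_pos hv]
      have h1 : D.pauliLike Q v s * p v * (D.pauliLike Q v s * p v) = p v := by
        rw [Matrix.mul_assoc, ← Matrix.mul_assoc (p v), ← D.pauliLike_commute Q (hcomm v),
          Matrix.mul_assoc, hpp, ← Matrix.mul_assoc, D.pauliLike_sq_mul Q (hKp v)]
      have h2 : (1 - p v) * (D.pauliLike Q v s * p v) = 0 := by
        rw [D.pauliLike_commute Q (hcomm v), ← Matrix.mul_assoc, hp1, Matrix.zero_mul]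
      rw [Matrix.add_mul, Matrix.mul_add, Matrix.mul_add, h1, h2, hp3, Matrix.mul_assoc, hp2,
        Matrix.mul_zero, add_zero, zero_add, add_sub_cancel]
    · simp only [hO, if_neg hv]
      exact D.pauliLike_mul_self_of_notMem Q hv s
  have hpρ : ∀ v ∈ D.AC, siteOp v (p v) * Q.ρ = Q.ρ := fun v hv =>
    Q.siteOp_mul_eq_self_of_kernelProjector (hg v) (hAC hv)
  have hp'ρ : tensorOp p' * Q.ρ = Q.ρ := by
    refine tensorOp_mul_eq_self fun v => ?_
    by_cases hv : v ∈ D.AC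
    · simp only [hp', if_pos hv]; exact hpρ v hv
    · simp only [hp', if_neg hv]; rw [siteOp_one, Matrix.one_mul]
  have hfix : ∀ C ∈ D.rows,
      tensorOp (fun v => selectOp (O 1 v) (O (-1) v) (settings G C v)) * Q.ρ = Q.ρ := by
    rintro _ ⟨l, hl, rfl⟩
    have hsel : ∀ s v, selectOp (O 1 v) (O (-1) v) s * p' v = D.pauliLike Q v s * p' v := by
      intro s v
      rcases signType_cases s with rfl | rfl | rfl
      · rw [selectOp_one, hOp]
      · rw [selectOp_neg_one, hOp]
      · rw [selectOp_zero, pauliLike_zero]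
    conv_lhs => rw [← hp'ρ]
    rw [← Matrix.mul_assoc, tensorOp_mul_tensorOp]
    simp only [hsel]
    rw [← tensorOp_mul_tensorOp, Matrix.mul_assoc, hp'ρ]
    exact hQ l hl
  -- on the range of `p T`, where `O` agrees with `pauliLike`, the square of `X Z = -Z X` is `-1`
  obtain ⟨q, hq⟩ := hP
  obtain ⟨T, hT, -⟩ := D.pair_AC q hq
  have hW : siteOp T (O 1 T * O (-1) T * O 1 T * O (-1) T) * Q.ρ = -Q.ρ := by
    have hOT : ∀ s, O s T * p T = D.pauliLike Q T s * p T := by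
      intro s
      have := hOp s T
      simpa only [hp', if_pos hT] using this
    have hOpl : ∀ s (M : Matrix (Fin (Q.d T)) (Fin (Q.d T)) ℂ), M * p T = p T * M →
        O s T * (M * p T) = D.pauliLike Q T s * (M * p T) := by
      intro s M hM
      rw [hM, ← Matrix.mul_assoc, hOT, Matrix.mul_assoc]
    have hc := fun s => D.pauliLike_commute Q (hcomm T) s
    have h4 : O 1 T * O (-1) T * O 1 T * O (-1) T * p T = -p T := by
      set x := D.pauliLike Q T 1
      set z := D.pauliLike Q T (-1)
      have hx : x * p T = p T * x := hc 1
      have hz : z * p T = p T * z := hc (-1)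
      have hxz : x * z * p T = p T * (x * z) := by
        rw [Matrix.mul_assoc, hz, ← Matrix.mul_assoc, hx, Matrix.mul_assoc]
      have hzxz : z * (x * z) * p T = p T * (z * (x * z)) := by
        rw [Matrix.mul_assoc, hxz, ← Matrix.mul_assoc, hz, Matrix.mul_assoc]
      have hanti : x * z * p T = -(z * x * p T) := D.pauliLike_anticomm_mul Q (hKp T)
      have e1 : O (-1) T * p T = z * p T := hOT (-1)
      have e2 : O 1 T * (z * p T) = x * (z * p T) := hOpl 1 z hz
      have e3 : O (-1) T * (x * (z * p T)) = z * (x * (z * p T)) := by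
        simpa only [Matrix.mul_assoc] using hOpl (-1) _ hxz
      have e4 : O 1 T * (z * (x * (z * p T))) = x * (z * (x * (z * p T))) := by
        simpa only [Matrix.mul_assoc] using hOpl 1 _ hzxz
      calc O 1 T * O (-1) T * O 1 T * O (-1) T * p T
          = O 1 T * (O (-1) T * (O 1 T * (O (-1) T * p T))) := by simp only [Matrix.mul_assoc]
        _ = x * (z * (x * z * p T)) := by rw [e1, e2, e3, e4, Matrix.mul_assoc x z]
        _ = -(x * (z * z * p T * x)) := by
            rw [hanti, Matrix.mul_neg, Matrix.mul_neg, Matrix.mul_assoc z x, hx]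
            simp only [Matrix.mul_assoc]
        _ = -(x * x * p T) := by rw [D.pauliLike_sq_mul Q (hKp T), ← hx, Matrix.mul_assoc]
        _ = -p T := by rw [D.pauliLike_sq_mul Q (hKp T)]
    conv_lhs => rw [← hpρ T hT]
    rw [← Matrix.mul_assoc, siteOp_mul, h4, siteOp_neg, Matrix.neg_mul, hpρ T hT]
  have hmain := _root_.siteOp_anticomm_mul_eq_zero (hOO 1) (hOO (-1)) hG
    (by rintro _ ⟨l, _, rfl⟩; exact D.indep l) hsp hfix hW v
  have hv1 : O 1 v = Q.A v := by
    simp only [hO, if_neg hvAC, pauliLike, Strategy.obs, if_true]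
  have hv2 : O (-1) v = Q.B v := by
    simp only [hO, if_neg hvAC, pauliLike, Strategy.obs, if_true,
      if_neg (show ¬ ((-1 : SignType) = 1) by decide)]
  rwa [hv1, hv2] at hmain

end BellData

/-! ### The local isometries -/

section Isometry

theorem projector_relations {n : Type*} [Fintype n] {Z p : Matrix n n ℂ} (hpp : p * p = p)
    (hZp : Z * p = p * Z) (hZZ : Z * Z * p = p) :
    p * (Z * p) = Z * p ∧ Z * p * p = Z * p ∧ Z * p * (Z * p) = p := by
  refine ⟨?_, ?_, ?_⟩
  · rw [hZp, ← Matrix.mul_assoc, hpp]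
  · rw [Matrix.mul_assoc, hpp]
  · rw [Matrix.mul_assoc, ← Matrix.mul_assoc p, ← hZp, Matrix.mul_assoc Z p p, hpp,
      ← Matrix.mul_assoc, hZZ]

variable {n : Type*} [DecidableEq n]

/-- The operator `a ⊗ 1` on `ℂ² ⊗ ℂ^n`. -/
def qubitOp (n : Type*) [DecidableEq n] (a : Matrix (Fin 2) (Fin 2) ℂ) :
    Matrix (Fin 2 × n) (Fin 2 × n) ℂ :=
  Matrix.of fun i j => a i.1 j.1 * (1 : Matrix n n ℂ) i.2 j.2

theorem qubitOp_smul (c : ℂ) (a : Matrix (Fin 2) (Fin 2) ℂ) :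
    qubitOp n (c • a) = c • qubitOp n a := by
  ext i j; simp [qubitOp, mul_assoc]

theorem qubitOp_add (a b : Matrix (Fin 2) (Fin 2) ℂ) :
    qubitOp n (a + b) = qubitOp n a + qubitOp n b := by
  ext i j; simp [qubitOp, add_mul]

theorem qubitOp_sub (a b : Matrix (Fin 2) (Fin 2) ℂ) :
    qubitOp n (a - b) = qubitOp n a - qubitOp n b := by
  ext i j; simp [qubitOp, sub_mul]

theorem qubitOp_one : qubitOp n 1 = 1 := by
  ext ⟨b, i⟩ ⟨b', j⟩
  by_cases h : b = b' <;> by_cases h' : i = j <;> simp [qubitOp, Matrix.one_apply, h, h']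

variable [Fintype n]

/-- The swap isometry `ℂ^n → ℂ² ⊗ ℂ^n` built from two operators `X`, `Z` that act like Pauli
matrices on the range of a projector `p`: there it maps `φ` to
`|0⟩ ⊗ (1 + Z)/2 φ + |1⟩ ⊗ X (1 - Z)/2 φ`, and off the range of `p` it maps `φ` to `|0⟩ ⊗ φ`. -/
noncomputable def swapIsometry (X Z p : Matrix n n ℂ) : Matrix (Fin 2 × n) n ℂ :=
  Matrix.of fun i j =>
    if i.1 = 0 then ((1 / 2 : ℂ) • ((1 + Z) * p) + (1 - p)) i.2 j
    else ((1 / 2 : ℂ) • (X * (1 - Z) * p)) i.2 j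

theorem qubitOp_mul_apply {κ : Type*} (a : Matrix (Fin 2) (Fin 2) ℂ) (M : Matrix (Fin 2 × n) κ ℂ)
    (b : Fin 2) (i : n) (k : κ) :
    (qubitOp n a * M) (b, i) k = a b 0 * M (0, i) k + a b 1 * M (1, i) k := by
  rw [Matrix.mul_apply, Fintype.sum_prod_type, Fin.sum_univ_two]
  congr 1 <;>
  · rw [Finset.sum_eq_single i]
    · simp [qubitOp]
    · intro j _ hj; simp [qubitOp, hj.symm]
    · simp

theorem swapIsometry_mul_apply_zero (X Z p M : Matrix n n ℂ) (i j : n) :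
    (swapIsometry X Z p * M) (0, i) j =
      (((1 / 2 : ℂ) • ((1 + Z) * p) + (1 - p)) * M) i j := by
  simp [swapIsometry, Matrix.mul_apply]

theorem swapIsometry_mul_apply_one (X Z p M : Matrix n n ℂ) (i j : n) :
    (swapIsometry X Z p * M) (1, i) j = (((1 / 2 : ℂ) • (X * (1 - Z) * p)) * M) i j := by
  simp [swapIsometry, Matrix.mul_apply]

variable {X Z p : Matrix n n ℂ}

theorem swapIsometry_isometry (hX : X.IsHermitian) (hZ : Z.IsHermitian) (hp : p.IsHermitian)
    (hpp : p * p = p) (hZp : Z * p = p * Z) (hXX : X * X * p = p)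
    (hZZ : Z * Z * p = p) : (swapIsometry X Z p)ᴴ * swapIsometry X Z p = 1 := by
  obtain ⟨hpy, hyp, hyy⟩ := projector_relations hpp hZp hZZ
  have hXy : X * X * (Z * p) = Z * p := by rw [hZp, ← Matrix.mul_assoc, hXX]
  have hyH : (Z * p)ᴴ = Z * p := by rw [conjTranspose_mul, hZ.eq, hp.eq, hZp]
  set y := Z * p with hy
  set a := (1 / 2 : ℂ) • (p + y) + (1 - p) with ha
  set b := (1 / 2 : ℂ) • (X * (p - y)) with hb
  have ha' : (1 / 2 : ℂ) • ((1 + Z) * p) + (1 - p) = a := by rw [Matrix.add_mul, Matrix.one_mul]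
  have hb' : (1 / 2 : ℂ) • (X * (1 - Z) * p) = b := by
    rw [Matrix.mul_assoc, Matrix.sub_mul, Matrix.one_mul]
  have h : (swapIsometry X Z p)ᴴ * swapIsometry X Z p = aᴴ * a + bᴴ * b := by
    ext i j
    rw [Matrix.mul_apply, Fintype.sum_prod_type, Fin.sum_univ_two, Matrix.add_apply,
      Matrix.mul_apply, Matrix.mul_apply]
    simp only [swapIsometry, ha', hb', Matrix.conjTranspose_apply, Matrix.of_apply, if_true,
      one_ne_zero, if_false]
  have hs : star (1 / 2 : ℂ) = 1 / 2 := by simp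
  have haH : aᴴ = a := by
    rw [ha, conjTranspose_add, conjTranspose_smul, hs, conjTranspose_add, conjTranspose_sub,
      conjTranspose_one, hp.eq, hyH]
  have hbH : bᴴ = (1 / 2 : ℂ) • ((p - y) * X) := by
    rw [hb, conjTranspose_smul, hs, conjTranspose_mul, conjTranspose_sub, hX.eq, hp.eq, hyH]
  have hbb : bᴴ * b = (1 / 4 : ℂ) • ((p - y) * (p - y)) := by
    rw [hbH, hb, Matrix.smul_mul, Matrix.mul_smul, smul_smul, Matrix.mul_assoc,
      ← Matrix.mul_assoc X X, Matrix.mul_sub (X * X), hXX, hXy]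
    norm_num
  rw [h, haH, hbb, ha]
  simp only [Matrix.add_mul, Matrix.mul_add, Matrix.sub_mul, Matrix.mul_sub, Matrix.smul_mul,
    Matrix.mul_smul, hpp, hpy, hyp, hyy, Matrix.one_mul, Matrix.mul_one]
  module

/-- On the range of `p` the swap isometry turns `Z` into the Pauli matrix `Z`. -/
theorem swapIsometry_mul_Z (hpp : p * p = p) (hZp : Z * p = p * Z) (hZZ : Z * Z * p = p) :
    swapIsometry X Z p * (Z * p) = qubitOp n pauliZ * (swapIsometry X Z p * p) := by
  obtain ⟨hpy, hyp, hyy⟩ := projector_relations hpp hZp hZZ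
  ext ⟨b, i⟩ j
  rw [qubitOp_mul_apply]
  fin_cases b
  · simp only [Fin.zero_eta, Fin.isValue, swapIsometry_mul_apply_zero, swapIsometry_mul_apply_one]
    have : ((1 / 2 : ℂ) • ((1 + Z) * p) + (1 - p)) * (Z * p) =
        ((1 / 2 : ℂ) • ((1 + Z) * p) + (1 - p)) * p := by
      simp only [Matrix.add_mul, Matrix.sub_mul, Matrix.smul_mul, hpp, hpy, hyp, hyy,
        Matrix.one_mul]
      module
    rw [this]
    simp [pauliZ]
  · simp only [Fin.mk_one, Fin.isValue, swapIsometry_mul_apply_zero, swapIsometry_mul_apply_one]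
    have : (1 / 2 : ℂ) • (X * (1 - Z) * p) * (Z * p) =
        -((1 / 2 : ℂ) • (X * (1 - Z) * p) * p) := by
      simp only [Matrix.mul_assoc X, Matrix.sub_mul, Matrix.smul_mul, hpp, hpy, hyp, hyy,
        Matrix.one_mul, Matrix.mul_sub]
      module
    rw [this]
    simp [pauliZ]

/-- On the range of `p` the swap isometry turns `X` into the Pauli matrix `X`. -/
theorem swapIsometry_mul_X (hpp : p * p = p) (hXp : X * p = p * X) (hZp : Z * p = p * Z)
    (hXX : X * X * p = p) (hZZ : Z * Z * p = p) (hXZ : X * Z * p = -(Z * X * p)) :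
    swapIsometry X Z p * (X * p) = qubitOp n pauliX * (swapIsometry X Z p * p) := by
  obtain ⟨hpy, hyp, hyy⟩ := projector_relations hpp hZp hZZ
  have hXy : X * (X * (Z * p)) = Z * p := by
    rw [hZp, ← Matrix.mul_assoc X p, ← Matrix.mul_assoc X, ← Matrix.mul_assoc X, hXX]
  have hXXp : X * (X * p) = p := by rw [← Matrix.mul_assoc, hXX]
  have hpX : p * (X * p) = X * p := by rw [hXp, ← Matrix.mul_assoc, hpp]
  have hyX : Z * p * (X * p) = -(X * (Z * p)) := by
    rw [Matrix.mul_assoc, hpX, ← Matrix.mul_assoc, ← Matrix.mul_assoc, hXZ, neg_neg]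
  ext ⟨b, i⟩ j
  rw [qubitOp_mul_apply]
  fin_cases b
  · simp only [Fin.zero_eta, Fin.isValue, swapIsometry_mul_apply_zero, swapIsometry_mul_apply_one]
    have : ((1 / 2 : ℂ) • ((1 + Z) * p) + (1 - p)) * (X * p) =
        (1 / 2 : ℂ) • (X * (1 - Z) * p) * p := by
      simp only [Matrix.mul_assoc X, Matrix.add_mul, Matrix.sub_mul, Matrix.smul_mul, hpp, hpX,
        hyp, hyX, Matrix.one_mul, Matrix.mul_sub]
      module
    rw [this]
    simp [pauliX]
  · simp only [Fin.mk_one, Fin.isValue, swapIsometry_mul_apply_zero, swapIsometry_mul_apply_one]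
    have : (1 / 2 : ℂ) • (X * (1 - Z) * p) * (X * p) =
        ((1 / 2 : ℂ) • ((1 + Z) * p) + (1 - p)) * p := by
      simp only [Matrix.mul_assoc X, Matrix.add_mul, Matrix.sub_mul, Matrix.smul_mul, hpp, hpX,
        hyp, hyX, Matrix.one_mul, Matrix.mul_sub, Matrix.mul_neg, hXXp, hXy]
      module
    rw [this]
    simp [pauliX]

end Isometry

section Joint

variable {N : ℕ} {m : Fin N → ℕ}

/-- A basis label of `⨂_v (ℂ² ⊗ ℂ^(m v))` as a pair of labels of the qubits and of the rest. -/
def splitLabel : (∀ v, Fin 2 × Fin (m v)) ≃ Qubits N × (∀ v, Fin (m v)) where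
  toFun i := (fun v => (i v).1, fun v => (i v).2)
  invFun i := fun v => (i.1 v, i.2 v)
  left_inv _ := rfl
  right_inv _ := rfl

theorem joint_eq_submatrix (M : Matrix (Qubits N) (Qubits N) ℂ)
    (σ : Matrix (∀ v, Fin (m v)) (∀ v, Fin (m v)) ℂ) :
    joint M σ = (Matrix.kroneckerMap (· * ·) M σ).submatrix splitLabel splitLabel := rfl

theorem joint_mul_joint (M M' : Matrix (Qubits N) (Qubits N) ℂ)
    (σ σ' : Matrix (∀ v, Fin (m v)) (∀ v, Fin (m v)) ℂ) :
    joint M σ * joint M' σ' = joint (M * M') (σ * σ') := by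
  rw [joint_eq_submatrix, joint_eq_submatrix, joint_eq_submatrix, Matrix.submatrix_mul_equiv,
    ← Matrix.mul_kronecker_mul]

theorem conjTranspose_joint (M : Matrix (Qubits N) (Qubits N) ℂ)
    (σ : Matrix (∀ v, Fin (m v)) (∀ v, Fin (m v)) ℂ) : (joint M σ)ᴴ = joint Mᴴ σᴴ := by
  ext i j
  simp [joint]

/-- The operator `M ⊗ 1` on `⨂_v (ℂ² ⊗ ℂ^(m v))`, where `M` acts on the qubits. -/
def liftQubits (m : Fin N → ℕ) (M : Matrix (Qubits N) (Qubits N) ℂ) :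
    Matrix (∀ v, Fin 2 × Fin (m v)) (∀ v, Fin 2 × Fin (m v)) ℂ :=
  joint M 1

theorem tensorOp_qubitOp (a : Fin N → Matrix (Fin 2) (Fin 2) ℂ) :
    tensorOp (fun v => qubitOp (Fin (m v)) (a v)) =
      liftQubits m (tensorOp a) := by
  rw [liftQubits, ← tensorOp_eq_one]
  ext i j
  simp only [tensorOp, qubitOp, joint, Matrix.of_apply, Finset.prod_mul_distrib]

theorem liftQubits_mul_apply {κ : Type*} (M : Matrix (Qubits N) (Qubits N) ℂ)
    (Ψ : Matrix (∀ v, Fin 2 × Fin (m v)) κ ℂ) (x : Qubits N) (a : ∀ v, Fin (m v)) (k : κ) :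
    (liftQubits m M * Ψ) (splitLabel.symm (x, a)) k =
      ∑ y, M x y * Ψ (splitLabel.symm (y, a)) k := by
  rw [Matrix.mul_apply, ← splitLabel.symm.sum_comp, Fintype.sum_prod_type]
  refine Finset.sum_congr rfl fun y _ => ?_
  rw [Finset.sum_eq_single a]
  · simp [liftQubits, joint, splitLabel]
  · intro b _ hb
    simp [liftQubits, joint, splitLabel, Matrix.one_apply_ne hb.symm]
  · simp

variable {G : SimpleGraph (Fin N)} [DecidableRel G.Adj]

/-- `Spans.graphProj_mul_eq_self` with further tensor factors, which are moved into the column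
index. -/
theorem Spans.liftQubits_graphProj_mul_eq_self {𝒞 : Set (Finset (Fin N))} (h : Spans 𝒞) {κ : Type*}
    {Ψ : Matrix (∀ v, Fin 2 × Fin (m v)) κ ℂ}
    (hΨ : ∀ C ∈ 𝒞, liftQubits m (stabilizerOf G (indVec C)) * Ψ = Ψ) :
    liftQubits m (graphProj G) * Ψ = Ψ := by
  let A : Matrix (Qubits N) ((∀ v, Fin (m v)) × κ) ℂ :=
    Matrix.of fun x k => Ψ (splitLabel.symm (x, k.1)) k.2
  have hA : ∀ M x (k : (∀ v, Fin (m v)) × κ),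
      (M * A) x k = (liftQubits m M * Ψ) (splitLabel.symm (x, k.1)) k.2 := by
    intro M x k
    rw [liftQubits_mul_apply, Matrix.mul_apply]
    rfl
  have hfix : graphProj G * A = A := h.graphProj_mul_eq_self G fun C hC => by
    ext x k
    rw [hA, hΨ C hC]
    rfl
  ext i k
  obtain ⟨⟨x, a⟩, rfl⟩ := splitLabel.symm.surjective i
  rw [← hA (graphProj G) x (a, k), hfix]
  rfl

/-- A state supported on `ψ_G ⊗ (anything)` is a product state. -/
theorem exists_eq_joint_of_mul_eq_self
    {R : Matrix (∀ v, Fin 2 × Fin (m v)) (∀ v, Fin 2 × Fin (m v)) ℂ}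
    (hR : IsDensity R) (h : liftQubits m (graphProj G) * R = R) :
    ∃ σ, IsDensity σ ∧ R = joint (graphProj G) σ := by
  -- the isometry `φ ↦ ψ_G ⊗ φ`
  let w : Matrix (∀ v, Fin 2 × Fin (m v)) (∀ v, Fin (m v)) ℂ :=
    Matrix.of fun i a => graphState G (splitLabel i).1 * (1 : Matrix _ _ ℂ) (splitLabel i).2 a
  have hw : ∀ σ : Matrix (∀ v, Fin (m v)) (∀ v, Fin (m v)) ℂ,
      w * σ * wᴴ = joint (graphProj G) σ := by
    intro σ
    have hl : ∀ i b, (w * σ) i b = graphState G (splitLabel i).1 * σ (splitLabel i).2 b := by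
      intro i b
      rw [Matrix.mul_apply, Finset.sum_eq_single (splitLabel i).2]
      · simp [w]
      · intro a _ ha; simp [w, Matrix.one_apply_ne ha.symm]
      · simp
    ext i j
    rw [Matrix.mul_apply, Finset.sum_eq_single (splitLabel j).2]
    · have hj : wᴴ (splitLabel j).2 j = star (graphState G (splitLabel j).1) := by simp [w]
      rw [hl, hj, joint, Matrix.of_apply, graphProj, vecMulVec_apply]
      simp only [splitLabel, Equiv.coe_fn_mk, Pi.star_apply]
      ring
    · intro a _ ha; simp [w, Matrix.one_apply_ne ha.symm]
    · simp
  have h2 : R * liftQubits m (graphProj G) = R := by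
    have := congrArg conjTranspose h
    rwa [conjTranspose_mul, liftQubits, conjTranspose_joint, hR.1.isHermitian.eq, conjTranspose_one,
      (graphProj_isDensity G).1.isHermitian.eq] at this
  have hJ : w * wᴴ = liftQubits m (graphProj G) := by
    rw [liftQubits, ← hw, Matrix.mul_one]
  refine ⟨wᴴ * R * w, ⟨?_, ?_⟩, ?_⟩
  · exact hR.1.conjTranspose_mul_mul_same w
  · rw [Matrix.mul_assoc, Matrix.trace_mul_comm, Matrix.mul_assoc, hJ, h2, hR.2]
  · rw [← hw]
    calc R = w * wᴴ * R * (w * wᴴ) := by rw [hJ, h, h2]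
      _ = _ := by simp only [Matrix.mul_assoc]

end Joint

namespace BellData

variable {N : ℕ} {G : SimpleGraph (Fin N)} [DecidableRel G.Adj] {L : Type*} (D : BellData G L)

/-- A maximal strategy of a spanning Bell expression is equivalent to the graph state with the
prescribed observables. -/
theorem equivalent_of_spans (hG : G.Connected) (hP : D.P.Nonempty) (hsp : Spans D.rows)
    (Q : Strategy N) (hQ : ∀ l ∈ D.labels, D.normCorr Q l * Q.ρ = Q.ρ) : D.Equivalent Q := by
  have hanti := D.siteOp_anticomm_mul_eq_zero Q hG hP hsp hQ
  choose p hp hpp hKp hcomm g hg using fun v => exists_kernelProjector (Q.anticomm_isHermitian v)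
  have hpρ : tensorOp p * Q.ρ = Q.ρ := tensorOp_mul_eq_self fun v =>
    Q.siteOp_mul_eq_self_of_kernelProjector (hg v) (hanti v)
  let U : ∀ v, Matrix (Fin 2 × Fin (Q.d v)) (Fin (Q.d v)) ℂ := fun v =>
    swapIsometry (D.pauliLike Q v 1) (D.pauliLike Q v (-1)) (p v)
  have hU : ∀ v, (U v)ᴴ * U v = 1 := fun v =>
    swapIsometry_isometry (D.pauliLike_isHermitian Q v 1) (D.pauliLike_isHermitian Q v (-1)) (hp v)
      (hpp v) (D.pauliLike_commute Q (hcomm v) _) (D.pauliLike_sq_mul Q (hKp v) _)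
      (D.pauliLike_sq_mul Q (hKp v) _)
  have hUU : (tensorOp U)ᴴ * tensorOp U = 1 := by
    rw [conjTranspose_tensorOp, tensorOp_mul_tensorOp]
    simp only [hU]
    exact tensorOp_eq_one
  -- the isometries turn the operators `pauliLike` into Pauli matrices
  have hpauli : ∀ v s, U v * (D.pauliLike Q v s * p v) =
      qubitOp (Fin (Q.d v)) (pauliOf s) * (U v * p v) := by
    intro v s
    rcases signType_cases s with rfl | rfl | rfl
    · exact swapIsometry_mul_X (hpp v) (D.pauliLike_commute Q (hcomm v) _)
        (D.pauliLike_commute Q (hcomm v) _) (D.pauliLike_sq_mul Q (hKp v) _)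
        (D.pauliLike_sq_mul Q (hKp v) _) (D.pauliLike_anticomm_mul Q (hKp v))
    · exact swapIsometry_mul_Z (hpp v) (D.pauliLike_commute Q (hcomm v) _)
        (D.pauliLike_sq_mul Q (hKp v) _)
    · rw [pauliLike_zero, Matrix.one_mul]
      have : pauliOf 0 = 1 := by simp [pauliOf]
      rw [this, qubitOp_one, Matrix.one_mul]
  have hX : ∀ v, U v * (D.pauliLike Q v 1 * p v) =
      qubitOp (Fin (Q.d v)) pauliX * (U v * p v) := fun v => hpauli v 1
  have hZ : ∀ v, U v * (D.pauliLike Q v (-1) * p v) =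
      qubitOp (Fin (Q.d v)) pauliZ * (U v * p v) := fun v => hpauli v (-1)
  have hobs : ∀ v s, U v * (Q.obs v s * p v) =
      qubitOp (Fin (Q.d v)) (D.refObs v s) * (U v * p v) := by
    intro v s
    by_cases hv : v ∈ D.AC
    · have hr := ofReal_inv_sqrt_two_mul_self
      have hX' := hX v
      have hZ' := hZ v
      have hx : D.pauliLike Q v 1 = ((1 / Real.sqrt 2 : ℝ) : ℂ) • (Q.A v + Q.B v) := by
        rw [pauliLike, if_pos hv, if_pos rfl]
      have hz : D.pauliLike Q v (-1) = ((1 / Real.sqrt 2 : ℝ) : ℂ) • (Q.A v - Q.B v) := by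
        rw [pauliLike, if_pos hv, if_neg (by decide), if_pos rfl]
      rcases signType_cases s with rfl | rfl | rfl
      · have hA : Q.obs v 1 = ((1 / Real.sqrt 2 : ℝ) : ℂ) •
            (D.pauliLike Q v 1 + D.pauliLike Q v (-1)) := by
          rw [hx, hz, ← smul_add, smul_smul, hr, Strategy.obs, if_pos rfl]; module
        rw [hA, refObs, if_pos hv, if_pos rfl, Matrix.smul_mul, Matrix.add_mul, Matrix.mul_smul,
          Matrix.mul_add, hX', hZ', qubitOp_smul, qubitOp_add, Matrix.smul_mul, Matrix.add_mul]
      · have hB : Q.obs v (-1) = ((1 / Real.sqrt 2 : ℝ) : ℂ) •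
            (D.pauliLike Q v 1 - D.pauliLike Q v (-1)) := by
          rw [hx, hz, ← smul_sub, smul_smul, hr, Strategy.obs, if_neg (by decide), if_pos rfl]
          module
        rw [hB, refObs, if_pos hv, if_neg (by decide), if_pos rfl, Matrix.smul_mul, Matrix.sub_mul,
          Matrix.mul_smul, Matrix.mul_sub, hX', hZ', qubitOp_smul, qubitOp_sub, Matrix.smul_mul,
          Matrix.sub_mul]
      · rw [refObs, if_pos hv, if_neg (by decide), if_neg (by decide), qubitOp_one, Matrix.one_mul,
          Strategy.obs, if_neg (by decide), if_neg (by decide), Matrix.one_mul]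
    · have h := hpauli v s
      rw [pauliLike, if_neg hv] at h
      rw [refObs, if_neg hv, h]
  have htensor : ∀ (M : ∀ v, Matrix (Fin (Q.d v)) (Fin (Q.d v)) ℂ)
      (a : Fin N → Matrix (Fin 2) (Fin 2) ℂ),
      (∀ v, U v * (M v * p v) = qubitOp (Fin (Q.d v)) (a v) * (U v * p v)) →
      tensorOp U * (tensorOp M * Q.ρ) = liftQubits Q.d (tensorOp a) * (tensorOp U * Q.ρ) := by
    intro M a h
    have h1 : tensorOp U * (tensorOp M * tensorOp p) =
        liftQubits Q.d (tensorOp a) * (tensorOp U * tensorOp p) := by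
      rw [← tensorOp_qubitOp, tensorOp_mul_tensorOp, tensorOp_mul_tensorOp, tensorOp_mul_tensorOp,
        tensorOp_mul_tensorOp]
      exact congrArg tensorOp (funext h)
    have h2 := congrArg (· * Q.ρ) h1
    simpa only [Matrix.mul_assoc, hpρ] using h2
  set R := tensorOp U * Q.ρ * (tensorOp U)ᴴ with hR
  have hRd : IsDensity R := by
    refine ⟨Q.density.1.mul_mul_conjTranspose_same _, ?_⟩
    rw [hR, Matrix.trace_mul_comm, ← Matrix.mul_assoc, hUU, Matrix.one_mul, Q.density.2]
  have hΨ : liftQubits Q.d (graphProj G) * (tensorOp U * Q.ρ) = tensorOp U * Q.ρ := by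
    refine hsp.liftQubits_graphProj_mul_eq_self ?_
    rintro _ ⟨l, hl, rfl⟩
    rw [← stabilizer_eq_stabilizerOf, stabilizer_eq G _ (D.indep l),
      ← htensor (fun v => D.pauliLike Q v (settings G (D.C l) v)) _ fun v => hpauli v _]
    exact congrArg (tensorOp U * ·) (hQ l hl)
  obtain ⟨σ, hσ, hRσ⟩ := exists_eq_joint_of_mul_eq_self hRd
    (show liftQubits Q.d (graphProj G) * R = R by rw [hR, ← Matrix.mul_assoc, hΨ])
  refine ⟨Q.d, U, σ, hU, hσ, fun s => ?_⟩
  rw [htensor _ _ fun v => hobs v (s v), Matrix.mul_assoc, ← hR, hRσ, liftQubits, joint_mul_joint,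
    Matrix.one_mul]

end BellData

/-! ### Mixed states of a stabilizer code are not equivalent to the graph state -/

section Local

theorem rankOne_mul_self {m : Type*} [Fintype m] {t : m → ℂ} (ht : star t ⬝ᵥ t ≠ 0) :
    ((star t ⬝ᵥ t)⁻¹ • vecMulVec t (star t)) * ((star t ⬝ᵥ t)⁻¹ • vecMulVec t (star t)) =
      (star t ⬝ᵥ t)⁻¹ • vecMulVec t (star t) := by
  rw [Matrix.smul_mul, Matrix.mul_smul, vecMulVec_mul_vecMulVec, smul_smul]
  ext i j
  simp only [Matrix.smul_apply, vecMulVec_apply, Pi.smul_apply, smul_eq_mul]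
  field_simp

/-- A projector of rank two on `ℂ² ⊗ ℂ^m` that fixes `ℂ² ⊗ t` is the projector onto `ℂ² ⊗ t`. -/
theorem eq_kronecker_of_fix {m : Type*} [Fintype m] [DecidableEq m]
    {E : Matrix (Fin 2 × m) (Fin 2 × m) ℂ} (hE : E.IsHermitian) (hEE : E * E = E)
    (htr : E.trace = 2) {t : m → ℂ} (ht : star t ⬝ᵥ t ≠ 0)
    (hfix : ∀ i b, ∑ a, E i (b, a) * t a = if i.1 = b then t i.2 else 0) :
    E = kroneckerMap (· * ·) 1 ((star t ⬝ᵥ t)⁻¹ • vecMulVec t (star t)) := by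
  set τ := (star t ⬝ᵥ t)⁻¹ • vecMulVec t (star t) with hτ
  have hn : star (star t ⬝ᵥ t) = star t ⬝ᵥ t := by
    simp [dotProduct, mul_comm]
  have hττ : τ * τ = τ := rankOne_mul_self ht
  have hτH : τᴴ = τ := by
    rw [hτ, conjTranspose_smul, conjTranspose_vecMulVec, star_star, star_inv₀, hn]
  have hτtr : τ.trace = 1 := by
    rw [hτ, Matrix.trace_smul, trace_vecMulVec, dotProduct_comm t, smul_eq_mul, inv_mul_cancel₀ ht]
  set F : Matrix (Fin 2 × m) (Fin 2 × m) ℂ := kroneckerMap (· * ·) 1 τ with hF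
  have hFF : F * F = F := by
    rw [hF, ← mul_kronecker_mul, hττ, Matrix.one_mul]
  have hFH : Fᴴ = F := by
    rw [hF, conjTranspose_kronecker, hτH, conjTranspose_one]
  have hFtr : F.trace = 2 := by
    rw [hF, trace_kronecker, hτtr]; simp
  have hEF : E * F = F := by
    ext i ⟨b, j⟩
    rw [Matrix.mul_apply, Fintype.sum_prod_type]
    have h1 : ∀ c, ∑ a, E i (c, a) * F (c, a) (b, j) =
        if c = b then (if i.1 = b then t i.2 else 0) * ((star t ⬝ᵥ t)⁻¹ * star t j) else 0 := by
      intro c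
      by_cases hcb : c = b
      · subst hcb
        rw [if_pos rfl, ← hfix, Finset.sum_mul]
        refine Finset.sum_congr rfl fun a _ => ?_
        simp only [hF, hτ, kroneckerMap_apply, Matrix.one_apply_eq, Matrix.smul_apply,
          vecMulVec_apply, smul_eq_mul]
        ring
      · rw [if_neg hcb]
        refine Finset.sum_eq_zero fun a _ => ?_
        simp [hF, kroneckerMap_apply, Matrix.one_apply_ne hcb]
    simp only [h1, Finset.sum_ite_eq', Finset.mem_univ, if_true]
    obtain ⟨c, k⟩ := i
    by_cases hcb : c = b
    · subst hcb
      simp only [if_true, hF, hτ, kroneckerMap_apply, Matrix.one_apply_eq, Matrix.smul_apply,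
          vecMulVec_apply, smul_eq_mul]
      ring
    · simp [hcb, hF, kroneckerMap_apply, Matrix.one_apply_ne hcb]
  have hFE : F * E = F := by
    have := congrArg conjTranspose hEF
    rwa [conjTranspose_mul, hE.eq, hFH] at this
  -- `F ≤ E`, so `E - F` is a projector, of trace zero
  have hD : (E - F)ᴴ * (E - F) = E - F := by
    rw [conjTranspose_sub, hE.eq, hFH, Matrix.sub_mul, Matrix.mul_sub, Matrix.mul_sub, hEE, hEF,
      hFE, hFF, sub_self, sub_zero]
  have h0 : ((E - F)ᴴ * (E - F)).trace = 0 := by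
    rw [hD, Matrix.trace_sub, htr, hFtr, sub_self]
  exact sub_eq_zero.mp (Matrix.trace_conjTranspose_mul_self_eq_zero_iff.mp h0)

end Local

section NotEquivalent

variable {N : ℕ}

theorem siteOp_mul_apply {α : Fin N → Type*} [∀ v, Fintype (α v)] [∀ v, DecidableEq (α v)]
    {κ : Type*} (v : Fin N) (E : Matrix (α v) (α v) ℂ) (R : Matrix (∀ v, α v) κ ℂ) (i : ∀ v, α v)
    (k : κ) : (siteOp v E * R : Matrix _ _ ℂ) i k =
      ∑ j, E (i v) j * R (Function.update i v j) k := by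
  rw [Matrix.mul_apply]
  symm
  refine Finset.sum_of_injOn (Function.update i v)
    (Function.update_injective i v).injOn (fun _ _ => Finset.mem_coe.mpr (Finset.mem_univ _)) ?_ ?_
  · intro j _ hj
    rw [siteOp, tensorOp_update_apply]
    have : ∃ w, w ≠ v ∧ i w ≠ j w := by
      by_contra! h
      refine hj ⟨j v, Finset.mem_coe.mpr (Finset.mem_univ _), ?_⟩
      funext w
      by_cases hw : w = v
      · subst hw; simp
      · rw [Function.update_of_ne hw, h w hw]
    obtain ⟨w, hw, hij⟩ := this
    have hz : ∏ u ∈ Finset.univ.erase v, (1 : Matrix (α u) (α u) ℂ) (i u) (j u) = 0 :=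
      Finset.prod_eq_zero (Finset.mem_erase.mpr ⟨hw, Finset.mem_univ w⟩) (Matrix.one_apply_ne hij)
    rw [hz, mul_zero, zero_mul]
  · intro j _
    rw [siteOp, tensorOp_update_apply, Function.update_self, Finset.prod_eq_one, mul_one]
    intro w hw
    rw [Function.update_of_ne (Finset.ne_of_mem_erase hw), Matrix.one_apply_eq]

theorem trace_tensorOp {α : Fin N → Type*} [∀ v, Fintype (α v)]
    (M : ∀ v, Matrix (α v) (α v) ℂ) : (tensorOp M).trace = ∏ v, (M v).trace := by
  classical
  simp only [Matrix.trace, Matrix.diag_apply, tensorOp, Matrix.of_apply]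
  rw [Finset.prod_univ_sum, Fintype.piFinset_univ]

variable (G : SimpleGraph (Fin N)) [DecidableRel G.Adj]

/-- On the labels supported at two adjacent vertices the graph state has the amplitudes of a
two-qubit graph state. -/
theorem graphState_update_single {v w : Fin N} (hvw : G.Adj v w) (c d : ZMod 2) :
    graphState G (bits.symm (Function.update (Pi.single w d) v c)) =
      sgn (c * d) * ((1 / Real.sqrt 2 : ℝ) : ℂ) ^ N := by
  rw [graphState_eq, Equiv.apply_symm_apply]
  congr 2
  have h0 : edgeParity G 0 = 0 := by simp [edgeParity]
  have hd : ∀ d, edgeParity G (Pi.single w d) = 0 := by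
    intro d
    rcases zmod_two_cases d with rfl | rfl
    · rw [Pi.single_zero, h0]
    · rw [← zero_add (Pi.single w 1), edgeParity_add_single, h0]; simp
  rcases zmod_two_cases c with rfl | rfl
  · have : Function.update (Pi.single w d) v 0 = (Pi.single w d : Fin N → ZMod 2) := by
      rw [Function.update_eq_self_iff, Pi.single_eq_of_ne hvw.ne]
    rw [this, hd, zero_mul]
  · have : Function.update (Pi.single w d) v 1 =
        (Pi.single w d + Pi.single v 1 : Fin N → ZMod 2) := by
      funext u
      by_cases hu : u = v
      · subst hu; simp [Pi.single_eq_of_ne hvw.ne]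
      · simp [hu]
    rw [this, edgeParity_add_single, hd, zero_add, one_mul, Finset.sum_eq_single w]
    · simp [hvw]
    · intro b _ hb; simp [hb]
    · simp

theorem graphState_update_single_fin {v w : Fin N} (hvw : G.Adj v w) (c d : Fin 2) :
    graphState G (Function.update (Pi.single w d) v c) =
      (if c = 1 ∧ d = 1 then -1 else 1) * ((1 / Real.sqrt 2 : ℝ) : ℂ) ^ N := by
  have h : graphState G (Function.update (Pi.single w d) v c) =
      sgn ((show ZMod 2 from c) * (show ZMod 2 from d)) * ((1 / Real.sqrt 2 : ℝ) : ℂ) ^ N :=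
    graphState_update_single G hvw c d
  have hsgn : ∀ a b : ZMod 2, sgn (a * b) = if a = 1 ∧ b = 1 then -1 else 1 := by
    intro a b
    rcases zmod_two_cases a with rfl | rfl <;> rcases zmod_two_cases b with rfl | rfl <;>
      simp [sgn]
  rw [h]
  congr 1
  exact hsgn c d

variable {G} {m : Fin N → ℕ}

theorem graphState_zero_ne (x : Qubits N) : graphState G x ≠ 0 := by
  intro h
  have := graphState_mul_self G x
  rw [h, zero_mul] at this
  exact (inv_ne_zero (pow_ne_zero N two_ne_zero)) this.symm

theorem joint_graphProj_injective :
    Function.Injective (joint (graphProj G) :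
      Matrix (∀ v, Fin (m v)) (∀ v, Fin (m v)) ℂ → _) := by
  intro σ σ' h
  ext a b
  have h1 := congrFun (congrFun h (splitLabel.symm (0, a))) (splitLabel.symm (0, b))
  have h2 : graphProj G 0 0 * σ a b = graphProj G 0 0 * σ' a b := h1
  refine mul_left_cancel₀ ?_ h2
  rw [graphProj, vecMulVec_apply, Pi.star_apply, star_graphState]
  exact mul_ne_zero (graphState_zero_ne 0) (graphState_zero_ne 0)

/-- If a local operator `E` at a vertex with a neighbour fixes `ψ_G ⊗ σ`, then it fixes
`ℂ² ⊗ t` for every local slice `t` of `σ`, since `ψ_G` has full local support. -/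
theorem sum_mul_slice_eq {v w : Fin N} (hvw : G.Adj v w)
    {E : Matrix (Fin 2 × Fin (m v)) (Fin 2 × Fin (m v)) ℂ}
    {σ : Matrix (∀ v, Fin (m v)) (∀ v, Fin (m v)) ℂ}
    (hE : siteOp (α := fun v => Fin 2 × Fin (m v)) v E * joint (graphProj G) σ =
      joint (graphProj G) σ)
    (a b : ∀ v, Fin (m v)) (i : Fin 2 × Fin (m v)) (c : Fin 2) :
    ∑ k, E i (c, k) * σ (Function.update a v k) b = if i.1 = c then σ (Function.update a v i.2) b
      else 0 := by
  obtain ⟨c₀, k₀⟩ := i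
  set r : ℂ := ((1 / Real.sqrt 2 : ℝ) : ℂ) ^ N with hr
  set S : Fin 2 → ℂ := fun c => ∑ k, E (c₀, k₀) (c, k) * σ (Function.update a v k) b with hS
  let q : Fin 2 → Fin 2 → Qubits N := fun d c => Function.update (Pi.single w d) v c
  have hent : ∀ (d c : Fin 2) (a' : ∀ v, Fin (m v)),
      joint (graphProj G) σ (splitLabel.symm (q d c, a')) (splitLabel.symm (0, b)) =
        r * graphState G 0 * ((if c = 1 ∧ d = 1 then -1 else 1) * σ a' b) := by
    intro d c a'
    have h1 : joint (graphProj G) σ (splitLabel.symm (q d c, a')) (splitLabel.symm (0, b)) =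
      graphProj G (q d c) 0 * σ a' b := rfl
    have h2 : graphState G (q d c) = (if c = 1 ∧ d = 1 then -1 else 1) * r :=
      graphState_update_single_fin G hvw c d
    rw [h1, graphProj, vecMulVec_apply, Pi.star_apply, star_graphState, h2]
    ring
  have hne : r * graphState G 0 ≠ 0 := by
    refine mul_ne_zero (pow_ne_zero _ ?_) (graphState_zero_ne 0)
    rw [Complex.ofReal_ne_zero]
    positivity
  -- the two values of a neighbouring qubit give independent combinations of `S 0` and `S 1`
  have key : ∀ d : Fin 2, S 0 + (if d = 1 then -1 else 1) * S 1 =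
      (if c₀ = 1 ∧ d = 1 then -1 else 1) * σ (Function.update a v k₀) b := by
    intro d
    have h := congrFun (congrFun hE (splitLabel.symm (q d c₀, Function.update a v k₀)))
      (splitLabel.symm (0, b))
    rw [siteOp_mul_apply] at h
    have hqv : (splitLabel.symm (q d c₀, Function.update a v k₀) : ∀ v, Fin 2 × Fin (m v)) v =
        (c₀, k₀) := by
      simp [splitLabel, q]
    have hup : ∀ j : Fin 2 × Fin (m v),
        Function.update (splitLabel.symm (q d c₀, Function.update a v k₀)) v j =
          splitLabel.symm (q d j.1, Function.update a v j.2) := by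
      intro j
      funext u
      by_cases hu : u = v
      · subst hu; simp [splitLabel, q]
      · simp [splitLabel, q, hu]
    rw [hqv, Fintype.sum_prod_type, Fin.sum_univ_two] at h
    simp only [hup, hent] at h
    refine mul_left_cancel₀ hne ?_
    rw [← h, mul_add, hS]
    simp only [Finset.mul_sum]
    congr 1
    · refine Finset.sum_congr rfl fun k _ => ?_
      rw [if_neg (fun h0 => zero_ne_one h0.1)]
      ring
    · refine Finset.sum_congr rfl fun k _ => ?_
      simp only [true_and]
      ring
  have k0 := key 0
  have k1 := key 1
  change S c = _
  fin_cases c₀ <;> fin_cases c <;> simp at k0 k1 ⊢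
  · linear_combination (1 / 2 : ℂ) * k0 + (1 / 2 : ℂ) * k1
  · linear_combination (1 / 2 : ℂ) * k0 - (1 / 2 : ℂ) * k1
  · linear_combination (1 / 2 : ℂ) * k0 + (1 / 2 : ℂ) * k1
  · linear_combination (1 / 2 : ℂ) * k0 - (1 / 2 : ℂ) * k1

/-- If local isometries take a state of `N` qubits to `ψ_G ⊗ σ`, then that state is pure: since
the local supports of `ψ_G` are already two-dimensional, `σ` is a pure product state. -/
theorem mul_self_eq_self_of_stateEquivalent (hG : ∀ v, ∃ w, G.Adj v w) {Q : Strategy N}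
    (hd : ∀ v, Q.d v = 2) (h : StateEquivalent G Q) : Q.ρ * Q.ρ = Q.ρ := by
  obtain ⟨m, U, σ, hU, hσ, hR⟩ := h
  have hUU : (tensorOp U)ᴴ * tensorOp U = 1 := by
    rw [conjTranspose_tensorOp, tensorOp_mul_tensorOp]
    simp only [hU]
    exact tensorOp_eq_one
  let E : ∀ v, Matrix (Fin 2 × Fin (m v)) (Fin 2 × Fin (m v)) ℂ := fun v => U v * (U v)ᴴ
  have hEfix : ∀ v, siteOp (α := fun v => Fin 2 × Fin (m v)) v (E v) * joint (graphProj G) σ =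
      joint (graphProj G) σ := by
    intro v
    have : siteOp (α := fun v => Fin 2 × Fin (m v)) v (E v) * tensorOp U = tensorOp U := by
      rw [siteOp, tensorOp_mul_tensorOp]
      congr 1
      funext u
      by_cases hu : u = v
      · subst hu
        rw [Function.update_self, Matrix.mul_assoc, hU, Matrix.mul_one]
      · rw [Function.update_of_ne hu, Matrix.one_mul]
    rw [← hR, ← Matrix.mul_assoc, ← Matrix.mul_assoc, this]
  obtain ⟨a, b, hab⟩ : ∃ a b, σ a b ≠ 0 := by
    by_contra! h0
    have : σ = 0 := by ext a b; exact h0 a b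
    have htr := hσ.2
    rw [this, Matrix.trace_zero] at htr
    exact zero_ne_one htr
  let t : ∀ v, Fin (m v) → ℂ := fun v k => σ (Function.update a v k) b
  have ht : ∀ v, star (t v) ⬝ᵥ t v ≠ 0 := by
    intro v h0
    refine hab ?_
    have := congrFun (dotProduct_star_self_eq_zero.mp h0) (a v)
    simpa [t] using this
  let τ : ∀ v, Matrix (Fin (m v)) (Fin (m v)) ℂ := fun v =>
    (star (t v) ⬝ᵥ t v)⁻¹ • vecMulVec (t v) (star (t v))
  -- the range of each local isometry is `ℂ² ⊗ t v`
  have hE : ∀ v, E v = kroneckerMap (· * ·) 1 (τ v) := by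
    intro v
    obtain ⟨w, hw⟩ := hG v
    refine eq_kronecker_of_fix ?_ ?_ ?_ (ht v) fun i c => ?_
    · rw [Matrix.IsHermitian, conjTranspose_mul, conjTranspose_conjTranspose]
    · calc E v * E v = U v * ((U v)ᴴ * U v) * (U v)ᴴ := by simp only [E, Matrix.mul_assoc]
        _ = E v := by rw [hU, Matrix.mul_one]
    · rw [Matrix.trace_mul_comm, hU, Matrix.trace_one, Fintype.card_fin, hd]
      norm_num
    · exact sum_mul_slice_eq hw (hEfix v) a b i c
  have htens : tensorOp U * (tensorOp U)ᴴ = joint 1 (tensorOp τ) := by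
    rw [conjTranspose_tensorOp, tensorOp_mul_tensorOp, ← tensorOp_eq_one]
    ext i j
    change ∏ v, E v (i v) (j v) = _
    simp only [hE, kroneckerMap_apply, Finset.prod_mul_distrib]
    rfl
  set R := tensorOp U * Q.ρ * (tensorOp U)ᴴ with hRdef
  have hσ1 : tensorOp τ * σ * tensorOp τ = σ := by
    refine joint_graphProj_injective (G := G) ?_
    have h1 : joint 1 (tensorOp τ) * R * joint 1 (tensorOp τ) = R := by
      rw [← htens, hRdef]
      calc tensorOp U * (tensorOp U)ᴴ * (tensorOp U * Q.ρ * (tensorOp U)ᴴ) *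
            (tensorOp U * (tensorOp U)ᴴ)
          = tensorOp U * ((tensorOp U)ᴴ * tensorOp U) * Q.ρ * ((tensorOp U)ᴴ * tensorOp U) *
            (tensorOp U)ᴴ := by simp only [Matrix.mul_assoc]
        _ = _ := by rw [hUU, Matrix.mul_one, Matrix.mul_one]
    rwa [hR, joint_mul_joint, joint_mul_joint, Matrix.one_mul, Matrix.mul_one] at h1
  -- `tensorOp τ` is a projector of rank one
  let T : (∀ v, Fin (m v)) → ℂ := fun x => ∏ v, t v (x v)
  have hτT : tensorOp τ = (∏ v, (star (t v) ⬝ᵥ t v)⁻¹) • vecMulVec T (star T) := by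
    rw [tensorOp_smul_factor]
    congr 1
    ext x y
    simp [tensorOp, vecMulVec_apply, T, Finset.prod_mul_distrib]
  have hτtr : (tensorOp τ).trace = 1 := by
    rw [trace_tensorOp]
    refine Finset.prod_eq_one fun v _ => ?_
    rw [Matrix.trace_smul, trace_vecMulVec, dotProduct_comm (t v), smul_eq_mul,
      inv_mul_cancel₀ (ht v)]
  obtain ⟨c, hc⟩ : ∃ c : ℂ, σ = c • tensorOp τ := by
    refine ⟨(∏ v, (star (t v) ⬝ᵥ t v)⁻¹) * (star T ⬝ᵥ σ *ᵥ T), ?_⟩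
    conv_lhs => rw [← hσ1]
    rw [hτT, Matrix.smul_mul, Matrix.smul_mul, Matrix.mul_smul, vecMulVec_mul,
      vecMulVec_mul_vecMulVec, ← dotProduct_mulVec]
    ext x y
    simp only [vecMulVec_apply, Matrix.smul_apply, Pi.smul_apply, smul_eq_mul]
    ring
  have hc1 : c = 1 := by
    have := congrArg Matrix.trace hc
    rwa [hσ.2, Matrix.trace_smul, hτtr, smul_eq_mul, mul_one, eq_comm] at this
  rw [hc1, one_smul] at hc
  have hσσ : σ * σ = σ := by
    rw [hc, tensorOp_mul_tensorOp]
    exact congrArg tensorOp (funext fun v => rankOne_mul_self (ht v))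
  have hRR : R * R = R := by
    rw [hR, joint_mul_joint, graphProj_mul_self, hσσ]
  have hpull : ∀ M : Matrix (∀ v, Fin (Q.d v)) (∀ v, Fin (Q.d v)) ℂ,
      (tensorOp U)ᴴ * (tensorOp U * M * (tensorOp U)ᴴ) * tensorOp U = M := by
    intro M
    calc (tensorOp U)ᴴ * (tensorOp U * M * (tensorOp U)ᴴ) * tensorOp U
        = (tensorOp U)ᴴ * tensorOp U * M * ((tensorOp U)ᴴ * tensorOp U) := by
          simp only [Matrix.mul_assoc]
      _ = M := by rw [hUU, Matrix.one_mul, Matrix.mul_one]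
  have h2 : R * R = tensorOp U * (Q.ρ * Q.ρ) * (tensorOp U)ᴴ := by
    calc R * R = tensorOp U * Q.ρ * ((tensorOp U)ᴴ * tensorOp U) * Q.ρ * (tensorOp U)ᴴ := by
          rw [hRdef]; simp only [Matrix.mul_assoc]
      _ = _ := by rw [hUU, Matrix.mul_one]; simp only [Matrix.mul_assoc]
  rw [← hpull (Q.ρ * Q.ρ), ← h2, hRR, hRdef, hpull]

end NotEquivalent

theorem theorem2 {N : ℕ} (G : SimpleGraph (Fin N)) [DecidableRel G.Adj] (hG : G.Connected)
    {L : Type*} (D : BellData G L) (hP : D.P.Nonempty) :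
    (D.SelfTests ↔ D.Determines) ∧
    (D.Determines ↔ D.ContainsIndependent) ∧
    (¬ D.Determines → ∃ Q : Strategy N, D.IsMaximal Q ∧ ¬ StateEquivalent G Q) := by
  have hmixed : ¬ D.Determines → ∃ Q : Strategy N, D.IsMaximal Q ∧ ¬ StateEquivalent G Q := by
    intro hD
    rw [D.determines_iff_spans] at hD
    obtain ⟨ρ, hρ, hsq, htr⟩ := exists_mixed_of_not_spans G hD
    refine ⟨D.refStrategy hρ, (D.isMaximal_iff _).mpr (D.value_refStrategy hρ htr), fun h => ?_⟩
    -- a stabilizer with `Z` at some vertex exists, so the graph has an edge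
    have hadj : ∀ v, ∃ w, G.Adj v w := by
      obtain ⟨p, hp⟩ := hP
      obtain ⟨T, -, hs, -⟩ := D.pair_AC p hp
      obtain ⟨i, hi⟩ : ∃ i, G.Adj i T := by
        by_contra! hno
        have hset : ∀ C, settings G C T ≠ -1 := by
          intro C
          simp only [settings, hno]
          split_ifs <;> simp_all
        rcases sign_cases_of_mul_eq_neg_one hs with ⟨-, h2⟩ | ⟨h1, -⟩
        · exact hset _ h2
        · exact hset _ h1
      intro v
      by_cases hvT : v = T
      · exact ⟨i, hvT ▸ hi.symm⟩
      · obtain ⟨walk⟩ := hG.preconnected v T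
        cases walk with
        | nil => exact absurd rfl hvT
        | cons hvw _ => exact ⟨_, hvw⟩
    have hpure : ρ * ρ = ρ :=
      mul_self_eq_self_of_stateEquivalent hadj (Q := D.refStrategy hρ) (fun _ => rfl) h
    rw [hpure] at hsq
    have := congrArg Matrix.trace hsq
    rw [Matrix.trace_smul, hρ.2] at this
    norm_num at this
  refine ⟨⟨fun hself => ?_, fun hD Q hQ => ?_⟩, ?_, hmixed⟩
  · by_contra hD
    obtain ⟨Q, hQ, hne⟩ := hmixed hD
    obtain ⟨m, U, σ, hU, hσ, h⟩ := hself Q hQ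
    refine hne ⟨m, U, σ, hU, hσ, ?_⟩
    -- the trivial choice of observables
    have h0 := h 0
    have h1 : ∀ v, Q.obs v ((0 : Fin N → SignType) v) = 1 := fun v => by
      simp [Strategy.obs]
    have h2 : ∀ v, D.refObs v ((0 : Fin N → SignType) v) = 1 := fun v => by
      by_cases hv : v ∈ D.AC <;> simp [BellData.refObs, pauliOf, hv]
    simp only [h1, h2] at h0
    rwa [tensorOp_eq_one, Matrix.one_mul, tensorOp_eq_one, Matrix.one_mul] at h0
  · exact D.equivalent_of_spans hG hP (D.determines_iff_spans.mp hD) Q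
      ((D.value_eq_maxValue_iff Q).mp ((D.isMaximal_iff Q).mp hQ))
  · rw [D.determines_iff_spans, D.containsIndependent_iff_spans]
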